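/- Let $d\ge 1$, fix a scaling $\mathfrak s\in\mathbb N^d$ (all $\mathfrak s_i\ge 1$), $|\mathfrak s|=\sum_i\mathfrak s_i$, $\|x\|_{\mathfrak s}=\sup_i|x_i|^{1/\mathfrak s_i}$, and let $Q(x,R)$ be the ball of centre $x$ and radius $R$ for $\|\cdot\|_{\mathfrak s}$ in $\mathbb R^d$. Let $(\mathcal A,\mathcal T,\mathcal G)$ be a regularity structure, $\mathcal T=\bigoplus_{\zeta\in\mathcal A}\mathcal T_\zeta$ with Banach spaces $\mathcal T_\zeta$, and let $(\Pi,\Gamma)$ be a model for it on $\mathbb R^d$ with scaling $\mathfrak s$. Write $|\tau|_\zeta$ for the norm of the $\mathcal T_\zeta$-component of $\tau\in\mathcal T$, $\mathcal A_\gamma=\mathcal A\cap(-\infty,\gamma)$, $\mathcal T_\gamma^-=\bigoplus_{\beta\in\mathcal A_\gamma}\mathcal T_\beta$, $\mathcal Q_{<\gamma}$ for the projection of $\mathcal T$ onto $\mathcal T_\gamma^-$, and $\Delta_{\Gamma,h}f(x)=f(x+h)-\Gamma_{x+h,x}f(x)$. Let $L^q_\lambda=L^q((0,1],\lambda^{-1}\mathrm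 d\lambda)$ and $L^p=L^p(\mathbb R^d,\mathrm dx)$. For $\gamma>0$, $1\le p<\infty$ and $1\le q\le\infty$, let $\mathcal F^\gamma_{p,q}$ be the space of all $f\colon\mathbb R^d\to\mathcal T_\gamma^-$ with (strongly) measurable components and finite norm $$\|f\|_{\mathcal F^\gamma_{p,q}}=\sup_{\zeta\in\mathcal A_\gamma}\big\||f(x)|_\zeta\big\|_{L^p}+\sup_{\zeta\in\mathcal A_\gamma}\bigg\|\Big\|\frac1{|Q(0,4\lambda)|}\int_{Q(0,4\lambda)}\frac{|\Delta_{\Gamma,h}f(x)|_\zeta}{\lambda^{\gamma-\zeta}}\,\mathrm dh\Big\|_{L^q_\lambda}\bigg\|_{L^p},$$ and let $\mathcal B^\gamma_{p,q}$ be the space of all such $f$ with finite norm $$\|f\|_{\mathcal B^\gamma_{p,q}}=\sup_{\zeta\in\mathcal A_\gamma}\big\||f(x)|_\zeta\big\|_{L^p}+\sup_{\zeta\in\mathcal A_\gamma}\bigg(\int_{Q(0,1)}\Big\|\frac{|\Delta_{\Gamma,h}f(x)|_\zeta}{\|h\|_{\mathfrak s}^{\gamma-\zeta}}\Big\|_{L^p}^q\frac{\mathrm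 dh}{\|h\|_{\mathfrak s}^{|\mathfrak s|}}\bigg)^{1/q}$$ (with the usual modification for $q=\infty$). For $\gamma\le\bar\gamma$, an embedding $X\subset Y$ of a space $X$ of maps into $\mathcal T^-_{\bar\gamma}$ into a space $Y$ of maps into $\mathcal T^-_\gamma$ means that $f\mapsto\mathcal Q_{<\gamma}f$ maps $X$ into $Y$ and that there is a constant $C$ with $\|\mathcal Q_{<\gamma}f\|_Y\le C\|f\|_X$ for all $f\in X$. Let $0<\gamma\le\bar\gamma$ with $\gamma\notin\mathcal A$, let $1\le q,\bar q,r\le\infty$ and $1\le p,\bar p<\infty$. Then: (i) $\mathcal F^{\bar\gamma}_{p,\bar q}\subset\mathcal F^\gamma_{p,q}$ if $q<\bar q$ and $\gamma<\bar\gamma$; (ii) $\mathcal F^{\bar\gamma}_{\bar p,q}\subset\mathcal F^\gamma_{p,r}$ if $\bar p<p$ and $\gamma<\bar\gamma-|\mathfrak s|(1/\bar p-1/p)$; (iii) $\mathcal F^{\bar\gamma}_{\bar p,q}\subset\mathcal B^\gamma_{p,\bar p}$ if $\bar p<p$ and $\gamma<\bar\gamma-|\mathfrak s|(1/\bar p-1/p)$.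 -/

import Mathlib

open MeasureTheory Set
open scoped ENNReal NNReal Distributions DirectSum

universe u

noncomputable section

/-! ### The scaled geometry of `ℝ^d` -/

/-- The total degree `|𝔰| = 𝔰₁ + ⋯ + 𝔰_d` of a scaling. -/
def scalingSum {d : ℕ} (𝔰 : Fin d → ℕ) : ℕ := ∑ i, 𝔰 i

/-- The scaled supremum "norm" `‖x‖_𝔰 = sup_i |x_i|^{1/𝔰_i}`. -/
def scaledNorm {d : ℕ} (𝔰 : Fin d → ℕ) (x : Fin d → ℝ) : ℝ :=
  ⨆ i, |x i| ^ (1 / (𝔰 i : ℝ))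

/-- The (closed) scaled ball `Q(x, R)`. -/
def scaledBall {d : ℕ} (𝔰 : Fin d → ℕ) (x : Fin d → ℝ) (R : ℝ) : Set (Fin d → ℝ) :=
  {z | scaledNorm 𝔰 (z - x) ≤ R}

/-! ### Test functions -/

/-- Smooth, compactly supported real functions on `ℝ^d`. -/
abbrev TestFun (d : ℕ) := 𝓓((⊤ : TopologicalSpace.Opens (Fin d → ℝ)), ℝ)

/-- Schwartz distributions on `ℝ^d`. -/
abbrev Distr (d : ℕ) := 𝓓'((⊤ : TopologicalSpace.Opens (Fin d → ℝ)), ℝ)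

/-- The map `z ↦ (l^{-𝔰_i} (z_i - x_i))_i`. -/
def rescaleHomeo {d : ℕ} (𝔰 : Fin d → ℕ) (l : ℝ) (hl : 0 < l) (x : Fin d → ℝ) :
    (Fin d → ℝ) ≃ₜ (Fin d → ℝ) where
  toFun z := fun i => (l ^ 𝔰 i)⁻¹ * (z i - x i)
  invFun w := fun i => l ^ 𝔰 i * w i + x i
  left_inv z := by
    funext i
    have : l ^ 𝔰 i ≠ 0 := (pow_pos hl _).ne'
    simp [this]
  right_inv w := by
    funext i
    have : l ^ 𝔰 i ≠ 0 := (pow_pos hl _).ne'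
    simp [this]
  continuous_toFun := by fun_prop
  continuous_invFun := by fun_prop

/-- The rescaled and recentred test function
`η^l_x(z) = l^{-|𝔰|} η(l^{-𝔰₁}(z₁ - x₁), …, l^{-𝔰_d}(z_d - x_d))`. -/
def rescale {d : ℕ} (𝔰 : Fin d → ℕ) (η : TestFun d) (l : ℝ) (hl : 0 < l) (x : Fin d → ℝ) :
    TestFun d where
  toFun z := (l ^ scalingSum 𝔰)⁻¹ * η (fun i => (l ^ 𝔰 i)⁻¹ * (z i - x i))
  contDiff' := by
    refine contDiff_const.mul (η.contDiff.comp ?_)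
    fun_prop
  hasCompactSupport' :=
    (η.hasCompactSupport.comp_homeomorph (rescaleHomeo 𝔰 l hl x)).mul_left
  tsupport_subset' := fun _ _ => trivial

/-- The class `𝓑^r`: smooth functions supported in `Q(0,1)` all of whose partial derivatives of
scaled degree at most `r` are bounded by one. An iterated partial derivative is specified by the
sequence `j` of directions in which one differentiates; its scaled degree is `∑ 𝔰 (j m)`. -/
def IsUnitTest {d : ℕ} (𝔰 : Fin d → ℕ) (r : ℕ) (η : TestFun d) : Prop :=
  tsupport (η : (Fin d → ℝ) → ℝ) ⊆ scaledBall 𝔰 0 1 ∧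
  ∀ (n : ℕ) (j : Fin n → Fin d), ∑ m, 𝔰 (j m) ≤ r → ∀ x : Fin d → ℝ,
    |iteratedFDeriv ℝ n (η : (Fin d → ℝ) → ℝ) x (fun m => Pi.single (j m) 1)| ≤ 1

/-! ### Regularity structures and models -/

/-- A regularity structure `(𝒜, 𝒯, 𝒢)`. -/
structure RegularityStructure where
  /-- The set of homogeneities. -/
  A : Set ℝ
  bddBelow : BddBelow A
  locallyFinite : ∀ a b : ℝ, (A ∩ Icc a b).Finite
  /-- The Banach spaces `𝒯_ζ`. -/
  T : A → Type u
  [normed : ∀ ζ, NormedAddCommGroup (T ζ)]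
  [space : ∀ ζ, NormedSpace ℝ (T ζ)]
  [complete : ∀ ζ, CompleteSpace (T ζ)]
  /-- The structure group, a group of linear maps of the model space `⨁ ζ, 𝒯_ζ`. -/
  G : Subgroup ((⨁ ζ, T ζ) ≃ₗ[ℝ] (⨁ ζ, T ζ))
  /-- `Γ τ - τ ∈ ⨁_{β < ζ} 𝒯_β` for `τ ∈ 𝒯_ζ`. -/
  triangular : ∀ g ∈ G, ∀ (ζ : A) (τ : T ζ) (β : A), ζ ≤ β →
    (g (DirectSum.lof ℝ A T ζ τ) - DirectSum.lof ℝ A T ζ τ) β = 0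

namespace RegularityStructure

attribute [instance] RegularityStructure.normed RegularityStructure.space
  RegularityStructure.complete

/-- The model space `𝒯 = ⨁_{ζ ∈ 𝒜} 𝒯_ζ`. -/
abbrev ModelSpace (R : RegularityStructure.{u}) : Type u := ⨁ ζ, R.T ζ

/-- The set `𝒜_γ = 𝒜 ∩ (-∞, γ)`, as a set of indices. -/
def lowIndices (R : RegularityStructure.{u}) (γ : ℝ) : Set R.A := {ζ | (ζ : ℝ) < γ}

/-- The subspace `𝒯_γ^- = ⨁_{β ∈ 𝒜_γ} 𝒯_β`. -/
def lowSpace (R : RegularityStructure.{u}) (γ : ℝ) : Submodule ℝ R.ModelSpace where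
  carrier := {τ | ∀ ζ : R.A, γ ≤ (ζ : ℝ) → τ ζ = 0}
  add_mem' := by
    intro a b ha hb ζ hζ
    rw [DirectSum.add_apply, ha ζ hζ, hb ζ hζ, add_zero]
  zero_mem' := by
    intro ζ _
    simp
  smul_mem' := by
    intro c a ha ζ hζ
    rw [DirectSum.smul_apply, ha ζ hζ, smul_zero]

/-- The projection `𝒬_{<γ}` of `𝒯` onto `𝒯_γ^-`. -/
def projLow (R : RegularityStructure.{u}) (γ : ℝ) : R.ModelSpace →ₗ[ℝ] R.ModelSpace :=
  DFinsupp.filterLinearMap ℝ R.T (fun ζ : R.A => (ζ : ℝ) < γ)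

/-- The smallest positive integer `r` with `|ζ| < r` for all `ζ ∈ 𝒜_γ`. -/
def testOrder (R : RegularityStructure.{u}) (γ : ℝ) : ℕ :=
  sInf {r : ℕ | 0 < r ∧ ∀ ζ ∈ R.lowIndices γ, |(ζ : ℝ)| < r}

end RegularityStructure

/-- A model `(Π, Γ)` for the regularity structure `R` on `ℝ^d` with scaling `𝔰`. -/
structure Model {d : ℕ} (𝔰 : Fin d → ℕ) (R : RegularityStructure.{u}) where
  /-- The linear maps `Π_x : 𝒯 → 𝓓'(ℝ^d)`. -/
  PiMap : (Fin d → ℝ) → R.ModelSpace →ₗ[ℝ] Distr d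
  /-- `Π_x` is continuous, i.e. it is continuous on every summand `𝒯_ζ`. -/
  continuous_PiMap : ∀ (x : Fin d → ℝ) (ζ : R.A),
    Continuous fun τ : R.T ζ => PiMap x (DirectSum.lof ℝ R.A R.T ζ τ)
  /-- The maps `Γ_{x,y} ∈ 𝒢`. -/
  Γ : (Fin d → ℝ) → (Fin d → ℝ) → R.G
  Γ_self : ∀ x, Γ x x = 1
  Γ_mul : ∀ x z y, Γ x z * Γ z y = Γ x y
  /-- `Π_y = Π_x Γ_{x,y}`. -/
  PiMap_Γ : ∀ x y τ, PiMap y τ = PiMap x ((Γ x y : R.ModelSpace ≃ₗ[ℝ] R.ModelSpace) τ)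
  bound_PiMap : ∀ γ : ℝ, 0 < γ → ∃ C : ℝ, ∀ (x : Fin d → ℝ) (η : TestFun d),
    IsUnitTest 𝔰 (R.testOrder γ) η → ∀ (l : ℝ) (hl : 0 < l), l ≤ 1 →
    ∀ ζ ∈ R.lowIndices γ, ∀ τ : R.T ζ,
      |PiMap x (DirectSum.lof ℝ R.A R.T ζ τ) (rescale 𝔰 η l hl x)| ≤ C * ‖τ‖ * l ^ (ζ : ℝ)
  bound_Γ : ∀ γ : ℝ, 0 < γ → ∃ C : ℝ, ∀ (x y : Fin d → ℝ), y ∈ scaledBall 𝔰 x 1 →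
    ∀ ζ ∈ R.lowIndices γ, ∀ β : R.A, β ≤ ζ → ∀ τ : R.T ζ,
      ‖(Γ x y : R.ModelSpace ≃ₗ[ℝ] R.ModelSpace) (DirectSum.lof ℝ R.A R.T ζ τ) β‖
        ≤ C * ‖τ‖ * scaledNorm 𝔰 (x - y) ^ ((ζ : ℝ) - (β : ℝ))

namespace Model

variable {d : ℕ} {𝔰 : Fin d → ℕ} {R : RegularityStructure.{u}}

/-- The difference operator `Δ_{Γ,h} f(x) = f(x + h) - Γ_{x+h,x} f(x)`. -/
def diff (M : Model 𝔰 R) (f : (Fin d → ℝ) → R.ModelSpace) (h x : Fin d → ℝ) : R.ModelSpace :=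
  f (x + h) - (M.Γ (x + h) x : R.ModelSpace ≃ₗ[ℝ] R.ModelSpace) (f x)

/-- `sup_{ζ ∈ 𝒜_γ} ‖ |f(x)|_ζ ‖_{L^p}`. -/
def localNorm (_M : Model 𝔰 R) (γ : ℝ) (p : ℝ≥0∞) (f : (Fin d → ℝ) → R.ModelSpace) : ℝ≥0∞ :=
  ⨆ ζ ∈ R.lowIndices γ, eLpNorm (fun x => f x ζ) p volume

/-- The measure `λ^{-1} dλ` on `(0, 1]`. -/
def scaleMeasure : Measure ℝ :=
  (volume.restrict (Ioc (0 : ℝ) 1)).withDensity (fun l => ENNReal.ofReal l⁻¹)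

/-- The measure `‖h‖_𝔰^{-|𝔰|} dh` on `Q(0, 1)`. -/
def incrementMeasure (𝔰 : Fin d → ℕ) : Measure (Fin d → ℝ) :=
  (volume.restrict (scaledBall 𝔰 0 1)).withDensity
    (fun h => ENNReal.ofReal (scaledNorm 𝔰 h ^ (-(scalingSum 𝔰 : ℝ))))

/-- `sup_ζ ‖ ‖ ⨍_{Q(0,4λ)} |Δ_{Γ,h} f(x)|_ζ / λ^{γ-ζ} dh ‖_{L^q_λ} ‖_{L^p}`. -/
def translationNormF (M : Model 𝔰 R) (γ : ℝ) (p q : ℝ≥0∞)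
    (f : (Fin d → ℝ) → R.ModelSpace) : ℝ≥0∞ :=
  ⨆ ζ ∈ R.lowIndices γ,
    eLpNorm (fun x : Fin d → ℝ =>
      eLpNorm (fun l : ℝ =>
        ⨍⁻ h in scaledBall 𝔰 0 (4 * l),
          ‖M.diff f h x ζ‖ₑ / ENNReal.ofReal (l ^ (γ - (ζ : ℝ))) ∂volume)
        q scaleMeasure)
      p volume

/-- `sup_ζ (∫_{Q(0,1)} ‖ |Δ_{Γ,h} f(x)|_ζ / ‖h‖_𝔰^{γ-ζ} ‖_{L^p}^q dh / ‖h‖_𝔰^{|𝔰|})^{1/q}`. -/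
def translationNormB (M : Model 𝔰 R) (γ : ℝ) (p q : ℝ≥0∞)
    (f : (Fin d → ℝ) → R.ModelSpace) : ℝ≥0∞ :=
  ⨆ ζ ∈ R.lowIndices γ,
    eLpNorm (fun h : Fin d → ℝ =>
      eLpNorm (fun x : Fin d → ℝ =>
        ‖M.diff f h x ζ‖ₑ / ENNReal.ofReal (scaledNorm 𝔰 h ^ (γ - (ζ : ℝ))))
        p volume)
      q (incrementMeasure 𝔰)

/-- The norm of `𝓕^γ_{p,q}`, with values in `[0, ∞]`. -/
def normF (M : Model 𝔰 R) (γ : ℝ) (p q : ℝ≥0∞) (f : (Fin d → ℝ) → R.ModelSpace) : ℝ≥0∞ :=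
  M.localNorm γ p f + M.translationNormF γ p q f

/-- The norm of `𝓑^γ_{p,q}`, with values in `[0, ∞]`. -/
def normB (M : Model 𝔰 R) (γ : ℝ) (p q : ℝ≥0∞) (f : (Fin d → ℝ) → R.ModelSpace) : ℝ≥0∞ :=
  M.localNorm γ p f + M.translationNormB γ p q f

/-- `f : ℝ^d → 𝒯_γ^-` with (Bochner) measurable components. -/
def IsMeasurableInto (_M : Model 𝔰 R) (γ : ℝ) (f : (Fin d → ℝ) → R.ModelSpace) : Prop :=
  (∀ x, f x ∈ R.lowSpace γ) ∧
  ∀ ζ ∈ R.lowIndices γ, AEStronglyMeasurable (fun x => f x ζ) volume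

/-- The Triebel–Lizorkin space `𝓕^γ_{p,q}` of modelled distributions. -/
def spaceF (M : Model 𝔰 R) (γ : ℝ) (p q : ℝ≥0∞) : Set ((Fin d → ℝ) → R.ModelSpace) :=
  {f | M.IsMeasurableInto γ f ∧ M.normF γ p q f < ∞}

/-- The Besov space `𝓑^γ_{p,q}` of modelled distributions. -/
def spaceB (M : Model 𝔰 R) (γ : ℝ) (p q : ℝ≥0∞) : Set ((Fin d → ℝ) → R.ModelSpace) :=
  {f | M.IsMeasurableInto γ f ∧ M.normB γ p q f < ∞}

end Model

/-- The continuous embedding `X ⊂ Y` of a space `X` with norm `N` of maps with values in some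
`𝒯_{γ'}^-` into a space `Y` with norm `N'` of maps with values in `𝒯_γ^-`, where `γ ≤ γ'`: the map
`f ↦ 𝒬_{<γ} f` sends `X` boundedly into `Y`. -/
def RegularityStructure.Embeds {d : ℕ} (R : RegularityStructure.{u}) (γ : ℝ) (X Y : Set ((Fin d → ℝ) → R.ModelSpace))
    (N N' : ((Fin d → ℝ) → R.ModelSpace) → ℝ≥0∞) : Prop :=
  ∃ C : ℝ≥0, ∀ f ∈ X,
    (fun x => R.projLow γ (f x)) ∈ Y ∧ N' (fun x => R.projLow γ (f x)) ≤ C * N f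

end

/-! All three embeddings come from one pointwise statement, proved for `p' ≤ p` and arbitrary fine
indices. Write `N = |𝔰|`, and let `f` have regularity `γ'` and integrability `p'`.

Averages of increments at comparable scales are comparable, so the `L^q_λ` norm dominates their
supremum over dyadic scales for every `q`. Adding the sizes of the components gives a `majorant` `H`
of `f` with `‖H‖_{L^{p'}} ≲ ‖f‖`. Comparing two points through a common neighbour yields the
Hajłasz-type inequality `|f(y) - Γ_{y,x} f(x)|_ζ ≲ ρ^{γ'-ζ} (H(x) + H(y))` for `‖y - x‖ ≤ ρ ≤ 1`
(`exists_increment_bound`).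

To pass from `L^{p'}` to `L^p`, take `S` with `‖H‖_{L^{p'}} ≤ S` and put `w = H/S`, `κ = N/p'`, `θ =
p'/p`. The function `S w^θ` has `L^p` norm at most `S`, so `w` must be traded for `w^θ`. By
Chebyshev, points with `w ≲ r^{-κ}`, called good at scale `r`, occur within distance `r/2` of every
point. At such points `w ≲ w^θ r^{-κ(1-θ)}`, and the loss `κ(1-θ) = N(1/p' - 1/p)` is exactly the
Sobolev loss. A point that is not good at scale `ρ` is joined to one that is by a dyadic chain of
good points (`exists_chain`); the scales crossed are those where `w(y) > c r^{-κ}`, so the resulting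
geometric series is again bounded by `w(y)^θ`.

The projection `𝒬_{<γ}` drops components of homogeneity at least `γ`. As `γ ∉ 𝒜` and `𝒜` is locally
finite, these have homogeneity at least some `γ₂ > γ`, which may be taken at most `γ' - κ(1-θ)`.
Bounding them at good points gives `|Δ_{Γ,h} 𝒬_{<γ} f(x)|_ζ ≲ ‖h‖^{γ₂-ζ} (K(x) + K(x+h))` with `K =
S w^θ` (`exists_pointwise_bound`). The surplus `γ₂ - γ > 0` makes the integrals over `λ` and `h`
converge for every fine index, whence both target norms. For the Triebel–Lizorkin norm part of the
surplus turns the averages of `K` into convolution with an integrable kernel, so no maximal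
inequality is needed and `p = 1` is covered. -/

/-! ### The scaled distance -/

section ScaledGeometry

variable {d : ℕ} {𝔰 : Fin d → ℕ}

lemma abs_rpow_le_scaledNorm (x : Fin d → ℝ) (i : Fin d) :
    |x i| ^ (1 / (𝔰 i : ℝ)) ≤ scaledNorm 𝔰 x :=
  le_ciSup (f := fun i => |x i| ^ (1 / (𝔰 i : ℝ))) (Set.finite_range _).bddAbove i

lemma scaledNorm_nonneg (x : Fin d → ℝ) : 0 ≤ scaledNorm 𝔰 x :=
  Real.iSup_nonneg fun _ => by positivity

lemma scaledNorm_le {x : Fin d → ℝ} {a : ℝ} (ha : 0 ≤ a)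
    (h : ∀ i, |x i| ^ (1 / (𝔰 i : ℝ)) ≤ a) : scaledNorm 𝔰 x ≤ a :=
  Real.iSup_le h ha

lemma scaledNorm_neg (x : Fin d → ℝ) : scaledNorm 𝔰 (-x) = scaledNorm 𝔰 x := by
  simp [scaledNorm]

lemma scaledNorm_sub_comm (x y : Fin d → ℝ) : scaledNorm 𝔰 (x - y) = scaledNorm 𝔰 (y - x) := by
  rw [← scaledNorm_neg, neg_sub]

lemma scaledNorm_zero (h𝔰 : ∀ i, 0 < 𝔰 i) : scaledNorm 𝔰 (0 : Fin d → ℝ) = 0 := by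
  refine le_antisymm (scaledNorm_le le_rfl fun i => ?_) (scaledNorm_nonneg _)
  have : (𝔰 i : ℝ)⁻¹ ≠ 0 := by have := h𝔰 i; positivity
  simp [Real.zero_rpow this]

lemma scaledNorm_add_le (h𝔰 : ∀ i, 0 < 𝔰 i) (x y : Fin d → ℝ) :
    scaledNorm 𝔰 (x + y) ≤ scaledNorm 𝔰 x + scaledNorm 𝔰 y := by
  refine scaledNorm_le (add_nonneg (scaledNorm_nonneg _) (scaledNorm_nonneg _)) fun i => ?_
  have h1 : (1 : ℝ) ≤ 𝔰 i := by exact_mod_cast h𝔰 i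
  have hs : 1 / (𝔰 i : ℝ) ≤ 1 := by rw [div_le_one (by linarith)]; exact h1
  calc |(x + y) i| ^ (1 / (𝔰 i : ℝ)) ≤ (|x i| + |y i|) ^ (1 / (𝔰 i : ℝ)) := by
        gcongr; exact abs_add_le _ _
    _ ≤ |x i| ^ (1 / (𝔰 i : ℝ)) + |y i| ^ (1 / (𝔰 i : ℝ)) :=
        Real.rpow_add_le_add_rpow (abs_nonneg _) (abs_nonneg _) (by positivity) hs
    _ ≤ _ := add_le_add (abs_rpow_le_scaledNorm x i) (abs_rpow_le_scaledNorm y i)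

lemma scaledNorm_sub_le (h𝔰 : ∀ i, 0 < 𝔰 i) (x y z : Fin d → ℝ) :
    scaledNorm 𝔰 (x - z) ≤ scaledNorm 𝔰 (x - y) + scaledNorm 𝔰 (y - z) := by
  simpa using scaledNorm_add_le h𝔰 (x - y) (y - z)

lemma scaledNorm_le_iff (h𝔰 : ∀ i, 0 < 𝔰 i) {x : Fin d → ℝ} {a : ℝ} (ha : 0 ≤ a) :
    scaledNorm 𝔰 x ≤ a ↔ ∀ i, |x i| ≤ a ^ 𝔰 i := by
  have key : ∀ i, |x i| ^ (1 / (𝔰 i : ℝ)) ≤ a ↔ |x i| ≤ a ^ 𝔰 i := fun i => by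
    have h1 : (0 : ℝ) < 𝔰 i := by exact_mod_cast h𝔰 i
    rw [one_div, Real.rpow_inv_le_iff_of_pos (abs_nonneg _) ha h1, Real.rpow_natCast]
  simp_rw [← key]
  exact ⟨fun h i => (abs_rpow_le_scaledNorm x i).trans h, scaledNorm_le ha⟩

lemma eq_zero_of_scaledNorm_eq_zero (h𝔰 : ∀ i, 0 < 𝔰 i) {x : Fin d → ℝ}
    (hx : scaledNorm 𝔰 x = 0) : x = 0 := by
  funext i
  have := (scaledNorm_le_iff h𝔰 le_rfl).1 hx.le i
  rw [zero_pow (h𝔰 i).ne'] at this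
  simpa using this

lemma continuous_scaledNorm (hd : 0 < d) :
    Continuous (scaledNorm 𝔰 : (Fin d → ℝ) → ℝ) := by
  have : Nonempty (Fin d) := ⟨⟨0, hd⟩⟩
  have : (scaledNorm 𝔰 : (Fin d → ℝ) → ℝ) = fun x =>
      Finset.univ.sup' Finset.univ_nonempty fun i => |x i| ^ (1 / (𝔰 i : ℝ)) := by
    funext x
    rw [scaledNorm, Finset.sup'_univ_eq_ciSup]
  rw [this]
  refine Continuous.finset_sup'_apply _ fun i _ => ?_
  exact (continuous_abs.comp (continuous_apply i)).rpow_const fun x => Or.inr (by positivity)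

lemma scaledBall_zero_eq_Icc (h𝔰 : ∀ i, 0 < 𝔰 i) {r : ℝ} (hr : 0 ≤ r) :
    scaledBall 𝔰 0 r = Icc (fun i => -(r ^ 𝔰 i)) (fun i => r ^ 𝔰 i) := by
  ext x
  simp only [scaledBall, mem_ofPred_eq, sub_zero, scaledNorm_le_iff h𝔰 hr, abs_le, mem_Icc,
    Pi.le_def, forall_and]

lemma scaledBall_eq_preimage (x : Fin d → ℝ) (r : ℝ) :
    scaledBall 𝔰 x r = (fun z => z - x) ⁻¹' scaledBall 𝔰 0 r := by
  ext z; simp [scaledBall]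

lemma mem_scaledBall_zero {h : Fin d → ℝ} {r : ℝ} :
    h ∈ scaledBall 𝔰 0 r ↔ scaledNorm 𝔰 h ≤ r := by
  rw [scaledBall, mem_ofPred_eq, sub_zero]

lemma measurableSet_scaledBall (hd : 0 < d) (x : Fin d → ℝ) (r : ℝ) :
    MeasurableSet (scaledBall 𝔰 x r) :=
  (isClosed_le ((continuous_scaledNorm hd).comp (continuous_id.sub continuous_const))
    continuous_const).measurableSet

lemma volume_scaledBall (h𝔰 : ∀ i, 0 < 𝔰 i) (x : Fin d → ℝ) {r : ℝ} (hr : 0 ≤ r) :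
    volume (scaledBall 𝔰 x r) = ENNReal.ofReal (2 ^ d * r ^ scalingSum 𝔰) := by
  rw [scaledBall_eq_preimage, (measurePreserving_sub_right volume x).measure_preimage,
    scaledBall_zero_eq_Icc h𝔰 hr, Real.volume_Icc_pi, ← ENNReal.ofReal_prod_of_nonneg]
  · congr 1
    simp_rw [sub_neg_eq_add, ← two_mul, Finset.prod_mul_distrib, Finset.prod_const,
      Finset.prod_pow_eq_pow_sum, Finset.card_univ, Fintype.card_fin, scalingSum]
  · intro i _
    have := pow_nonneg hr (𝔰 i)
    linarith
  · rw [scaledBall_zero_eq_Icc h𝔰 hr]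
    exact measurableSet_Icc.nullMeasurableSet

lemma volume_scaledBall_ne_top (h𝔰 : ∀ i, 0 < 𝔰 i) (x : Fin d → ℝ) {r : ℝ} (hr : 0 ≤ r) :
    volume (scaledBall 𝔰 x r) ≠ ∞ := by
  rw [volume_scaledBall h𝔰 x hr]; exact ENNReal.ofReal_ne_top

lemma volume_scaledBall_ne_zero (h𝔰 : ∀ i, 0 < 𝔰 i) (x : Fin d → ℝ) {r : ℝ} (hr : 0 < r) :
    volume (scaledBall 𝔰 x r) ≠ 0 := by
  rw [volume_scaledBall h𝔰 x hr.le, Ne, ENNReal.ofReal_eq_zero, not_le]; positivity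

lemma volume_scaledBall_mul (h𝔰 : ∀ i, 0 < 𝔰 i) (x y : Fin d → ℝ) {r a : ℝ} (hr : 0 ≤ r)
    (ha : 0 ≤ a) : volume (scaledBall 𝔰 x (a * r)) =
      ENNReal.ofReal (a ^ scalingSum 𝔰) * volume (scaledBall 𝔰 y r) := by
  rw [volume_scaledBall h𝔰 x (by positivity), volume_scaledBall h𝔰 y hr,
    ← ENNReal.ofReal_mul (by positivity)]
  congr 1; ring

lemma scaledBall_mono (x : Fin d → ℝ) {r r' : ℝ} (h : r ≤ r') :
    scaledBall 𝔰 x r ⊆ scaledBall 𝔰 x r' := fun _ hz => le_trans (α := ℝ) hz h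

lemma scaledBall_subset_scaledBall (h𝔰 : ∀ i, 0 < 𝔰 i) {x y : Fin d → ℝ} {r r' : ℝ}
    (h : scaledNorm 𝔰 (x - y) + r ≤ r') : scaledBall 𝔰 x r ⊆ scaledBall 𝔰 y r' := by
  intro z hz
  have h1 := scaledNorm_sub_le h𝔰 z x y
  have h2 : scaledNorm 𝔰 (z - x) ≤ r := hz
  show scaledNorm 𝔰 (z - y) ≤ r'
  linarith

/-- Comparison of averages over two concentric balls of comparable radii. -/
lemma setLAverage_scaledBall_le (h𝔰 : ∀ i, 0 < 𝔰 i) (F : (Fin d → ℝ) → ℝ≥0∞) {r r' : ℝ}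
    (hr : 0 < r) (h : r ≤ r') (h' : r' ≤ 2 * r) :
    ⨍⁻ h in scaledBall 𝔰 0 r, F h ∂volume ≤
      ENNReal.ofReal (2 ^ scalingSum 𝔰) * ⨍⁻ h in scaledBall 𝔰 0 r', F h ∂volume := by
  rw [setLAverage_eq, setLAverage_eq, ENNReal.div_eq_inv_mul, ENNReal.div_eq_inv_mul, ← mul_assoc]
  refine mul_le_mul' ?_ (lintegral_mono_set (scaledBall_mono 0 h))
  have hv : volume (scaledBall 𝔰 (0 : Fin d → ℝ) r') ≤
      ENNReal.ofReal (2 ^ scalingSum 𝔰) * volume (scaledBall 𝔰 (0 : Fin d → ℝ) r) := by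
    rw [← volume_scaledBall_mul h𝔰 0 0 hr.le zero_le_two]
    exact measure_mono (scaledBall_mono 0 h')
  have h0 := volume_scaledBall_ne_zero h𝔰 0 hr
  have ht := volume_scaledBall_ne_top h𝔰 0 hr.le
  have h0' := volume_scaledBall_ne_zero h𝔰 0 (hr.trans_le h)
  have ht' := volume_scaledBall_ne_top h𝔰 0 (hr.trans_le h).le
  rw [← div_eq_mul_inv, ENNReal.le_div_iff_mul_le (Or.inl h0') (Or.inl ht'),
    ← ENNReal.div_eq_inv_mul]
  exact ENNReal.div_le_of_le_mul hv

/-- Every number in `(0, 1]` lies in a dyadic interval. -/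
lemma exists_dyadic {r : ℝ} (h0 : 0 < r) (h1 : r ≤ 1) :
    ∃ k : ℕ, (1 / 2 : ℝ) ^ k / 2 < r ∧ r ≤ (1 / 2 : ℝ) ^ k := by
  obtain ⟨k, hk, hk'⟩ := exists_nat_pow_near_of_lt_one h0 h1 (y := (1 / 2 : ℝ)) (by norm_num)
    (by norm_num)
  exact ⟨k, by rw [pow_succ] at hk; linarith, hk'⟩

lemma lintegral_scaledNorm_rpow_lt_top (hd : 0 < d) (h𝔰 : ∀ i, 0 < 𝔰 i) {a : ℝ} (ha : 0 < a) :
    ∫⁻ h in scaledBall 𝔰 (0 : Fin d → ℝ) 4,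
      ENNReal.ofReal (scaledNorm 𝔰 h ^ (a - (scalingSum 𝔰 : ℝ))) < ∞ := by
  have : Nonempty (Fin d) := ⟨⟨0, hd⟩⟩
  set N := scalingSum 𝔰
  let S : ℕ → Set (Fin d → ℝ) := fun k => {h | 4 * ((1 / 2 : ℝ) ^ k / 2) < scaledNorm 𝔰 h} ∩
    scaledBall 𝔰 0 (4 * (1 / 2 : ℝ) ^ k)
  have hcover : scaledBall 𝔰 (0 : Fin d → ℝ) 4 ⊆ {0} ∪ ⋃ k, S k := by
    intro h hh
    rcases (scaledNorm_nonneg (𝔰 := 𝔰) h).eq_or_lt with h0 | h0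
    · exact Or.inl (eq_zero_of_scaledNorm_eq_zero h𝔰 h0.symm)
    · have h4 : scaledNorm 𝔰 h ≤ 4 := mem_scaledBall_zero.1 hh
      obtain ⟨k, hk, hk'⟩ := exists_dyadic (r := scaledNorm 𝔰 h / 4) (by positivity) (by linarith)
      refine Or.inr (mem_iUnion.2 ⟨k, ?_, ?_⟩)
      · show 4 * ((1 / 2 : ℝ) ^ k / 2) < scaledNorm 𝔰 h
        linarith
      · show scaledNorm 𝔰 (h - 0) ≤ _
        rw [sub_zero]; linarith
  have hterm : ∀ k, ∫⁻ h in S k, ENNReal.ofReal (scaledNorm 𝔰 h ^ (a - (N : ℝ))) ≤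
      ENNReal.ofReal (2 ^ d * 2 ^ N * 4 ^ a * ((1 / 2 : ℝ) ^ a) ^ k) := by
    intro k
    set ρ : ℝ := 4 * (1 / 2 : ℝ) ^ k with hρ
    have hρ0 : 0 < ρ := by positivity
    calc ∫⁻ h in S k, ENNReal.ofReal (scaledNorm 𝔰 h ^ (a - (N : ℝ)))
        ≤ ∫⁻ _ in S k, ENNReal.ofReal (ρ ^ a * (ρ / 2) ^ (-(N : ℝ))) := by
          refine setLIntegral_mono' ?_ fun h hh => ENNReal.ofReal_le_ofReal ?_
          · exact (measurableSet_lt measurable_const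
              (continuous_scaledNorm hd).measurable).inter (measurableSet_scaledBall hd _ _)
          · have h1 : ρ / 2 < scaledNorm 𝔰 h := by
              have : 4 * ((1 / 2 : ℝ) ^ k / 2) < scaledNorm 𝔰 h := hh.1
              linarith
            have h2 : scaledNorm 𝔰 h ≤ ρ := mem_scaledBall_zero.1 hh.2
            have h3 : 0 < scaledNorm 𝔰 h := by linarith
            rw [sub_eq_add_neg, Real.rpow_add h3]
            refine mul_le_mul (Real.rpow_le_rpow h3.le h2 ha.le) ?_ (by positivity) (by positivity)
            exact Real.rpow_le_rpow_of_nonpos (by linarith) h1.le (by simp)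
      _ ≤ ENNReal.ofReal (ρ ^ a * (ρ / 2) ^ (-(N : ℝ))) * ENNReal.ofReal (2 ^ d * ρ ^ N) := by
          rw [setLIntegral_const]
          refine mul_le_mul' le_rfl ?_
          rw [← volume_scaledBall h𝔰 0 hρ0.le]
          exact measure_mono inter_subset_right
      _ = _ := by
          rw [← ENNReal.ofReal_mul (by positivity)]
          congr 1
          rw [Real.rpow_neg (by positivity), Real.rpow_natCast, div_pow, hρ,
            Real.mul_rpow (by norm_num) (by positivity), ← Real.rpow_natCast (1 / 2) k,
            ← Real.rpow_mul (by norm_num), mul_comm (k : ℝ) a, Real.rpow_mul (by norm_num),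
            Real.rpow_natCast]
          field_simp
  have hsum : Summable fun k : ℕ => 2 ^ d * 2 ^ N * 4 ^ a * ((1 / 2 : ℝ) ^ a) ^ k :=
    (summable_geometric_of_lt_one (by positivity)
      (Real.rpow_lt_one (by norm_num) (by norm_num) ha)).mul_left _
  calc ∫⁻ h in scaledBall 𝔰 (0 : Fin d → ℝ) 4, ENNReal.ofReal (scaledNorm 𝔰 h ^ (a - (N : ℝ)))
      ≤ ∫⁻ h in {0} ∪ ⋃ k, S k, ENNReal.ofReal (scaledNorm 𝔰 h ^ (a - (N : ℝ))) :=
        lintegral_mono_set hcover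
    _ ≤ (∫⁻ h in {0}, ENNReal.ofReal (scaledNorm 𝔰 h ^ (a - (N : ℝ)))) +
        ∫⁻ h in ⋃ k, S k, ENNReal.ofReal (scaledNorm 𝔰 h ^ (a - (N : ℝ))) :=
        lintegral_union_le _ _ _
    _ ≤ 0 + ∑' k, ENNReal.ofReal (2 ^ d * 2 ^ N * 4 ^ a * ((1 / 2 : ℝ) ^ a) ^ k) := by
        refine add_le_add ?_ ((lintegral_iUnion_le _ _).trans (ENNReal.tsum_le_tsum hterm))
        rw [setLIntegral_measure_zero _ _ (measure_singleton _)]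
    _ < ∞ := by
        rw [zero_add, ← ENNReal.ofReal_tsum_of_nonneg (fun k => by positivity) hsum]
        exact ENNReal.ofReal_lt_top

end ScaledGeometry

/-! ### The model space and the re-expansion maps -/

namespace RegularityStructure

variable (R : RegularityStructure.{u})

lemma finite_lowIndices (γ : ℝ) : (R.lowIndices γ).Finite := by
  obtain ⟨a, ha⟩ := R.bddBelow
  refine Set.Finite.of_finite_image ((R.locallyFinite a γ).subset ?_)
    (Subtype.val_injective.injOn (s := R.lowIndices γ))
  rintro _ ⟨ζ, hζ, rfl⟩
  exact ⟨ζ.2, ha ζ.2, le_of_lt (α := ℝ) hζ⟩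

/-- The set `𝒜_γ` as a finite set. -/
noncomputable def lowFinset (γ : ℝ) : Finset R.A := (R.finite_lowIndices γ).toFinset

variable {R} {γ : ℝ}

lemma mem_lowFinset {ζ : R.A} : ζ ∈ R.lowFinset γ ↔ (ζ : ℝ) < γ := by
  simp [lowFinset, lowIndices]

lemma lof_apply_of_ne {β ζ : R.A} (h : β ≠ ζ) (t : R.T β) :
    (DirectSum.lof ℝ R.A R.T β t) ζ = 0 := by
  rw [DirectSum.lof_eq_of, DirectSum.of_eq_of_ne _ _ _ h.symm]

lemma lof_apply_self (β : R.A) (t : R.T β) : (DirectSum.lof ℝ R.A R.T β t) β = t := by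
  rw [DirectSum.lof_eq_of, DirectSum.of_eq_same]

lemma lof_mem_lowSpace {β : R.A} (hβ : (β : ℝ) < γ) (t : R.T β) :
    DirectSum.lof ℝ R.A R.T β t ∈ R.lowSpace γ := fun ζ hζ =>
  lof_apply_of_ne (by rintro rfl; linarith) t

lemma sum_lof_apply {τ : R.ModelSpace} (hτ : τ ∈ R.lowSpace γ) :
    ∑ β ∈ R.lowFinset γ, DirectSum.lof ℝ R.A R.T β (τ β) = τ := by
  classical
  refine DFinsupp.ext fun ζ => ?_
  rw [DFinsupp.finsetSum_apply]
  by_cases hζ : ζ ∈ R.lowFinset γ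
  · rw [Finset.sum_eq_single_of_mem ζ hζ]
    · exact lof_apply_self _ _
    · exact fun β _ hβ => lof_apply_of_ne hβ _
  · rw [Finset.sum_eq_zero]
    · exact (hτ ζ (not_lt.1 (mt mem_lowFinset.2 hζ))).symm
    · exact fun β hβ => lof_apply_of_ne (by rintro rfl; exact hζ hβ) _

lemma projLow_apply_of_lt (τ : R.ModelSpace) {ζ : R.A} (h : (ζ : ℝ) < γ) :
    R.projLow γ τ ζ = τ ζ :=
  (DFinsupp.filter_apply _ _ _).trans (if_pos h)

lemma projLow_apply_of_le (τ : R.ModelSpace) {ζ : R.A} (h : γ ≤ (ζ : ℝ)) :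
    R.projLow γ τ ζ = 0 :=
  (DFinsupp.filter_apply _ _ _).trans (if_neg h.not_gt)

lemma projLow_mem_lowSpace (τ : R.ModelSpace) : R.projLow γ τ ∈ R.lowSpace γ :=
  fun _ h => projLow_apply_of_le τ h

lemma lowSpace_mono {γ' : ℝ} (h : γ ≤ γ') : R.lowSpace γ ≤ R.lowSpace γ' :=
  fun _ hτ ζ hζ => hτ ζ (h.trans hζ)

end RegularityStructure

namespace Model

open RegularityStructure

variable {d : ℕ} {𝔰 : Fin d → ℕ} {R : RegularityStructure.{u}} (M : Model 𝔰 R)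

/-- The map `Γ_{x,y}` as a linear map. -/
noncomputable def reexpand (x y : Fin d → ℝ) : R.ModelSpace →ₗ[ℝ] R.ModelSpace :=
  ((M.Γ x y : R.ModelSpace ≃ₗ[ℝ] R.ModelSpace) : R.ModelSpace →ₗ[ℝ] R.ModelSpace)

/-- The increment `f(y) - Γ_{y,x} f(x)`. -/
noncomputable def increment (f : (Fin d → ℝ) → R.ModelSpace) (y x : Fin d → ℝ) : R.ModelSpace :=
  f y - M.reexpand y x (f x)

variable {M}

lemma diff_eq_increment (f : (Fin d → ℝ) → R.ModelSpace) (h x : Fin d → ℝ) :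
    M.diff f h x = M.increment f (x + h) x := rfl

lemma reexpand_self (x : Fin d → ℝ) (τ : R.ModelSpace) : M.reexpand x x τ = τ := by
  simp [reexpand, M.Γ_self]

lemma reexpand_reexpand (x z y : Fin d → ℝ) (τ : R.ModelSpace) :
    M.reexpand x z (M.reexpand z y τ) = M.reexpand x y τ := by
  simp only [reexpand]
  rw [← M.Γ_mul x z y]
  rfl

lemma increment_self (f : (Fin d → ℝ) → R.ModelSpace) (x : Fin d → ℝ) :
    M.increment f x x = 0 := by
  rw [increment, reexpand_self, sub_self]

/-- The cocycle property of increments. -/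
lemma increment_add (f : (Fin d → ℝ) → R.ModelSpace) (x z y : Fin d → ℝ) :
    M.increment f x z + M.reexpand x z (M.increment f z y) = M.increment f x y := by
  simp only [increment, map_sub, reexpand_reexpand]
  abel

lemma reexpand_lof_apply (x y : Fin d → ℝ) {β ζ : R.A} (h : β ≤ ζ) (t : R.T β) :
    M.reexpand x y (DirectSum.lof ℝ R.A R.T β t) ζ = DirectSum.lof ℝ R.A R.T β t ζ := by
  have := R.triangular _ (M.Γ x y).2 β t ζ h
  rw [DirectSum.sub_apply, sub_eq_zero] at this
  exact this

lemma reexpand_apply_eq_sum {γ : ℝ} (x y : Fin d → ℝ) {τ : R.ModelSpace}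
    (hτ : τ ∈ R.lowSpace γ) (ζ : R.A) :
    M.reexpand x y τ ζ =
      ∑ β ∈ R.lowFinset γ, M.reexpand x y (DirectSum.lof ℝ R.A R.T β (τ β)) ζ := by
  classical
  conv_lhs => rw [← sum_lof_apply hτ, map_sum]
  exact DFinsupp.finsetSum_apply _ _ _

lemma reexpand_mem_lowSpace {γ : ℝ} (x y : Fin d → ℝ) {τ : R.ModelSpace}
    (hτ : τ ∈ R.lowSpace γ) : M.reexpand x y τ ∈ R.lowSpace γ := by
  intro ζ hζ
  rw [reexpand_apply_eq_sum x y hτ]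
  refine Finset.sum_eq_zero fun β hβ => ?_
  have hβ' := mem_lowFinset.1 hβ
  rw [reexpand_lof_apply x y (by exact_mod_cast (hβ'.le.trans hζ))]
  exact lof_mem_lowSpace hβ' _ ζ hζ

lemma increment_mem_lowSpace {γ : ℝ} {f : (Fin d → ℝ) → R.ModelSpace}
    (hf : ∀ x, f x ∈ R.lowSpace γ) (x y : Fin d → ℝ) : M.increment f x y ∈ R.lowSpace γ :=
  Submodule.sub_mem _ (hf x) (reexpand_mem_lowSpace _ _ (hf y))

variable (M)

lemma exists_bound_reexpand_le_one {γ : ℝ} (hγ : 0 < γ) :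
    ∃ C : ℝ, 1 ≤ C ∧ ∀ x y : Fin d → ℝ, scaledNorm 𝔰 (x - y) ≤ 1 →
      ∀ β ∈ R.lowFinset γ, ∀ ζ : R.A, ζ ≤ β → ∀ t : R.T β,
        ‖M.reexpand x y (DirectSum.lof ℝ R.A R.T β t) ζ‖
          ≤ C * ‖t‖ * scaledNorm 𝔰 (x - y) ^ ((β : ℝ) - ζ) := by
  obtain ⟨C, hC⟩ := M.bound_Γ γ hγ
  refine ⟨max C 1, le_max_right _ _, fun x y hxy β hβ ζ hζ t => ?_⟩
  refine (hC x y ?_ β (mem_lowFinset.1 hβ) ζ hζ t).trans ?_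
  · show scaledNorm 𝔰 (y - x) ≤ 1
    rwa [scaledNorm_sub_comm]
  · have := Real.rpow_nonneg (scaledNorm_nonneg (𝔰 := 𝔰) (x - y)) ((β : ℝ) - ζ)
    gcongr
    exact le_max_left _ _

variable {M} in
lemma norm_reexpand_lof_le_of_le_one {C : ℝ} (hC1 : 1 ≤ C) {x y : Fin d → ℝ}
    (hxy : scaledNorm 𝔰 (x - y) ≤ 1) {β : R.A}
    (hC : ∀ ζ : R.A, ζ ≤ β → ∀ t : R.T β,
        ‖M.reexpand x y (DirectSum.lof ℝ R.A R.T β t) ζ‖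
          ≤ C * ‖t‖ * scaledNorm 𝔰 (x - y) ^ ((β : ℝ) - ζ)) (ζ : R.A) (t : R.T β) :
    ‖M.reexpand x y (DirectSum.lof ℝ R.A R.T β t) ζ‖ ≤ C * ‖t‖ := by
  have hCt : 0 ≤ C * ‖t‖ := by positivity
  rcases le_or_gt ζ β with h | h
  · refine (hC ζ h t).trans (mul_le_of_le_one_right hCt ?_)
    exact Real.rpow_le_one (scaledNorm_nonneg _) hxy (sub_nonneg.2 h)
  · rw [reexpand_lof_apply x y h.le, lof_apply_of_ne h.ne, norm_zero]
    exact hCt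

/-- The model bounds `Γ` only up to distance one. Longer displacements are split into `n` equal
steps and the factors are composed by the cocycle identity. -/
lemma exists_bound_reexpand_nsmul {γ : ℝ} (hγ : 0 < γ) (n : ℕ) :
    ∃ C : ℝ, 1 ≤ C ∧ ∀ x k : Fin d → ℝ, scaledNorm 𝔰 k ≤ 1 → ∀ τ ∈ R.lowSpace γ,
      ∀ B : ℝ, 0 ≤ B → (∀ β, ‖τ β‖ ≤ B) →
        ∀ ζ, ‖M.reexpand (x + n • k) x τ ζ‖ ≤ C * B := by
  induction n with
  | zero =>
    refine ⟨1, le_rfl, fun x k _ τ _ B _ h ζ => ?_⟩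
    rw [zero_smul, add_zero, reexpand_self, one_mul]
    exact h ζ
  | succ n ih =>
    obtain ⟨C, hC1, hC⟩ := ih
    obtain ⟨C', hC1', hC'⟩ := M.exists_bound_reexpand_le_one hγ
    refine ⟨max 1 ((R.lowFinset γ).card * C' * C), le_max_left _ _,
      fun x k hk τ hτ B hB h ζ => ?_⟩
    rw [← reexpand_reexpand _ (x + n • k) _]
    have hmem := reexpand_mem_lowSpace (M := M) (x + n • k) x hτ
    have hle : scaledNorm 𝔰 (x + (n + 1) • k - (x + n • k)) ≤ 1 := by
      rw [add_smul, one_smul, add_sub_add_left_eq_sub, add_sub_cancel_left]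
      exact hk
    rw [reexpand_apply_eq_sum _ _ hmem]
    refine (norm_sum_le _ _).trans ?_
    calc _ ≤ ∑ β ∈ R.lowFinset γ, C' * (C * B) := by
          refine Finset.sum_le_sum fun β hβ => ?_
          refine (norm_reexpand_lof_le_of_le_one hC1' hle (hC' _ _ hle β hβ) ζ _).trans ?_
          gcongr
          exact hC x k hk τ hτ B hB h β
      _ = ((R.lowFinset γ).card * C' * C) * B := by
          rw [Finset.sum_const, nsmul_eq_mul]; ring
      _ ≤ _ := by gcongr; exact le_max_right _ _

lemma exists_bound_reexpand_lof {γ : ℝ} (hγ : 0 < γ) (n : ℕ) (hn : 0 < n) :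
    ∃ C : ℝ, 1 ≤ C ∧ ∀ x y : Fin d → ℝ, (∀ i, |x i - y i| ≤ n) → ∀ β ∈ R.lowFinset γ,
      ∀ ζ, ∀ t : R.T β, ‖M.reexpand x y (DirectSum.lof ℝ R.A R.T β t) ζ‖ ≤ C * ‖t‖ := by
  obtain ⟨C, hC1, hC⟩ := M.exists_bound_reexpand_nsmul hγ n
  refine ⟨C, hC1, fun x y hxy β hβ ζ t => ?_⟩
  have hn' : (0 : ℝ) < n := by exact_mod_cast hn
  -- A displacement with coordinates at most `n` is `n` steps with coordinates at most `1`, hence of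
  -- scaled norm at most `1`.
  have hx : x = y + n • ((n : ℝ)⁻¹ • (x - y)) := by
    rw [← Nat.cast_smul_eq_nsmul ℝ, smul_smul, mul_inv_cancel₀ hn'.ne', one_smul,
      add_sub_cancel]
  rw [hx]
  refine hC y _ ?_ _ (lof_mem_lowSpace (mem_lowFinset.1 hβ) t) _ (norm_nonneg t) (fun β' => ?_) ζ
  · refine scaledNorm_le zero_le_one fun i => Real.rpow_le_one (abs_nonneg _) ?_ (by positivity)
    rw [Pi.smul_apply, smul_eq_mul, abs_mul, abs_inv, Nat.abs_cast, Pi.sub_apply,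
      inv_mul_le_one₀ hn']
    exact hxy i
  · by_cases h : β = β'
    · subst h; rw [lof_apply_self]
    · rw [lof_apply_of_ne h, norm_zero]; exact norm_nonneg t

/-- The analytic bound on `Γ` in the ball of radius `4`. -/
lemma exists_bound_reexpand_le_four (h𝔰 : ∀ i, 0 < 𝔰 i) {γ : ℝ} (hγ : 0 < γ) :
    ∃ C : ℝ, 1 ≤ C ∧ ∀ x y : Fin d → ℝ, scaledNorm 𝔰 (x - y) ≤ 4 →
      ∀ β ∈ R.lowFinset γ, ∀ ζ : R.A, ζ ≤ β → ∀ t : R.T β,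
        ‖M.reexpand x y (DirectSum.lof ℝ R.A R.T β t) ζ‖
          ≤ C * ‖t‖ * scaledNorm 𝔰 (x - y) ^ ((β : ℝ) - ζ) := by
  obtain ⟨C, hC1, hC⟩ := M.exists_bound_reexpand_le_one hγ
  -- Scaled distance at most `4` means coordinates at most `4 ^ 𝔰 i`, all bounded by `4 ^ |𝔰|`.
  -- Beyond distance one the homogeneous factor is at least `1`, so a plain bound suffices there.
  obtain ⟨C', hC1', hC'⟩ := M.exists_bound_reexpand_lof hγ (4 ^ scalingSum 𝔰) (by positivity)
  refine ⟨max C C', hC1.trans (le_max_left _ _), fun x y hxy β hβ ζ hζ t => ?_⟩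
  have hnn := Real.rpow_nonneg (scaledNorm_nonneg (𝔰 := 𝔰) (x - y)) ((β : ℝ) - ζ)
  rcases le_or_gt (scaledNorm 𝔰 (x - y)) 1 with h | h
  · refine (hC x y h β hβ ζ hζ t).trans ?_
    gcongr
    exact le_max_left _ _
  · refine (hC' x y (fun i => ?_) β hβ ζ t).trans ?_
    · refine ((scaledNorm_le_iff h𝔰 (by norm_num)).1 hxy i).trans ?_
      push_cast
      refine pow_le_pow_right₀ (by norm_num) ?_
      exact Finset.single_le_sum (f := 𝔰) (fun _ _ => Nat.zero_le _) (Finset.mem_univ i)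
    · have h1 : (1 : ℝ) ≤ scaledNorm 𝔰 (x - y) ^ ((β : ℝ) - ζ) :=
        Real.one_le_rpow h.le (sub_nonneg.2 hζ)
      have h2 : C' * ‖t‖ ≤ max C C' * ‖t‖ := by gcongr; exact le_max_right _ _
      exact h2.trans (le_mul_of_one_le_right (by positivity) h1)

/-- Re-expansion preserves homogeneous bounds `‖τ_β‖ ≤ B ρ^{a - β}`. -/
lemma exists_reexpand_bound (h𝔰 : ∀ i, 0 < 𝔰 i) {γ : ℝ} (hγ : 0 < γ) :
    ∃ C : ℝ, 1 ≤ C ∧ ∀ (x y : Fin d → ℝ) (ρ : ℝ), 0 < ρ → ρ ≤ 4 → scaledNorm 𝔰 (x - y) ≤ ρ →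
      ∀ τ ∈ R.lowSpace γ, ∀ a B : ℝ, 0 ≤ B → ∀ ζ : R.A,
        (∀ β ∈ R.lowFinset γ, ζ ≤ β → ‖τ β‖ ≤ B * ρ ^ (a - β)) →
          ‖M.reexpand x y τ ζ‖ ≤ C * (B * ρ ^ (a - ζ)) := by
  obtain ⟨C, hC1, hC⟩ := M.exists_bound_reexpand_le_four h𝔰 hγ
  refine ⟨max 1 ((R.lowFinset γ).card * C), le_max_left _ _,
    fun x y ρ hρ hρ4 hxy τ hτ a B hB ζ hb => ?_⟩
  rw [reexpand_apply_eq_sum _ _ hτ]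
  refine (norm_sum_le _ _).trans ?_
  calc _ ≤ ∑ β ∈ R.lowFinset γ, C * (B * ρ ^ (a - ζ)) := by
        refine Finset.sum_le_sum fun β hβ => ?_
        rcases le_or_gt ζ β with h | h
        · have h' : (0 : ℝ) ≤ (β : ℝ) - ζ := sub_nonneg.2 h
          refine (hC x y (hxy.trans hρ4) β hβ ζ h _).trans ?_
          calc C * ‖τ β‖ * scaledNorm 𝔰 (x - y) ^ ((β : ℝ) - ζ)
              ≤ C * (B * ρ ^ (a - β)) * ρ ^ ((β : ℝ) - ζ) := by
                have := Real.rpow_le_rpow (scaledNorm_nonneg _) hxy h'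
                have h3 := Real.rpow_nonneg (scaledNorm_nonneg (𝔰 := 𝔰) (x - y)) ((β : ℝ) - ζ)
                have := hb β hβ h
                gcongr
            _ = C * (B * ρ ^ (a - ζ)) := by
                rw [show a - (ζ : ℝ) = (a - β) + (β - ζ) by ring, Real.rpow_add hρ]; ring
        · rw [reexpand_lof_apply x y h.le, lof_apply_of_ne h.ne, norm_zero]
          positivity
    _ = ((R.lowFinset γ).card * C) * (B * ρ ^ (a - ζ)) := by
        rw [Finset.sum_const, nsmul_eq_mul]; ring
    _ ≤ _ := by gcongr; exact le_max_right _ _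

end Model

/-! ### Continuity of the re-expansion maps and measurability of increments -/

namespace Model

open RegularityStructure Filter Topology

variable {d : ℕ} {𝔰 : Fin d → ℕ} {R : RegularityStructure.{u}} (M : Model 𝔰 R)

/-- Components at or above `β` are unchanged by triangularity; those below carry a positive power of
the distance. -/
lemma tendsto_reexpand_lof_of_tendsto_zero {γ : ℝ} (hγ : 0 < γ) {β : R.A}
    (hβ : β ∈ R.lowFinset γ) (ζ : R.A) {α : Type*} {l : Filter α} {x y : α → Fin d → ℝ}
    (hxy : Tendsto (fun a => scaledNorm 𝔰 (x a - y a)) l (𝓝 0)) {t : α → R.T β} {t₀ : R.T β}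
    (ht : Tendsto t l (𝓝 t₀)) :
    Tendsto (fun a => M.reexpand (x a) (y a) (DirectSum.lof ℝ R.A R.T β (t a)) ζ) l
      (𝓝 (DirectSum.lof ℝ R.A R.T β t₀ ζ)) := by
  rcases le_or_gt β ζ with h | h
  · simp_rw [reexpand_lof_apply _ _ h]
    by_cases h' : β = ζ
    · subst h'
      simpa only [lof_apply_self] using ht
    · simpa only [lof_apply_of_ne h'] using tendsto_const_nhds
  · rw [lof_apply_of_ne h.ne']
    obtain ⟨C, -, hC⟩ := M.exists_bound_reexpand_le_one hγ
    have hpos : (0 : ℝ) < (β : ℝ) - ζ := sub_pos.2 h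
    have hlim : Tendsto (fun a => C * ‖t a‖ * scaledNorm 𝔰 (x a - y a) ^ ((β : ℝ) - ζ)) l
        (𝓝 0) := by
      have h2 := (ht.norm.const_mul C).mul (hxy.rpow_const (p := (β : ℝ) - ζ) (Or.inr hpos.le))
      simpa only [Real.zero_rpow hpos.ne', mul_zero] using h2
    refine squeeze_zero_norm' ?_ hlim
    filter_upwards [hxy.eventually (ge_mem_nhds one_pos)] with a ha
    exact hC _ _ ha β hβ ζ h.le _

lemma continuous_reexpand_lof_const {γ : ℝ} (hγ : 0 < γ) {β : R.A}
    (hβ : β ∈ R.lowFinset γ) (ζ : R.A) (x y : Fin d → ℝ) :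
    Continuous fun t : R.T β => M.reexpand x y (DirectSum.lof ℝ R.A R.T β t) ζ := by
  obtain ⟨n, hn⟩ := exists_nat_gt ‖x - y‖
  have hn0 : 0 < n := by exact_mod_cast (norm_nonneg _).trans_lt hn
  obtain ⟨C, -, hC⟩ := M.exists_bound_reexpand_lof hγ n hn0
  have hxy : ∀ i, |x i - y i| ≤ n := fun i => (norm_le_pi_norm (x - y) i).trans hn.le
  exact AddMonoidHomClass.continuous_of_bound
    ((DirectSum.component ℝ R.A R.T ζ).comp
      ((M.reexpand x y).comp (DirectSum.lof ℝ R.A R.T β))) C fun t => hC x y hxy β hβ ζ t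

/-- The components of the re-expansion maps are jointly continuous. -/
lemma continuous_reexpand_lof (hd : 0 < d) (h𝔰 : ∀ i, 0 < 𝔰 i) {γ : ℝ} (hγ : 0 < γ) {β : R.A}
    (hβ : β ∈ R.lowFinset γ) (ζ : R.A) :
    Continuous fun p : (Fin d → ℝ) × (Fin d → ℝ) × R.T β =>
      M.reexpand p.1 p.2.1 (DirectSum.lof ℝ R.A R.T β p.2.2) ζ := by
  refine continuous_iff_continuousAt.2 fun ⟨x₀, y₀, t₀⟩ => ?_
  have hlof : ∀ t : R.T β, DirectSum.lof ℝ R.A R.T β t ∈ R.lowSpace γ :=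
    lof_mem_lowSpace (mem_lowFinset.1 hβ)
  have hsc : ∀ z₀ : Fin d → ℝ, Tendsto (fun z => scaledNorm 𝔰 (z - z₀)) (𝓝 z₀) (𝓝 0) :=
    fun z₀ => by
      have h : Continuous fun z : Fin d → ℝ => scaledNorm 𝔰 (z - z₀) :=
        (continuous_scaledNorm hd).comp (continuous_id.sub continuous_const)
      simpa only [sub_self, scaledNorm_zero h𝔰] using h.tendsto z₀
  have hx : Tendsto (fun p : (Fin d → ℝ) × (Fin d → ℝ) × R.T β => scaledNorm 𝔰 (p.1 - x₀))
      (𝓝 (x₀, y₀, t₀)) (𝓝 0) := (hsc x₀).comp continuous_fst.continuousAt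
  have hy : Tendsto (fun p : (Fin d → ℝ) × (Fin d → ℝ) × R.T β => scaledNorm 𝔰 (y₀ - p.2.1))
      (𝓝 (x₀, y₀, t₀)) (𝓝 0) := by
    simp_rw [scaledNorm_sub_comm y₀]
    exact (hsc y₀).comp (continuous_fst.comp continuous_snd).continuousAt
  have ht : Tendsto (fun p : (Fin d → ℝ) × (Fin d → ℝ) × R.T β => p.2.2)
      (𝓝 (x₀, y₀, t₀)) (𝓝 t₀) := (continuous_snd.comp continuous_snd).continuousAt
  -- Factor `Γ_{x,y} = Γ_{x,x₀} Γ_{x₀,y₀} Γ_{y₀,y}`: the outer factors tend to the identity and the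
  -- middle one is fixed and bounded on each summand. The factors are handled from right to left.
  have h1 : ∀ b, Tendsto (fun p : (Fin d → ℝ) × (Fin d → ℝ) × R.T β =>
      M.reexpand y₀ p.2.1 (DirectSum.lof ℝ R.A R.T β p.2.2) b) (𝓝 (x₀, y₀, t₀))
      (𝓝 (DirectSum.lof ℝ R.A R.T β t₀ b)) := fun b =>
    M.tendsto_reexpand_lof_of_tendsto_zero hγ hβ b hy ht
  have h2 : ∀ a, Tendsto (fun p : (Fin d → ℝ) × (Fin d → ℝ) × R.T β =>
      M.reexpand x₀ p.2.1 (DirectSum.lof ℝ R.A R.T β p.2.2) a) (𝓝 (x₀, y₀, t₀))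
      (𝓝 (M.reexpand x₀ y₀ (DirectSum.lof ℝ R.A R.T β t₀) a)) := fun a => by
    have he : ∀ (y : Fin d → ℝ) (t : R.T β),
        M.reexpand x₀ y (DirectSum.lof ℝ R.A R.T β t) a = ∑ b ∈ R.lowFinset γ,
          M.reexpand x₀ y₀ (DirectSum.lof ℝ R.A R.T b
            (M.reexpand y₀ y (DirectSum.lof ℝ R.A R.T β t) b)) a := fun y t => by
      rw [← reexpand_reexpand x₀ y₀ y]
      exact reexpand_apply_eq_sum x₀ y₀ (reexpand_mem_lowSpace y₀ _ (hlof _)) a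
    rw [reexpand_apply_eq_sum x₀ y₀ (hlof _) a]
    refine Tendsto.congr (fun p => (he p.2.1 p.2.2).symm) ?_
    exact tendsto_finsetSum _ fun b hb =>
      ((M.continuous_reexpand_lof_const hγ hb a x₀ y₀).tendsto _).comp (h1 b)
  have h3 : Tendsto (fun p : (Fin d → ℝ) × (Fin d → ℝ) × R.T β =>
      ∑ a ∈ R.lowFinset γ, M.reexpand p.1 x₀ (DirectSum.lof ℝ R.A R.T a
        (M.reexpand x₀ p.2.1 (DirectSum.lof ℝ R.A R.T β p.2.2) a)) ζ) (𝓝 (x₀, y₀, t₀))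
      (𝓝 (∑ a ∈ R.lowFinset γ, DirectSum.lof ℝ R.A R.T a
        (M.reexpand x₀ y₀ (DirectSum.lof ℝ R.A R.T β t₀) a) ζ)) :=
    tendsto_finsetSum _ fun a ha =>
      M.tendsto_reexpand_lof_of_tendsto_zero hγ ha ζ hx (h2 a)
  have h4 : ∑ a ∈ R.lowFinset γ, DirectSum.lof ℝ R.A R.T a
        (M.reexpand x₀ y₀ (DirectSum.lof ℝ R.A R.T β t₀) a) ζ =
      M.reexpand x₀ y₀ (DirectSum.lof ℝ R.A R.T β t₀) ζ := by
    classical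
    conv_rhs => rw [← sum_lof_apply (reexpand_mem_lowSpace (M := M) x₀ y₀ (hlof t₀))]
    exact (DFinsupp.finsetSum_apply _ _ _).symm
  rw [h4] at h3
  refine h3.congr fun p => ?_
  rw [← reexpand_apply_eq_sum p.1 x₀ (reexpand_mem_lowSpace (M := M) x₀ _ (hlof _)),
    reexpand_reexpand]

lemma aestronglyMeasurable_diff_prod (hd : 0 < d) (h𝔰 : ∀ i, 0 < 𝔰 i) {γ : ℝ} (hγ : 0 < γ)
    {f : (Fin d → ℝ) → R.ModelSpace} (hf : M.IsMeasurableInto γ f) {ζ : R.A}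
    (hζ : ζ ∈ R.lowFinset γ) :
    AEStronglyMeasurable (fun p : (Fin d → ℝ) × (Fin d → ℝ) => M.diff f p.2 p.1 ζ)
      (volume.prod volume) := by
  have h1 : AEStronglyMeasurable (fun p : (Fin d → ℝ) × (Fin d → ℝ) => f (p.1 + p.2) ζ)
      (volume.prod volume) :=
    (hf.2 ζ (mem_lowFinset.1 hζ)).comp_quasiMeasurePreserving
      (Measure.quasiMeasurePreserving_snd.comp
        (measurePreserving_prod_add volume volume).quasiMeasurePreserving)
  have h2 : ∀ β ∈ R.lowFinset γ, AEStronglyMeasurable (fun p : (Fin d → ℝ) × (Fin d → ℝ) =>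
      M.reexpand (p.1 + p.2) p.1 (DirectSum.lof ℝ R.A R.T β (f p.1 β)) ζ)
      (volume.prod volume) := fun β hβ => by
    have hc := M.continuous_reexpand_lof hd h𝔰 hγ hβ ζ
    have hm : AEStronglyMeasurable (fun p : (Fin d → ℝ) × (Fin d → ℝ) => f p.1 β)
        (volume.prod volume) :=
      (hf.2 β (mem_lowFinset.1 hβ)).comp_quasiMeasurePreserving Measure.quasiMeasurePreserving_fst
    exact hc.comp_aestronglyMeasurable
      (((continuous_fst.add continuous_snd).aestronglyMeasurable).prodMk
        (continuous_fst.aestronglyMeasurable.prodMk hm))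
  refine (h1.sub (Finset.aestronglyMeasurable_fun_sum _ h2)).congr
    (Filter.Eventually.of_forall fun p => ?_)
  simp only [Pi.sub_apply]
  rw [diff_eq_increment, increment, DirectSum.sub_apply, reexpand_apply_eq_sum _ _ (hf.1 p.1)]

lemma aestronglyMeasurable_increment (hd : 0 < d) (h𝔰 : ∀ i, 0 < 𝔰 i) {γ : ℝ} (hγ : 0 < γ)
    {f : (Fin d → ℝ) → R.ModelSpace} (hf : M.IsMeasurableInto γ f) {ζ : R.A}
    (hζ : ζ ∈ R.lowFinset γ) (x : Fin d → ℝ) :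
    AEStronglyMeasurable (fun z : Fin d → ℝ => M.increment f z x ζ) volume := by
  have h2 : ∀ β ∈ R.lowFinset γ, AEStronglyMeasurable (fun z : Fin d → ℝ =>
      M.reexpand z x (DirectSum.lof ℝ R.A R.T β (f x β)) ζ) volume := fun β hβ =>
    ((M.continuous_reexpand_lof hd h𝔰 hγ hβ ζ).comp (g := fun p => M.reexpand p.1 p.2.1
      (DirectSum.lof ℝ R.A R.T β p.2.2) ζ) (f := fun z => (z, x, f x β))
      (continuous_id.prodMk continuous_const)).aestronglyMeasurable
  refine ((hf.2 ζ (mem_lowFinset.1 hζ)).sub (Finset.aestronglyMeasurable_fun_sum _ h2)).congr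
    (Filter.Eventually.of_forall fun z => ?_)
  simp only [Pi.sub_apply]
  rw [increment, DirectSum.sub_apply, reexpand_apply_eq_sum _ _ (hf.1 x)]

end Model

/-! ### Pointwise control of increments and chaining -/

namespace Model

open RegularityStructure

variable {d : ℕ} {𝔰 : Fin d → ℕ} {R : RegularityStructure.{u}}

/-- The points of `P` at which `w` is at most `c r^{-κ}`. -/
def goodSet (P : Set (Fin d → ℝ)) (w : (Fin d → ℝ) → ℝ) (c κ r : ℝ) : Set (Fin d → ℝ) :=
  {x | x ∈ P ∧ w x ≤ c * r ^ (-κ)}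

lemma goodSet_anti {P : Set (Fin d → ℝ)} {w : (Fin d → ℝ) → ℝ} {c κ r r' : ℝ} (hc : 0 ≤ c)
    (hκ : 0 ≤ κ) (hr : 0 < r) (h : r ≤ r') : goodSet P w c κ r' ⊆ goodSet P w c κ r :=
  fun _ hx => ⟨hx.1, hx.2.trans (mul_le_mul_of_nonneg_left
    (Real.rpow_le_rpow_of_nonpos hr h (by linarith)) hc)⟩

/-- Since `c ≥ 1` and `ρ ≤ 1`, the threshold at scale `ρ / 2^n` is at least `2^{κ n}`, which
eventually exceeds `w y`. Minimality of `n` is what makes the chaining sum controllable: all larger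
dyadic scales are bad. -/
lemma exists_first_goodSet {P : Set (Fin d → ℝ)} {w : (Fin d → ℝ) → ℝ} {c κ ρ : ℝ} (hc : 1 ≤ c)
    (hκ : 0 < κ) (hρ : 0 < ρ) (hρ1 : ρ ≤ 1) {y : Fin d → ℝ} (hy : y ∈ P) :
    ∃ n : ℕ, y ∈ goodSet P w c κ (ρ / 2 ^ n) ∧
      ∀ j < n, y ∉ goodSet P w c κ (ρ / 2 ^ j) := by
  classical
  have hex : ∃ n : ℕ, y ∈ goodSet P w c κ (ρ / 2 ^ n) := by
    obtain ⟨n, hn⟩ := pow_unbounded_of_one_lt (w y)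
      (Real.one_lt_rpow (x := 2) (by norm_num) hκ)
    refine ⟨n, hy, hn.le.trans ?_⟩
    have h1 : ρ / 2 ^ n ≤ (2 ^ n)⁻¹ := by
      rw [div_eq_mul_inv]; exact mul_le_of_le_one_left (by positivity) hρ1
    have h2 := Real.rpow_le_rpow_of_nonpos (by positivity) h1 (neg_nonpos.2 hκ.le)
    rw [Real.rpow_neg (by positivity), Real.inv_rpow (by positivity), inv_inv,
      ← Real.rpow_natCast 2 n, ← Real.rpow_mul (by norm_num), mul_comm,
      Real.rpow_mul (by norm_num), Real.rpow_natCast] at h2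
    refine h2.trans ?_
    rw [Real.rpow_natCast]
    exact le_mul_of_one_le_left (by positivity) hc
  exact ⟨Nat.find hex, Nat.find_spec hex, fun j hj => Nat.find_min hex hj⟩

/-- The function `S w` controls a modelled distribution `f` and its increments at the points of
`P`, and points with moderate values of `w` are dense in a quantitative sense. -/
structure IsControlled (M : Model 𝔰 R) (γ κ c C S : ℝ) (f : (Fin d → ℝ) → R.ModelSpace)
    (P : Set (Fin d → ℝ)) (w : (Fin d → ℝ) → ℝ) : Prop where
  mem : ∀ x, f x ∈ R.lowSpace γ
  scale_nonneg : 0 ≤ S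
  nonneg : ∀ x, 0 ≤ w x
  norm_le : ∀ x ∈ P, ∀ ζ ∈ R.lowFinset γ, ‖f x ζ‖ ≤ S * w x
  increment_le : ∀ y ∈ P, ∀ x ∈ P, ∀ ρ a : ℝ, 0 < ρ → ρ ≤ 1 → scaledNorm 𝔰 (y - x) ≤ ρ →
    w y ≤ a → w x ≤ a → ∀ ζ ∈ R.lowFinset γ, ‖M.increment f y x ζ‖ ≤ C * S * a * ρ ^ (γ - ζ)
  dense : ∀ (y : Fin d → ℝ) (r : ℝ), 0 < r → r ≤ 1 →
    ∃ z ∈ goodSet P w c κ r, scaledNorm 𝔰 (y - z) ≤ r / 2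

/-- The interpolation behind the Sobolev loss: with `T = c r^{-κ}` it replaces `w` by `w^θ` at the
price of `r^{-κ(1-θ)}`. -/
lemma le_rpow_mul_rpow {a T θ : ℝ} (ha : 0 ≤ a) (haT : a ≤ T) (hθ : 0 < θ) (hθ1 : θ ≤ 1) :
    a ≤ a ^ θ * T ^ (1 - θ) :=
  calc a = a ^ (θ + (1 - θ)) := by rw [add_sub_cancel, Real.rpow_one]
    _ = a ^ θ * a ^ (1 - θ) := Real.rpow_add_of_nonneg ha hθ.le (by linarith)
    _ ≤ a ^ θ * T ^ (1 - θ) := by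
      have := Real.rpow_le_rpow ha haT (sub_nonneg.2 hθ1)
      gcongr

variable (M : Model 𝔰 R)

/-- The chain is built from the fine scale upwards. A chain for `ρ/2` ends at a point `z'`, and
density at scale `ρ` supplies a last jump of length at most `ρ/2`; the two lengths add up to at most
`ρ`. Each jump contributes one term of the sum. -/
lemma exists_chain_sum (h𝔰 : ∀ i, 0 < 𝔰 i) {γ κ c C₀ : ℝ} (hγ : 0 < γ) (hκ : 0 < κ)
    (hc : 1 ≤ c) (hC₀ : 0 ≤ C₀) :
    ∃ C : ℝ, 0 ≤ C ∧ ∀ S f P w, M.IsControlled γ κ c C₀ S f P w →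
      ∀ (n : ℕ) (y : Fin d → ℝ) (ρ : ℝ), 0 < ρ → ρ ≤ 1 → y ∈ goodSet P w c κ (ρ / 2 ^ n) →
        ∃ z ∈ goodSet P w c κ ρ, scaledNorm 𝔰 (y - z) ≤ ρ ∧ ∀ ζ ∈ R.lowFinset γ,
          ‖M.increment f y z ζ‖ ≤
            C * S * ∑ j ∈ Finset.range n, (ρ / 2 ^ (j + 1)) ^ (γ - κ - ζ) := by
  obtain ⟨CΓ, hCΓ1, hCΓ⟩ := M.exists_reexpand_bound h𝔰 hγ
  refine ⟨CΓ * (C₀ * c), by positivity, fun S f P w hf n => ?_⟩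
  have hS := hf.scale_nonneg
  induction n with
  | zero =>
    intro y ρ hρ _ hy
    refine ⟨y, by simpa using hy, ?_, fun ζ _ => ?_⟩
    · rw [sub_self, scaledNorm_zero h𝔰]; exact hρ.le
    · rw [increment_self]; simp
  | succ n ih =>
    intro y ρ hρ hρ1 hy
    have hρ2 : 0 < ρ / 2 := by positivity
    have hpow : ∀ k : ℕ, ρ / 2 / 2 ^ k = ρ / 2 ^ (k + 1) := fun k => by
      rw [div_div, pow_succ']
    obtain ⟨z', hz', hyz', hinc⟩ := ih y (ρ / 2) hρ2 (by linarith) (by rwa [hpow])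
    obtain ⟨z, hz, hz'z⟩ := hf.dense z' ρ hρ hρ1
    refine ⟨z, hz, ?_, fun ζ hζ => ?_⟩
    · have := scaledNorm_sub_le h𝔰 y z' z
      linarith
    · have hstep : ∀ β ∈ R.lowFinset γ, ζ ≤ β →
          ‖M.increment f z' z β‖ ≤ C₀ * c * S * (ρ / 2) ^ (γ - κ - β) := fun β hβ _ => by
        refine (hf.increment_le z' hz'.1 z hz.1 (ρ / 2) _ hρ2 (by linarith) hz'z hz'.2
          (goodSet_anti (by linarith) hκ.le hρ2 (by linarith) hz).2 β hβ).trans_eq ?_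
        rw [show γ - κ - (β : ℝ) = -κ + (γ - β) by ring, Real.rpow_add hρ2]
        ring
      have h2 := hCΓ y z' (ρ / 2) hρ2 (by linarith) hyz' _
        (increment_mem_lowSpace hf.mem z' z) _ _ (by positivity) ζ hstep
      rw [← increment_add f y z' z, DirectSum.add_apply, Finset.sum_range_succ', mul_add]
      refine (norm_add_le _ _).trans (add_le_add ?_ (h2.trans_eq ?_))
      · simpa only [hpow] using hinc ζ hζ
      · rw [zero_add, pow_one]; ring

lemma rpow_neg_div_two_pow_succ {ρ b : ℝ} (hρ : 0 < ρ) {n : ℕ} :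
    (ρ / 2 ^ (n + 1)) ^ (-b) = 2 ^ b * (ρ / 2 ^ n) ^ (-b) := by
  have h : (0 : ℝ) ≤ ρ / 2 ^ n := by positivity
  rw [pow_succ, ← div_div, Real.div_rpow h zero_le_two, Real.rpow_neg zero_le_two, div_inv_eq_mul,
    mul_comm]

/-- The exponent is negative, so the geometric sum is comparable to its term at the smallest scale.
-/
lemma sum_rpow_le {ρ b : ℝ} (hρ : 0 < ρ) (hb : 0 < b) (n : ℕ) :
    ∑ j ∈ Finset.range n, (ρ / 2 ^ (j + 1)) ^ (-b) ≤
      2 ^ b / (2 ^ b - 1) * (ρ / 2 ^ n) ^ (-b) := by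
  have h1 : (1 : ℝ) < 2 ^ b := Real.one_lt_rpow (by norm_num) hb
  have h2 : (0 : ℝ) < 2 ^ b - 1 := by linarith
  induction n with
  | zero => simp only [Finset.range_zero, Finset.sum_empty]; positivity
  | succ n ih =>
    rw [Finset.sum_range_succ]
    refine (add_le_add_left ih _).trans_eq ?_
    rw [rpow_neg_div_two_pow_succ hρ]
    field_simp
    ring

/-- Every point of `P` can be joined to a good point at scale `ρ`. -/
lemma exists_chain (h𝔰 : ∀ i, 0 < 𝔰 i) {γ κ c C₀ θ : ℝ} (hγ : 0 < γ) (hκ : 0 < κ)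
    (hc : 1 ≤ c) (hC₀ : 0 ≤ C₀) (hθ : 0 < θ) :
    ∃ C : ℝ, 0 ≤ C ∧ ∀ S f P w, M.IsControlled γ κ c C₀ S f P w →
      ∀ (y : Fin d → ℝ) (ρ : ℝ), y ∈ P → 0 < ρ → ρ ≤ 1 →
        ∃ z ∈ goodSet P w c κ ρ, scaledNorm 𝔰 (y - z) ≤ ρ ∧ w z ≤ w y ∧
          ∀ ζ ∈ R.lowFinset γ, ∀ B : ℝ, 0 ≤ B →
            (∀ r, 0 < r → r ≤ ρ → y ∉ goodSet P w c κ (2 * r) →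
              r ^ (γ - κ * (1 - θ) - ζ) ≤ B) →
            ‖M.increment f y z ζ‖ ≤ C * S * (B * w y ^ θ) := by
  obtain ⟨C, hC0, hC⟩ := M.exists_chain_sum h𝔰 hγ hκ hc hC₀
  have hκθ : 0 < κ * θ := by positivity
  have h21 : (1 : ℝ) < 2 ^ (κ * θ) := Real.one_lt_rpow (by norm_num) hκθ
  have h22 : (0 : ℝ) < 2 ^ (κ * θ) - 1 := by linarith
  set A : ℝ := 2 ^ (κ * θ) / (2 ^ (κ * θ) - 1)
  refine ⟨C * (A * 2 ^ (κ * θ)), by positivity, fun S f P w hf y ρ hy hρ hρ1 => ?_⟩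
  have hS := hf.scale_nonneg
  have hw := hf.nonneg
  obtain ⟨n, hn, hmin⟩ := exists_first_goodSet (w := w) hc hκ hρ hρ1 hy
  -- A point already good at scale `ρ` is its own partner, and the increment vanishes.
  rcases n with _ | n
  · refine ⟨y, by simpa using hn, ?_, le_rfl, fun ζ _ B hB _ => ?_⟩
    · rw [sub_self, scaledNorm_zero h𝔰]; exact hρ.le
    · have := Real.rpow_nonneg (hw y) θ
      rw [increment_self, DirectSum.zero_apply, norm_zero]; positivity
  obtain ⟨z, hz, hyz, hinc⟩ := hC S f P w hf _ y ρ hρ hρ1 hn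
  have hlt : ∀ j < n + 1, c * (ρ / 2 ^ j) ^ (-κ) < w y := fun j hj =>
    not_le.1 fun h => hmin j hj ⟨hy, h⟩
  refine ⟨z, hz, hyz, ?_, fun ζ hζ B hB hM => ?_⟩
  · have := hlt 0 (Nat.succ_pos _)
    rw [pow_zero, div_one] at this
    exact hz.2.trans this.le
  · refine (hinc ζ hζ).trans ?_
    -- The last bad scale is `ρ / 2^n`, one step above the first good one; badness there bounds the
    -- largest term of the series by `w y ^ θ`.
    have hwθ : (ρ / 2 ^ n) ^ (-(κ * θ)) ≤ w y ^ θ := by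
      have h1 : (ρ / 2 ^ n) ^ (-κ) ≤ w y :=
        (le_mul_of_one_le_left (by positivity) hc).trans (hlt n (Nat.lt_succ_self n)).le
      rw [← neg_mul, Real.rpow_mul (by positivity)]
      exact Real.rpow_le_rpow (by positivity) h1 hθ.le
    have hsum : ∑ j ∈ Finset.range (n + 1), (ρ / 2 ^ (j + 1)) ^ (γ - κ - ζ) ≤
        B * (A * (2 ^ (κ * θ) * w y ^ θ)) := by
      calc _ ≤ ∑ j ∈ Finset.range (n + 1), B * (ρ / 2 ^ (j + 1)) ^ (-(κ * θ)) := by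
            refine Finset.sum_le_sum fun j hj => ?_
            have hr : 0 < ρ / 2 ^ (j + 1) := by positivity
            -- The first exponent is absorbed into `B`, because the doubled scale `ρ / 2^j` is bad;
            -- the second leaves a series dominated by its finest scale.
            rw [show γ - κ - (ζ : ℝ) = (γ - κ * (1 - θ) - ζ) + -(κ * θ) by ring,
              Real.rpow_add hr]
            refine mul_le_mul_of_nonneg_right (hM _ hr ?_ ?_) (by positivity)
            · exact div_le_self hρ.le (one_le_pow₀ (by norm_num))
            · have : 2 * (ρ / 2 ^ (j + 1)) = ρ / 2 ^ j := by rw [pow_succ]; field_simp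
              rw [this]
              exact hmin j (Finset.mem_range.1 hj)
        _ ≤ B * (A * (ρ / 2 ^ (n + 1)) ^ (-(κ * θ))) := by
            rw [← Finset.mul_sum]
            exact mul_le_mul_of_nonneg_left (sum_rpow_le hρ hκθ _) hB
        _ ≤ _ := by
            rw [rpow_neg_div_two_pow_succ hρ]
            gcongr
    calc _ ≤ C * S * (B * (A * (2 ^ (κ * θ) * w y ^ θ))) := by gcongr
      _ = _ := by ring

/-- The components of homogeneity at most `γ - κ (1 - θ)` are controlled by `w ^ θ`. -/
lemma exists_norm_le_of_goodSet (h𝔰 : ∀ i, 0 < 𝔰 i) {γ κ c C₀ θ : ℝ} (hγ : 0 < γ) (hκ : 0 < κ)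
    (hc : 1 ≤ c) (hC₀ : 0 ≤ C₀) (hθ : 0 < θ) (hθ1 : θ ≤ 1) :
    ∃ C : ℝ, 0 ≤ C ∧ ∀ S f P w, M.IsControlled γ κ c C₀ S f P w →
      ∀ (y : Fin d → ℝ) (r : ℝ), 0 < r → r ≤ 1 → y ∈ goodSet P w c κ r →
        ∀ δ ∈ R.lowFinset γ,
          ‖f y δ‖ ≤ C * S * (r ^ (min 0 (γ - κ * (1 - θ) - (δ : ℝ))) * w y ^ θ) := by
  obtain ⟨CΓ, hCΓ1, hCΓ⟩ := M.exists_reexpand_bound h𝔰 hγ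
  obtain ⟨C, hC0, hC⟩ := M.exists_chain h𝔰 hγ hκ hc hC₀ hθ
  refine ⟨C * 2 ^ κ + CΓ * c, by positivity, fun S f P w hf y r hr hr1 hy δ hδ => ?_⟩
  have hS := hf.scale_nonneg
  have hwθ := Real.rpow_nonneg (hf.nonneg y) θ
  -- Chain up to scale one, where good points have `w ≤ c`, and bound `f y` by the increment plus
  -- the re-expansion of `f z`.
  obtain ⟨z, hz, hyz, hwz, hinc⟩ := hC S f P w hf y 1 hy.1 one_pos le_rfl
  set m := min 0 (γ - κ * (1 - θ) - (δ : ℝ)) with hm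
  have hm0 : m ≤ 0 := min_le_left _ _
  have hδγ := mem_lowFinset.1 hδ
  -- This makes the constant `2^{-m}` independent of `δ`.
  have hmκ : -m ≤ κ := by
    have : -κ ≤ m := by
      refine le_min (by linarith) ?_
      nlinarith [mul_pos hκ hθ]
    linarith
  have h1 : ‖M.increment f y z δ‖ ≤ C * S * ((2 ^ κ * r ^ m) * w y ^ θ) := by
    refine hinc δ hδ _ (by positivity) fun r' hr' hr'1 hbad => ?_
    -- As `y` is good at scale `r`, it is good at all smaller scales, so the chain never descends to
    -- `r/2` or below.
    have hlt : r / 2 < r' := by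
      by_contra hcon
      exact hbad (goodSet_anti (by linarith) hκ.le (by positivity) (by linarith) hy)
    calc r' ^ (γ - κ * (1 - θ) - (δ : ℝ)) ≤ r' ^ m :=
          Real.rpow_le_rpow_of_exponent_ge hr' hr'1 (min_le_right _ _)
      _ ≤ (r / 2) ^ m := Real.rpow_le_rpow_of_nonpos (by positivity) hlt.le hm0
      _ = 2 ^ (-m) * r ^ m := by
          rw [Real.div_rpow hr.le (by norm_num), Real.rpow_neg (by norm_num)]; ring
      _ ≤ 2 ^ κ * r ^ m := by
          gcongr
          norm_num
  have hwz' : w z ≤ c * w y ^ θ := by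
    have hz2 : w z ≤ c := by simpa using hz.2
    calc w z ≤ w z ^ θ * c ^ (1 - θ) := le_rpow_mul_rpow (hf.nonneg z) hz2 hθ hθ1
      _ ≤ w y ^ θ * c ^ (1 : ℝ) := by
          have h3 := Real.rpow_le_rpow (hf.nonneg z) hwz hθ.le
          have h4 := Real.rpow_le_rpow_of_exponent_le hc (show 1 - θ ≤ 1 by linarith)
          gcongr
      _ = c * w y ^ θ := by rw [Real.rpow_one, mul_comm]
  have h2 := hCΓ y z 1 one_pos (by norm_num) hyz _ (hf.mem z) 0 (S * (c * w y ^ θ))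
    (by positivity) δ fun β hβ _ => by
      rw [Real.one_rpow, mul_one]
      exact (hf.norm_le z hz.1 β hβ).trans (mul_le_mul_of_nonneg_left hwz' hS)
  rw [Real.one_rpow, mul_one] at h2
  have h3 : f y δ = M.increment f y z δ + M.reexpand y z (f z) δ := by
    rw [← DirectSum.add_apply, increment, sub_add_cancel]
  have h4 : 1 ≤ r ^ m := Real.one_le_rpow_of_pos_of_le_one_of_nonpos hr hr1 hm0
  rw [h3]
  refine (norm_add_le _ _).trans ((add_le_add h1 h2).trans ?_)
  calc _ ≤ C * S * (2 ^ κ * r ^ m * w y ^ θ) + CΓ * (S * (c * (r ^ m * w y ^ θ))) := by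
        have h5 : w y ^ θ ≤ r ^ m * w y ^ θ := le_mul_of_one_le_left hwθ h4
        gcongr
    _ = _ := by ring

end Model

/-! ### Pointwise bounds on increments of projections -/

namespace Model

open RegularityStructure

variable {d : ℕ} {𝔰 : Fin d → ℕ} {R : RegularityStructure.{u}} (M : Model 𝔰 R)

/-- Every point of `P` is good at some scale, and for these homogeneities the exponent `min 0 _` is
zero, so that scale leaves no trace in the bound. -/
lemma exists_norm_le_of_le (h𝔰 : ∀ i, 0 < 𝔰 i) {γ κ c C₀ θ : ℝ} (hγ : 0 < γ) (hκ : 0 < κ)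
    (hc : 1 ≤ c) (hC₀ : 0 ≤ C₀) (hθ : 0 < θ) (hθ1 : θ ≤ 1) :
    ∃ C : ℝ, 0 ≤ C ∧ ∀ S f P w, M.IsControlled γ κ c C₀ S f P w →
      ∀ y ∈ P, ∀ δ ∈ R.lowFinset γ, (δ : ℝ) ≤ γ - κ * (1 - θ) → ‖f y δ‖ ≤ C * S * w y ^ θ := by
  obtain ⟨C, hC0, hC⟩ := M.exists_norm_le_of_goodSet h𝔰 hγ hκ hc hC₀ hθ hθ1
  refine ⟨C, hC0, fun S f P w hf y hy δ hδ hle => ?_⟩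
  obtain ⟨n, hn, -⟩ := exists_first_goodSet (w := w) hc hκ one_pos le_rfl hy
  have h := hC S f P w hf y _ (by positivity) (div_le_self zero_le_one (one_le_pow₀ (by norm_num)))
    hn δ hδ
  rwa [min_eq_left (by linarith), Real.rpow_zero, one_mul] at h

/-- Telescoping along `y → y' → x' → x`. The projection does not commute with `Γ`; the last term is
the resulting error, carried by the components of `Γ_{x,x'} f(x')` of homogeneity at least `γ`. -/
lemma increment_projLow_eq (γ : ℝ) (f : (Fin d → ℝ) → R.ModelSpace) (x y x' y' : Fin d → ℝ)
    {ζ : R.A} (hζ : (ζ : ℝ) < γ) :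
    M.increment (fun x => R.projLow γ (f x)) y x ζ =
      M.increment f y y' ζ + M.reexpand y y' (M.increment f y' x') ζ
        - M.reexpand y x (R.projLow γ (M.increment f x x')) ζ
        + M.reexpand y x (M.reexpand x x' (f x') - R.projLow γ (M.reexpand x x' (f x'))) ζ := by
  have h1 : M.increment (fun x => R.projLow γ (f x)) y x ζ =
      (f y - M.reexpand y x (R.projLow γ (f x))) ζ := by
    rw [increment, DirectSum.sub_apply, DirectSum.sub_apply, projLow_apply_of_lt _ hζ]
  rw [h1, ← DirectSum.add_apply, ← DirectSum.sub_apply, ← DirectSum.add_apply, increment_add]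
  congr 1
  simp only [increment, map_sub, reexpand_reexpand]
  abel

/-- Both endpoints are chained to points `x'`, `y'` good at scale `ρ = ‖y - x‖`, and the four terms
of `increment_projLow_eq` are bounded separately. The points `x'`, `y'` are at distance at most
`3ρ`, whence the restriction `ρ ≤ 1/3`. -/
lemma exists_increment_projLow_bound_of_small (h𝔰 : ∀ i, 0 < 𝔰 i) {γ γ₁ γ₂ κ c C₀ θ : ℝ}
    (hγ : 0 < γ₁) (hγγ₁ : γ ≤ γ₁) (hκ : 0 < κ) (hc : 1 ≤ c) (hC₀ : 0 ≤ C₀) (hθ : 0 < θ)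
    (hθ1 : θ ≤ 1) (h₂ : γ < γ₂) (h₂' : γ₂ ≤ γ₁ - κ * (1 - θ))
    (hgap : ∀ δ : R.A, γ ≤ δ → γ₂ ≤ δ) :
    ∃ C : ℝ, 0 ≤ C ∧ ∀ S f P w, M.IsControlled γ₁ κ c C₀ S f P w →
      ∀ y ∈ P, ∀ x ∈ P, 0 < scaledNorm 𝔰 (y - x) → scaledNorm 𝔰 (y - x) ≤ 1 / 3 →
        ∀ ζ ∈ R.lowFinset γ, ‖M.increment (fun x => R.projLow γ (f x)) y x ζ‖ ≤
          C * S * (scaledNorm 𝔰 (y - x) ^ (γ₂ - ζ) * (w x ^ θ + w y ^ θ)) := by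
  obtain ⟨m, hm⟩ := R.bddBelow
  obtain ⟨CΓ, hCΓ1, hCΓ⟩ := M.exists_reexpand_bound h𝔰 hγ
  obtain ⟨C₁, hC₁0, hC₁⟩ := M.exists_chain h𝔰 hγ hκ hc hC₀ hθ
  obtain ⟨C₂, hC₂0, hC₂⟩ := M.exists_norm_le_of_goodSet h𝔰 hγ hκ hc hC₀ hθ hθ1
  set K : ℝ := C₀ * c * 3 ^ (γ₁ - m) with hK
  refine ⟨C₁ + CΓ * K + CΓ * C₁ + CΓ * (CΓ * C₂), by positivity,
    fun S f P w hf y hy x hx hρ hρ3 ζ hζ => ?_⟩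
  set ρ := scaledNorm 𝔰 (y - x) with hρdef
  have hS := hf.scale_nonneg
  have hζγ := mem_lowFinset.1 hζ
  set W := w x ^ θ + w y ^ θ with hW
  have hwx := Real.rpow_nonneg (hf.nonneg x) θ
  have hwy := Real.rpow_nonneg (hf.nonneg y) θ
  have hWx : w x ^ θ ≤ W := by linarith
  have hWy : w y ^ θ ≤ W := by linarith
  have hW0 : 0 ≤ W := by linarith
  have hρ1 : ρ ≤ 1 := by linarith
  have hexp : ∀ {a b : ℝ}, b ≤ a → ρ ^ a ≤ ρ ^ b := fun h =>
    Real.rpow_le_rpow_of_exponent_ge hρ hρ1 h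
  have hζ₁ : ζ ∈ R.lowFinset γ₁ := mem_lowFinset.2 (hζγ.trans_le hγγ₁)
  have hchain : ∀ v z : Fin d → ℝ, w v ^ θ ≤ W → (∀ ζ ∈ R.lowFinset γ₁, ∀ B : ℝ, 0 ≤ B →
      (∀ r, 0 < r → r ≤ ρ → v ∉ goodSet P w c κ (2 * r) → r ^ (γ₁ - κ * (1 - θ) - ζ) ≤ B) →
      ‖M.increment f v z ζ‖ ≤ C₁ * S * (B * w v ^ θ)) → ∀ β ∈ R.lowFinset γ,
      ‖M.increment f v z β‖ ≤ C₁ * S * W * ρ ^ (γ₂ - β) := fun v z hv h β hβ => by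
    have hβγ := mem_lowFinset.1 hβ
    refine (h β (mem_lowFinset.2 (hβγ.trans_le hγγ₁)) (ρ ^ (γ₂ - β)) (by positivity)
      fun r hr hrρ _ => ?_).trans ?_
    -- The exponent is at least `γ₂ - β > 0`, so the power is largest at `r = ρ` and `B = ρ^{γ₂-β}`
    -- is admissible in the chaining bound.
    · exact (Real.rpow_le_rpow hr.le hrρ (by linarith)).trans (hexp (by linarith))
    · calc _ ≤ C₁ * S * (ρ ^ (γ₂ - β) * W) := by gcongr
        _ = _ := by ring
  obtain ⟨x', hx', hxx', hwx', hincx⟩ := hC₁ S f P w hf x ρ hx hρ hρ1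
  obtain ⟨y', hy', hyy', hwy', hincy⟩ := hC₁ S f P w hf y ρ hy hρ hρ1
  have hWx' : w x' ^ θ ≤ W := (Real.rpow_le_rpow (hf.nonneg _) hwx' hθ.le).trans hWx
  have hWy' : w y' ^ θ ≤ W := (Real.rpow_le_rpow (hf.nonneg _) hwy' hθ.le).trans hWy
  have t1 : ‖M.increment f y y' ζ‖ ≤ C₁ * S * W * ρ ^ (γ₂ - ζ) := hchain y y' hWy hincy ζ hζ
  have t2 : ‖M.reexpand y y' (M.increment f y' x') ζ‖ ≤ CΓ * (K * S * W * ρ ^ (γ₂ - ζ)) := by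
    refine hCΓ y y' ρ hρ (by linarith) hyy' _ (increment_mem_lowSpace hf.mem _ _) _ _
      (by positivity) ζ fun β hβ _ => ?_
    have hβγ := mem_lowFinset.1 hβ
    set a := max (w y') (w x')
    have ha0 : 0 ≤ a := (hf.nonneg y').trans (le_max_left _ _)
    have haW : a ^ θ ≤ W := by
      rcases max_cases (w y') (w x') with h | h <;> rw [show a = _ from h.1] <;> assumption
    -- Goodness at scale `ρ` and interpolation: `a ≤ a^θ (c ρ^{-κ})^{1-θ}`.
    have haT : a ≤ W * (c * ρ ^ (-(κ * (1 - θ)))) := by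
      refine (le_rpow_mul_rpow ha0 (max_le hy'.2 hx'.2) hθ hθ1).trans ?_
      rw [Real.mul_rpow (by linarith) (by positivity), ← Real.rpow_mul hρ.le, neg_mul]
      have : c ^ (1 - θ) ≤ c := by
        simpa using Real.rpow_le_rpow_of_exponent_le hc (show 1 - θ ≤ 1 by linarith)
      gcongr
    have hdist : scaledNorm 𝔰 (y' - x') ≤ 3 * ρ := by
      have e1 := scaledNorm_sub_le h𝔰 y' y x'
      have e2 := scaledNorm_sub_le h𝔰 y x x'
      rw [scaledNorm_sub_comm y' y] at e1
      linarith
    refine (hf.increment_le y' hy'.1 x' hx'.1 (3 * ρ) a (by positivity) (by linarith) hdist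
      (le_max_left _ _) (le_max_right _ _) β hβ).trans ?_
    have h3 : (3 : ℝ) ^ (γ₁ - β) ≤ 3 ^ (γ₁ - m) :=
      Real.rpow_le_rpow_of_exponent_le (by norm_num) (by have := hm β.2; linarith)
    have h4 : ρ ^ (-(κ * (1 - θ))) * ρ ^ (γ₁ - β) ≤ ρ ^ (γ₂ - β) := by
      rw [← Real.rpow_add hρ]
      exact hexp (by linarith)
    rw [Real.mul_rpow (by norm_num) hρ.le]
    calc C₀ * S * a * (3 ^ (γ₁ - (β : ℝ)) * ρ ^ (γ₁ - (β : ℝ)))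
        ≤ C₀ * S * (W * (c * ρ ^ (-(κ * (1 - θ))))) * (3 ^ (γ₁ - m) * ρ ^ (γ₁ - (β : ℝ))) := by
          gcongr
      _ = C₀ * c * 3 ^ (γ₁ - m) * S * W * (ρ ^ (-(κ * (1 - θ))) * ρ ^ (γ₁ - β)) := by ring
      _ ≤ _ := by gcongr
  have t3 : ‖M.reexpand y x (R.projLow γ (M.increment f x x')) ζ‖ ≤
      CΓ * (C₁ * S * W * ρ ^ (γ₂ - ζ)) := by
    refine hCΓ y x ρ hρ (by linarith) le_rfl _
      (lowSpace_mono hγγ₁ (projLow_mem_lowSpace _)) _ _ (by positivity) ζ fun β _ _ => ?_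
    rcases lt_or_ge (β : ℝ) γ with h | h
    · rw [projLow_apply_of_lt _ h]
      exact hchain x x' hWx hincx β (mem_lowFinset.2 h)
    · rw [projLow_apply_of_le _ h, norm_zero]
      positivity
  have t4 : ‖M.reexpand y x (M.reexpand x x' (f x') - R.projLow γ (M.reexpand x x' (f x'))) ζ‖ ≤
      CΓ * (CΓ * (C₂ * S * W) * ρ ^ (γ₂ - ζ)) := by
    have hmem := reexpand_mem_lowSpace (M := M) x x' (hf.mem x')
    refine hCΓ y x ρ hρ (by linarith) le_rfl _
      (Submodule.sub_mem _ hmem (lowSpace_mono hγγ₁ (projLow_mem_lowSpace _))) _ _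
      (by positivity) ζ fun β hβ _ => ?_
    rw [DirectSum.sub_apply]
    rcases lt_or_ge (β : ℝ) γ with h | h
    · rw [projLow_apply_of_lt _ h, sub_self, norm_zero]
      positivity
    · rw [projLow_apply_of_le _ h, sub_zero, mul_assoc]
      refine hCΓ x x' ρ hρ (by linarith) hxx' _ (hf.mem x') _ _ (by positivity) β
        fun δ hδ hβδ => ?_
      -- The gap makes `γ₂ - δ` nonpositive, hence below both entries of the minimum in the bound at
      -- good points. Without it the dropped components would not yield a power beyond `γ`.
      have hγδ : γ₂ ≤ δ := hgap δ (h.trans hβδ)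
      refine (hC₂ S f P w hf x' ρ hρ hρ1 hx' δ hδ).trans ?_
      have := hexp (a := min 0 (γ₁ - κ * (1 - θ) - (δ : ℝ))) (b := γ₂ - δ)
        (le_min (by linarith) (by linarith))
      calc _ ≤ C₂ * S * (ρ ^ (γ₂ - (δ : ℝ)) * W) := by
            have := Real.rpow_nonneg (hf.nonneg x') θ
            gcongr
        _ = _ := by ring
  rw [M.increment_projLow_eq γ f x y x' y' hζγ]
  calc _ ≤ C₁ * S * W * ρ ^ (γ₂ - ζ) + CΓ * (K * S * W * ρ ^ (γ₂ - ζ)) +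
        CΓ * (C₁ * S * W * ρ ^ (γ₂ - ζ)) + CΓ * (CΓ * (C₂ * S * W) * ρ ^ (γ₂ - ζ)) := by
        refine (norm_add_le _ _).trans (add_le_add ?_ t4)
        exact (norm_sub_le _ _).trans (add_le_add ((norm_add_le _ _).trans (add_le_add t1 t2)) t3)
    _ = _ := by ring

/-- Increments of the projection of a controlled modelled distribution, up to distance `4`. -/
lemma exists_increment_projLow_bound (h𝔰 : ∀ i, 0 < 𝔰 i) {γ γ₁ γ₂ κ c C₀ θ : ℝ}
    (hγ : 0 < γ₁) (hγγ₁ : γ ≤ γ₁) (hκ : 0 < κ) (hc : 1 ≤ c) (hC₀ : 0 ≤ C₀) (hθ : 0 < θ)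
    (hθ1 : θ ≤ 1) (h₂ : γ < γ₂) (h₂' : γ₂ ≤ γ₁ - κ * (1 - θ))
    (hgap : ∀ δ : R.A, γ ≤ δ → γ₂ ≤ δ) :
    ∃ C : ℝ, 0 ≤ C ∧ ∀ S f P w, M.IsControlled γ₁ κ c C₀ S f P w →
      ∀ y ∈ P, ∀ x ∈ P, scaledNorm 𝔰 (y - x) ≤ 4 →
        ∀ ζ ∈ R.lowFinset γ, ‖M.increment (fun x => R.projLow γ (f x)) y x ζ‖ ≤
          C * S * (scaledNorm 𝔰 (y - x) ^ (γ₂ - ζ) * (w x ^ θ + w y ^ θ)) := by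
  obtain ⟨m, hm⟩ := R.bddBelow
  obtain ⟨CΓ, hCΓ1, hCΓ⟩ := M.exists_reexpand_bound h𝔰 hγ
  obtain ⟨C₁, hC₁0, hC₁⟩ := M.exists_increment_projLow_bound_of_small h𝔰 hγ hγγ₁ hκ hc hC₀ hθ
    hθ1 h₂ h₂' hgap
  obtain ⟨C₂, hC₂0, hC₂⟩ := M.exists_norm_le_of_le h𝔰 hγ hκ hc hC₀ hθ hθ1
  set K : ℝ := (C₂ + CΓ * (C₂ * 4 ^ (γ₁ - m))) * 3 ^ (γ₂ - m) with hK
  refine ⟨max C₁ K, hC₁0.trans (le_max_left _ _), fun S f P w hf y hy x hx hρ4 ζ hζ => ?_⟩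
  set ρ := scaledNorm 𝔰 (y - x) with hρdef
  have hρ0 : 0 ≤ ρ := scaledNorm_nonneg _
  have hS := hf.scale_nonneg
  have hwx := Real.rpow_nonneg (hf.nonneg x) θ
  have hwy := Real.rpow_nonneg (hf.nonneg y) θ
  have hζγ := mem_lowFinset.1 hζ
  have hmζ : m ≤ ζ := hm ζ.2
  rcases hρ0.eq_or_lt with h0 | h0
  · have : y = x := sub_eq_zero.1 (eq_zero_of_scaledNorm_eq_zero h𝔰 h0.symm)
    subst this
    rw [increment_self, DirectSum.zero_apply, norm_zero]
    have := hC₁0.trans (le_max_left C₁ K)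
    positivity
  -- Beyond distance `1/3` the factor `ρ^{γ₂-ζ}` is bounded below, because `3ρ > 1`, so size bounds
  -- at the two points replace chaining.
  rcases le_or_gt ρ (1 / 3) with h3 | h3
  · refine (hC₁ S f P w hf y hy x hx h0 h3 ζ hζ).trans ?_
    gcongr
    exact le_max_left _ _
  · have hζ₁ : ζ ∈ R.lowFinset γ₁ := mem_lowFinset.2 (hζγ.trans_le hγγ₁)
    have b1 : ‖f y ζ‖ ≤ C₂ * S * w y ^ θ := hC₂ S f P w hf y hy ζ hζ₁ (by linarith)
    have b2 : ‖M.reexpand y x (R.projLow γ (f x)) ζ‖ ≤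
        CΓ * (C₂ * S * w x ^ θ * 4 ^ (γ₁ - ζ)) := by
      refine hCΓ y x 4 (by norm_num) le_rfl hρ4 _
        (lowSpace_mono hγγ₁ (projLow_mem_lowSpace _)) _ _ (by positivity) ζ fun β hβ _ => ?_
      have hβ₁ := mem_lowFinset.1 hβ
      have h4 : (1 : ℝ) ≤ 4 ^ (γ₁ - β) := Real.one_le_rpow (by norm_num) (by linarith)
      rcases lt_or_ge (β : ℝ) γ with h | h
      · rw [projLow_apply_of_lt _ h]
        exact (hC₂ S f P w hf x hx β hβ (by linarith)).trans
          (le_mul_of_one_le_right (by positivity) h4)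
      · rw [projLow_apply_of_le _ h, norm_zero]
        positivity
    have h4 : (4 : ℝ) ^ (γ₁ - ζ) ≤ 4 ^ (γ₁ - m) :=
      Real.rpow_le_rpow_of_exponent_le (by norm_num) (by linarith)
    have h5 : 1 ≤ 3 ^ (γ₂ - m) * ρ ^ (γ₂ - ζ) := by
      calc (1 : ℝ) ≤ (3 * ρ) ^ (γ₂ - (ζ : ℝ)) := Real.one_le_rpow (by linarith) (by linarith)
        _ = 3 ^ (γ₂ - (ζ : ℝ)) * ρ ^ (γ₂ - (ζ : ℝ)) := Real.mul_rpow (by norm_num) hρ0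
        _ ≤ _ := by
          have := Real.rpow_le_rpow_of_exponent_le (show (1 : ℝ) ≤ 3 by norm_num)
            (show γ₂ - (ζ : ℝ) ≤ γ₂ - m by linarith)
          gcongr
    rw [increment, DirectSum.sub_apply, projLow_apply_of_lt _ hζγ]
    calc _ ≤ C₂ * S * w y ^ θ + CΓ * (C₂ * S * w x ^ θ * 4 ^ (γ₁ - (ζ : ℝ))) :=
          (norm_sub_le _ _).trans (add_le_add b1 b2)
      _ ≤ C₂ * S * (w x ^ θ + w y ^ θ) + CΓ * (C₂ * S * (w x ^ θ + w y ^ θ) * 4 ^ (γ₁ - m)) := by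
          gcongr <;> linarith
      _ = (C₂ + CΓ * (C₂ * 4 ^ (γ₁ - m))) * S * (w x ^ θ + w y ^ θ) * 1 := by ring
      _ ≤ (C₂ + CΓ * (C₂ * 4 ^ (γ₁ - m))) * S * (w x ^ θ + w y ^ θ) *
          (3 ^ (γ₂ - m) * ρ ^ (γ₂ - ζ)) := by gcongr
      _ = K * S * (ρ ^ (γ₂ - (ζ : ℝ)) * (w x ^ θ + w y ^ θ)) := by rw [hK]; ring
      _ ≤ _ := by
          gcongr
          exact le_max_right _ _

end Model

/-! ### Control of modelled distributions in Triebel–Lizorkin spaces -/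

lemma eLpNorm_le_const_mul {α : Type*} [MeasurableSpace α] {μ : Measure α} {f g : α → ℝ≥0∞}
    {c : ℝ≥0∞} (hc : c ≠ ∞) (h : ∀ᵐ x ∂μ, f x ≤ c * g x) (p : ℝ≥0∞) :
    eLpNorm f p μ ≤ c * eLpNorm g p μ := by
  lift c to ℝ≥0 using hc
  exact eLpNorm_le_nnreal_smul_eLpNorm_of_ae_le_mul' (by simpa using h) p

/-- A constant `a` on `s` has norm `a μ(s)^{1/p} ≥ a/2`, since `1/p ≤ 1`. -/
lemma le_eLpNorm_of_le_on {α : Type*} [MeasurableSpace α] {μ : Measure α} {g : α → ℝ≥0∞}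
    {s : Set α} (hs : MeasurableSet s) {a : ℝ≥0∞} (h : ∀ x ∈ s, a ≤ g x) (hμ : 1 / 2 ≤ μ s)
    {p : ℝ≥0∞} (hp : 1 ≤ p) : a ≤ 2 * eLpNorm g p μ := by
  have hp0 : p ≠ 0 := (zero_lt_one.trans_le hp).ne'
  have h1 : eLpNorm (s.indicator fun _ => a) p μ ≤ eLpNorm g p μ :=
    eLpNorm_mono_enorm fun x => by
      by_cases hx : x ∈ s
      · simpa [hx] using h x hx
      · simp [hx]
  have hμ0 : μ s ≠ 0 := fun h0 => by simp [h0] at hμ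
  rw [eLpNorm_indicator_const' hs hμ0 hp0, enorm_eq_self] at h1
  have h2 : (1 / 2 : ℝ≥0∞) ≤ μ s ^ (1 / p.toReal) := by
    have hexp : 1 / p.toReal ≤ 1 := by
      -- For `p = ∞` the exponent reads `1 / 0 = 0`.
      rcases eq_or_ne p ∞ with rfl | hpt
      · simp
      · exact div_le_one_of_le₀ ((ENNReal.ofReal_le_iff_le_toReal hpt).1 (by simpa using hp))
          ENNReal.toReal_nonneg
    calc (1 / 2 : ℝ≥0∞) = (1 / 2) ^ (1 : ℝ) := (ENNReal.rpow_one _).symm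
      _ ≤ (1 / 2) ^ (1 / p.toReal) := ENNReal.rpow_le_rpow_of_exponent_ge (by simp) hexp
      _ ≤ _ := ENNReal.rpow_le_rpow hμ (by positivity)
  calc a = 2 * (a * (1 / 2)) := by
        rw [mul_left_comm, one_div, ENNReal.mul_inv_cancel two_ne_zero ENNReal.ofNat_ne_top,
          mul_one]
    _ ≤ 2 * (a * μ s ^ (1 / p.toReal)) := by gcongr
    _ ≤ _ := by gcongr

namespace Model

open RegularityStructure

variable {d : ℕ} {𝔰 : Fin d → ℕ} {R : RegularityStructure.{u}} (M : Model 𝔰 R)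

/-- The weighted average `⨍_{Q(0,4l)} |Δ_{Γ,h} f(x)|_ζ / l^{γ-ζ} dh`. -/
noncomputable def avgIncrement (γ : ℝ) (f : (Fin d → ℝ) → R.ModelSpace) (ζ : R.A) (l : ℝ)
    (x : Fin d → ℝ) : ℝ≥0∞ :=
  ⨍⁻ h in scaledBall 𝔰 0 (4 * l),
    ‖M.diff f h x ζ‖ₑ / ENNReal.ofReal (l ^ (γ - (ζ : ℝ))) ∂volume

/-- The supremum of the weighted averages over the dyadic scales `1/2, 1/4, …`. -/
noncomputable def maximalIncrement (γ : ℝ) (f : (Fin d → ℝ) → R.ModelSpace) (ζ : R.A)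
    (x : Fin d → ℝ) : ℝ≥0∞ :=
  ⨆ k : ℕ, M.avgIncrement γ f ζ ((1 / 2 : ℝ) ^ k / 2) x

/-- A function dominating the size of `f` and of its averaged increments. -/
noncomputable def majorant (γ : ℝ) (f : (Fin d → ℝ) → R.ModelSpace) (x : Fin d → ℝ) : ℝ≥0∞ :=
  ∑ ζ ∈ R.lowFinset γ, (‖f x ζ‖ₑ + M.maximalIncrement γ f ζ x)

variable {M}

/-- Doubling of volumes costs `2^{|𝔰|}` and the change of weight `2^{γ-ζ}`. This allows passing
between continuous and dyadic scales. -/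
lemma avgIncrement_le (h𝔰 : ∀ i, 0 < 𝔰 i) {γ : ℝ} (f : (Fin d → ℝ) → R.ModelSpace) {ζ : R.A}
    (hζ : (ζ : ℝ) < γ) {l l' : ℝ} (hl : 0 < l) (h : l ≤ l') (h' : l' ≤ 2 * l)
    (x : Fin d → ℝ) :
    M.avgIncrement γ f ζ l x ≤
      ENNReal.ofReal (2 ^ scalingSum 𝔰 * 2 ^ (γ - ζ)) * M.avgIncrement γ f ζ l' x := by
  have hl' : 0 < l' := hl.trans_le h
  refine (setLAverage_scaledBall_le h𝔰 _ (r := 4 * l) (r' := 4 * l') (by positivity) (by linarith)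
    (by linarith)).trans ?_
  rw [ENNReal.ofReal_mul (by positivity), mul_assoc]
  gcongr
  rw [avgIncrement, setLAverage_eq, setLAverage_eq, ← mul_div_assoc,
    ← lintegral_const_mul' _ _ ENNReal.ofReal_ne_top]
  refine ENNReal.div_le_div_right (lintegral_mono fun h => ?_) _
  rw [← mul_div_assoc, ENNReal.div_eq_inv_mul, ENNReal.div_eq_inv_mul, ← mul_assoc]
  refine mul_le_mul' ?_ le_rfl
  rw [← ENNReal.ofReal_inv_of_pos (by positivity), ← ENNReal.ofReal_inv_of_pos (by positivity),
    ← ENNReal.ofReal_mul (by positivity)]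
  refine ENNReal.ofReal_le_ofReal ?_
  have h1 : l' ^ (γ - ζ) ≤ 2 ^ (γ - ζ) * l ^ (γ - ζ) := by
    rw [← Real.mul_rpow (by norm_num) hl.le]
    exact Real.rpow_le_rpow hl'.le h' (by linarith)
  rw [inv_le_iff_one_le_mul₀ (by positivity), inv_mul_eq_div, div_mul_eq_mul_div,
    one_le_div (by positivity)]
  exact h1

lemma avgIncrement_le_maximalIncrement (h𝔰 : ∀ i, 0 < 𝔰 i) {γ : ℝ}
    (f : (Fin d → ℝ) → R.ModelSpace) {ζ : R.A} (hζ : (ζ : ℝ) < γ) {l : ℝ} (hl : 0 < l)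
    (hl' : l ≤ 1 / 2) (x : Fin d → ℝ) :
    M.avgIncrement γ f ζ l x ≤
      ENNReal.ofReal (2 ^ scalingSum 𝔰 * 2 ^ (γ - ζ)) * M.maximalIncrement γ f ζ x := by
  obtain ⟨k, hk, hk'⟩ := exists_dyadic (r := 2 * l) (by positivity) (by linarith)
  refine (avgIncrement_le h𝔰 f hζ hl (l' := (1 / 2 : ℝ) ^ k / 2) (by linarith) (by linarith)
    x).trans ?_
  gcongr
  exact le_iSup (fun k : ℕ => M.avgIncrement γ f ζ ((1 / 2 : ℝ) ^ k / 2) x) k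

/-- The density is at least `1/(2l)` on an interval of length `l`; the bound `l ≤ 1/2` keeps the
interval inside `(0, 1]`. -/
lemma half_le_scaleMeasure_Ioc {l : ℝ} (hl : 0 < l) (hl' : l ≤ 1 / 2) :
    1 / 2 ≤ scaleMeasure (Ioc l (2 * l)) := by
  have hsub : Ioc l (2 * l) ⊆ Ioc (0 : ℝ) 1 := fun t ht =>
    ⟨hl.trans ht.1, ht.2.trans (by linarith)⟩
  rw [scaleMeasure, withDensity_apply _ measurableSet_Ioc,
    Measure.restrict_restrict measurableSet_Ioc, inter_eq_left.2 hsub]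
  calc (1 / 2 : ℝ≥0∞) = ∫⁻ _ in Ioc l (2 * l), ENNReal.ofReal (2 * l)⁻¹ := by
        rw [setLIntegral_const, Real.volume_Ioc, ← ENNReal.ofReal_mul (by positivity)]
        rw [show (2 * l)⁻¹ * (2 * l - l) = 1 / 2 by field_simp; ring,
          ENNReal.ofReal_div_of_pos two_pos]
        simp
    _ ≤ _ := setLIntegral_mono' measurableSet_Ioc fun t ht =>
        ENNReal.ofReal_le_ofReal (inv_anti₀ (hl.trans ht.1) ht.2)

/-- Each dyadic average is dominated by the averages at all scales of `(l, 2l]`, a set of measure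
bounded below. Here the fine index `q` is given up, with a constant independent of it. -/
lemma maximalIncrement_le_eLpNorm (h𝔰 : ∀ i, 0 < 𝔰 i) {γ : ℝ}
    (f : (Fin d → ℝ) → R.ModelSpace) {ζ : R.A} (hζ : (ζ : ℝ) < γ) {q : ℝ≥0∞} (hq : 1 ≤ q)
    (x : Fin d → ℝ) :
    M.maximalIncrement γ f ζ x ≤ ENNReal.ofReal (2 ^ scalingSum 𝔰 * 2 ^ (γ - ζ)) * 2 *
      eLpNorm (fun l => M.avgIncrement γ f ζ l x) q scaleMeasure := by
  refine iSup_le fun k => ?_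
  set l : ℝ := (1 / 2 : ℝ) ^ k / 2
  have hl : 0 < l := by positivity
  have hl' : l ≤ 1 / 2 := by
    have : (1 / 2 : ℝ) ^ k ≤ 1 := pow_le_one₀ (by norm_num) (by norm_num)
    simp only [l]; linarith
  have hc0 : ENNReal.ofReal (2 ^ scalingSum 𝔰 * 2 ^ (γ - (ζ : ℝ))) ≠ 0 := by
    rw [Ne, ENNReal.ofReal_eq_zero, not_le]; positivity
  have h := le_eLpNorm_of_le_on (g := fun l => M.avgIncrement γ f ζ l x) measurableSet_Ioc
    (a := M.avgIncrement γ f ζ l x / ENNReal.ofReal (2 ^ scalingSum 𝔰 * 2 ^ (γ - (ζ : ℝ))))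
    (fun t ht => ENNReal.div_le_of_le_mul' (avgIncrement_le h𝔰 f hζ hl ht.1.le ht.2 x))
    (half_le_scaleMeasure_Ioc hl hl') hq
  rw [ENNReal.div_le_iff_le_mul (Or.inl hc0) (Or.inl ENNReal.ofReal_ne_top)] at h
  exact h.trans_eq (by ring)

lemma aemeasurable_avgIncrement (hd : 0 < d) (h𝔰 : ∀ i, 0 < 𝔰 i) {γ : ℝ} (hγ : 0 < γ)
    {f : (Fin d → ℝ) → R.ModelSpace} (hf : M.IsMeasurableInto γ f) {ζ : R.A}
    (hζ : ζ ∈ R.lowFinset γ) (l : ℝ) : AEMeasurable (M.avgIncrement γ f ζ l) volume := by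
  have h1 := (M.aestronglyMeasurable_diff_prod hd h𝔰 hγ hf hζ).enorm
  have h2 : AEMeasurable (fun p : (Fin d → ℝ) × (Fin d → ℝ) =>
      ‖M.diff f p.2 p.1 ζ‖ₑ / ENNReal.ofReal (l ^ (γ - (ζ : ℝ))))
      (volume.prod (volume.restrict (scaledBall 𝔰 0 (4 * l)))) := by
    refine (h1.div_const _).mono_measure ?_
    have h := Measure.prod_restrict (μ := (volume : Measure (Fin d → ℝ)))
      (ν := (volume : Measure (Fin d → ℝ))) univ (scaledBall 𝔰 0 (4 * l))
    rw [Measure.restrict_univ] at h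
    rw [h]
    exact Measure.restrict_le_self
  refine (h2.lintegral_prod_right'.div_const (volume (scaledBall 𝔰 (0 : Fin d → ℝ) (4 * l)))).congr
    (Filter.Eventually.of_forall fun x => ?_)
  rw [avgIncrement, setLAverage_eq]

lemma aemeasurable_maximalIncrement (hd : 0 < d) (h𝔰 : ∀ i, 0 < 𝔰 i) {γ : ℝ} (hγ : 0 < γ)
    {f : (Fin d → ℝ) → R.ModelSpace} (hf : M.IsMeasurableInto γ f) {ζ : R.A}
    (hζ : ζ ∈ R.lowFinset γ) : AEMeasurable (M.maximalIncrement γ f ζ) volume :=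
  AEMeasurable.iSup fun _ => aemeasurable_avgIncrement hd h𝔰 hγ hf hζ _

lemma aemeasurable_majorant (hd : 0 < d) (h𝔰 : ∀ i, 0 < 𝔰 i) {γ : ℝ} (hγ : 0 < γ)
    {f : (Fin d → ℝ) → R.ModelSpace} (hf : M.IsMeasurableInto γ f) :
    AEMeasurable (M.majorant γ f) volume :=
  Finset.aemeasurable_fun_sum _ fun ζ hζ => (hf.2 ζ (mem_lowFinset.1 hζ)).enorm.add
    (aemeasurable_maximalIncrement hd h𝔰 hγ hf hζ)

variable (M) in
/-- The majorant is controlled by the Triebel–Lizorkin norm. -/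
lemma exists_eLpNorm_majorant_le (hd : 0 < d) (h𝔰 : ∀ i, 0 < 𝔰 i) {γ : ℝ} (hγ : 0 < γ) :
    ∃ C : ℝ≥0, ∀ (p q : ℝ≥0∞), 1 ≤ p → 1 ≤ q → ∀ f, M.IsMeasurableInto γ f →
      eLpNorm (M.majorant γ f) p volume ≤ C * M.normF γ p q f := by
  refine ⟨∑ ζ ∈ R.lowFinset γ, 
    (1 + ((2 : ℝ) ^ scalingSum 𝔰 * 2 ^ (γ - (ζ : ℝ))).toNNReal * 2),
    fun p q hp hq f hf => ?_⟩
  have hmeas := fun ζ hζ => (hf.2 ζ (mem_lowFinset.1 hζ)).enorm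
  have hmeas' := fun ζ hζ => aemeasurable_maximalIncrement hd h𝔰 hγ hf (ζ := ζ) hζ
  have hsum : M.majorant γ f = ∑ ζ ∈ R.lowFinset γ,
      ((fun x => ‖f x ζ‖ₑ) + M.maximalIncrement γ f ζ) := by
    funext x
    simp [majorant]
  rw [hsum]
  refine (eLpNorm_sum_le (fun ζ hζ => ((hmeas ζ hζ).add (hmeas' ζ hζ)).aestronglyMeasurable)
    hp).trans ?_
  push_cast
  rw [Finset.sum_mul]
  refine Finset.sum_le_sum fun ζ hζ => ?_
  have hζγ := mem_lowFinset.1 hζ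
  refine (eLpNorm_add_le (hmeas ζ hζ).aestronglyMeasurable (hmeas' ζ hζ).aestronglyMeasurable
    hp).trans ?_
  rw [add_mul, one_mul]
  refine add_le_add ?_ ?_
  · rw [eLpNorm_enorm]
    refine le_trans ?_ le_self_add
    exact le_iSup₂_of_le (f := fun (ζ : R.A) (_ : ζ ∈ R.lowIndices γ) =>
      eLpNorm (fun x => f x ζ) p volume) ζ hζγ le_rfl
  · refine (eLpNorm_le_const_mul (ENNReal.mul_ne_top ENNReal.ofReal_ne_top ENNReal.ofNat_ne_top)
      (Filter.Eventually.of_forall (maximalIncrement_le_eLpNorm h𝔰 f hζγ hq)) p).trans ?_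
    refine mul_le_mul' le_rfl (le_trans ?_ le_add_self)
    exact le_iSup₂_of_le (f := fun (ζ : R.A) (_ : ζ ∈ R.lowIndices γ) =>
      eLpNorm (fun x => eLpNorm (fun l => M.avgIncrement γ f ζ l x) q scaleMeasure) p volume)
      ζ hζγ le_rfl

end Model

/-! ### Pointwise bounds on increments by the majorant, and density of good points -/

namespace Model

open RegularityStructure

variable {d : ℕ} {𝔰 : Fin d → ℕ} {R : RegularityStructure.{u}} {M : Model 𝔰 R}

lemma maximalIncrement_le_majorant {γ : ℝ} (f : (Fin d → ℝ) → R.ModelSpace) {ζ : R.A}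
    (hζ : ζ ∈ R.lowFinset γ) (x : Fin d → ℝ) :
    M.maximalIncrement γ f ζ x ≤ M.majorant γ f x :=
  le_add_self.trans (Finset.single_le_sum
    (f := fun ζ => ‖f x ζ‖ₑ + M.maximalIncrement γ f ζ x) (fun _ _ => zero_le) hζ)

lemma enorm_le_majorant {γ : ℝ} (f : (Fin d → ℝ) → R.ModelSpace) {ζ : R.A}
    (hζ : ζ ∈ R.lowFinset γ) (x : Fin d → ℝ) : ‖f x ζ‖ₑ ≤ M.majorant γ f x :=
  le_self_add.trans (Finset.single_le_sum
    (f := fun ζ => ‖f x ζ‖ₑ + M.maximalIncrement γ f ζ x) (fun _ _ => zero_le) hζ)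

/-- The averaging ball at scale `l = ρ/2` is `Q(0, 4l) = Q(0, 2ρ)`; the maximal increment controls
that average. -/
lemma lintegral_diff_le (h𝔰 : ∀ i, 0 < 𝔰 i) {γ : ℝ} (f : (Fin d → ℝ) → R.ModelSpace) {ζ : R.A}
    (hζ : ζ ∈ R.lowFinset γ) {ρ : ℝ} (hρ : 0 < ρ) (hρ1 : ρ ≤ 1) (v : Fin d → ℝ) :
    ∫⁻ h in scaledBall 𝔰 0 (2 * ρ), ‖M.diff f h v ζ‖ₑ ≤
      ENNReal.ofReal (2 ^ scalingSum 𝔰 * (2 ^ scalingSum 𝔰 * 2 ^ (γ - ζ)) * ρ ^ (γ - ζ)) *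
        volume (scaledBall 𝔰 (0 : Fin d → ℝ) ρ) * M.majorant γ f v := by
  have hζγ := mem_lowFinset.1 hζ
  have hpos : (0 : ℝ) < (ρ / 2) ^ (γ - (ζ : ℝ)) := by positivity
  have hV0 := volume_scaledBall_ne_zero h𝔰 (0 : Fin d → ℝ) (r := 2 * ρ) (by positivity)
  have hVt := volume_scaledBall_ne_top h𝔰 (0 : Fin d → ℝ) (r := 2 * ρ) (by positivity)
  have hc0 : ENNReal.ofReal ((ρ / 2) ^ (γ - (ζ : ℝ))) ≠ 0 := by
    rwa [Ne, ENNReal.ofReal_eq_zero, not_le]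
  have h1 := (avgIncrement_le_maximalIncrement (M := M) h𝔰 f hζγ (l := ρ / 2) (by positivity)
    (by linarith) v).trans (mul_le_mul' le_rfl (maximalIncrement_le_majorant f hζ v))
  rw [avgIncrement, show 4 * (ρ / 2) = 2 * ρ by ring, setLAverage_eq] at h1
  simp_rw [ENNReal.div_eq_inv_mul (b := ENNReal.ofReal ((ρ / 2) ^ (γ - (ζ : ℝ))))] at h1
  rw [lintegral_const_mul' _ _ (ENNReal.inv_ne_top.2 hc0), ← ENNReal.div_eq_inv_mul,
    ENNReal.div_le_iff hV0 hVt, ENNReal.div_le_iff hc0 ENNReal.ofReal_ne_top] at h1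
  refine h1.trans ?_
  have h2 : ENNReal.ofReal ((ρ / 2) ^ (γ - (ζ : ℝ))) ≤ ENNReal.ofReal (ρ ^ (γ - (ζ : ℝ))) :=
    ENNReal.ofReal_le_ofReal (Real.rpow_le_rpow (by positivity) (by linarith) (by linarith))
  rw [volume_scaledBall_mul h𝔰 0 0 hρ.le zero_le_two]
  calc _ ≤ ENNReal.ofReal (2 ^ scalingSum 𝔰 * 2 ^ (γ - (ζ : ℝ))) * M.majorant γ f v *
        (ENNReal.ofReal (2 ^ scalingSum 𝔰) * volume (scaledBall 𝔰 (0 : Fin d → ℝ) ρ)) *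
        ENNReal.ofReal (ρ ^ (γ - (ζ : ℝ))) := by gcongr
    _ = _ := by
        rw [ENNReal.ofReal_mul (p := 2 ^ scalingSum 𝔰 * (2 ^ scalingSum 𝔰 * 2 ^ (γ - (ζ : ℝ))))
          (by positivity), ENNReal.ofReal_mul (p := 2 ^ scalingSum 𝔰)
          (q := 2 ^ scalingSum 𝔰 * 2 ^ (γ - (ζ : ℝ))) (by positivity)]
        ring

/-- Since `Q(x, ρ) ⊆ Q(v, 2ρ)`, one ball around `x` serves base points `v = x` and `v = y` alike. -/
lemma lintegral_increment_le (h𝔰 : ∀ i, 0 < 𝔰 i) {γ : ℝ}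
    (f : (Fin d → ℝ) → R.ModelSpace) {ζ : R.A} (hζ : ζ ∈ R.lowFinset γ) {ρ : ℝ} (hρ : 0 < ρ)
    (hρ1 : ρ ≤ 1) {x v : Fin d → ℝ} (hv : scaledNorm 𝔰 (x - v) ≤ ρ) :
    ∫⁻ z in scaledBall 𝔰 x ρ, ‖M.increment f z v ζ‖ₑ ≤
      ENNReal.ofReal (2 ^ scalingSum 𝔰 * (2 ^ scalingSum 𝔰 * 2 ^ (γ - ζ)) * ρ ^ (γ - ζ)) *
        volume (scaledBall 𝔰 (0 : Fin d → ℝ) ρ) * M.majorant γ f v := by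
  refine le_trans ?_ (lintegral_diff_le h𝔰 f hζ hρ hρ1 v)
  refine (lintegral_mono_set
    (scaledBall_subset_scaledBall h𝔰 (y := v) (r' := 2 * ρ) (by linarith))).trans_eq ?_
  have hpre : (fun h => v + h) ⁻¹' scaledBall 𝔰 v (2 * ρ) = scaledBall 𝔰 0 (2 * ρ) := by
    ext h
    simp [scaledBall]
  rw [← hpre]
  exact ((measurePreserving_add_left volume v).setLIntegral_comp_preimage_emb
    (measurableEmbedding_addLeft v) (fun z => ‖M.increment f z v ζ‖ₑ) _).symm

/-- Two points have a common neighbour at which both increments are small. -/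
lemma exists_common_point (hd : 0 < d) (h𝔰 : ∀ i, 0 < 𝔰 i) {γ : ℝ} (hγ : 0 < γ)
    {f : (Fin d → ℝ) → R.ModelSpace} (hf : M.IsMeasurableInto γ f) {m : ℝ} (hm : ∀ ζ : R.A, m ≤ ζ)
    {x y : Fin d → ℝ} {ρ : ℝ} (hρ : 0 < ρ) (hρ1 : ρ ≤ 1) (hxy : scaledNorm 𝔰 (y - x) ≤ ρ) :
    ∃ z ∈ scaledBall 𝔰 x ρ, ∀ v, v = x ∨ v = y → ∀ ζ ∈ R.lowFinset γ, ‖M.increment f z v ζ‖ₑ ≤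
      ENNReal.ofReal ((R.lowFinset γ).card * (2 ^ scalingSum 𝔰 * (2 ^ scalingSum 𝔰 * 2 ^ (γ - m)))
        * ρ ^ (γ - ζ)) * (M.majorant γ f x + M.majorant γ f y) := by
  set K : ℝ := 2 ^ scalingSum 𝔰 * (2 ^ scalingSum 𝔰 * 2 ^ (γ - m)) with hK
  have hV0 := volume_scaledBall_ne_zero h𝔰 x hρ
  have hVt := volume_scaledBall_ne_top h𝔰 x hρ.le
  have hc0 : ∀ ζ : R.A, ENNReal.ofReal (ρ ^ (γ - (ζ : ℝ))) ≠ 0 := fun ζ => by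
    rw [Ne, ENNReal.ofReal_eq_zero, not_le]; positivity
  -- Summing the normalised increments over both base points and all homogeneities lets a single
  -- `z`, where `Φ` is at most its average, serve all of them at once.
  let Φ : (Fin d → ℝ) → ℝ≥0∞ := fun z => ∑ ζ ∈ R.lowFinset γ,
    (ENNReal.ofReal (ρ ^ (γ - (ζ : ℝ))))⁻¹ * (‖M.increment f z x ζ‖ₑ + ‖M.increment f z y ζ‖ₑ)
  have hmeas : ∀ ζ ∈ R.lowFinset γ, ∀ v, AEMeasurable (fun z => ‖M.increment f z v ζ‖ₑ)
      (volume.restrict (scaledBall 𝔰 x ρ)) := fun ζ hζ v =>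
    (M.aestronglyMeasurable_increment hd h𝔰 hγ hf hζ v).enorm.restrict
  have hmeas' : ∀ ζ ∈ R.lowFinset γ, AEMeasurable (fun z => (ENNReal.ofReal (ρ ^ (γ - (ζ : ℝ))))⁻¹ *
      (‖M.increment f z x ζ‖ₑ + ‖M.increment f z y ζ‖ₑ))
      (volume.restrict (scaledBall 𝔰 x ρ)) := fun ζ hζ =>
    ((hmeas ζ hζ x).add (hmeas ζ hζ y)).const_mul _
  obtain ⟨z, hz, hle⟩ := exists_le_setLAverage hV0 hVt (f := Φ)
    (Finset.aemeasurable_fun_sum _ hmeas')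
  have hint : ∀ ζ ∈ R.lowFinset γ, ∀ v, scaledNorm 𝔰 (x - v) ≤ ρ →
      (ENNReal.ofReal (ρ ^ (γ - (ζ : ℝ))))⁻¹ * ∫⁻ z in scaledBall 𝔰 x ρ, ‖M.increment f z v ζ‖ₑ ≤
        ENNReal.ofReal K * volume (scaledBall 𝔰 x ρ) * M.majorant γ f v := fun ζ hζ v hv => by
    have hζγ := mem_lowFinset.1 hζ
    rw [← ENNReal.div_eq_inv_mul, ENNReal.div_le_iff (hc0 ζ) ENNReal.ofReal_ne_top]
    refine (lintegral_increment_le h𝔰 f hζ hρ hρ1 hv).trans ?_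
    rw [volume_scaledBall h𝔰 0 hρ.le, ← volume_scaledBall h𝔰 x hρ.le,
      ENNReal.ofReal_mul (by positivity)]
    have h2 : (2 : ℝ) ^ (γ - (ζ : ℝ)) ≤ 2 ^ (γ - m) :=
      Real.rpow_le_rpow_of_exponent_le one_le_two (by linarith [hm ζ])
    have h3 : ENNReal.ofReal (2 ^ scalingSum 𝔰 * (2 ^ scalingSum 𝔰 * 2 ^ (γ - (ζ : ℝ)))) ≤
        ENNReal.ofReal K := ENNReal.ofReal_le_ofReal (by rw [hK]; gcongr)
    calc _ ≤ ENNReal.ofReal K * ENNReal.ofReal (ρ ^ (γ - (ζ : ℝ))) *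
          volume (scaledBall 𝔰 x ρ) * M.majorant γ f v := by gcongr
      _ = _ := by ring
  have hΦ : Φ z ≤ ENNReal.ofReal ((R.lowFinset γ).card * K) *
      (M.majorant γ f x + M.majorant γ f y) := by
    refine hle.trans ?_
    rw [setLAverage_eq, ENNReal.div_le_iff hV0 hVt, lintegral_finsetSum' _ hmeas']
    calc _ ≤ ∑ ζ ∈ R.lowFinset γ, ENNReal.ofReal K * volume (scaledBall 𝔰 x ρ) *
          (M.majorant γ f x + M.majorant γ f y) := by
          refine Finset.sum_le_sum fun ζ hζ => ?_
          rw [lintegral_const_mul' _ _ (ENNReal.inv_ne_top.2 (hc0 ζ)),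
            lintegral_add_left' (hmeas ζ hζ x), mul_add, mul_add]
          refine add_le_add (hint ζ hζ x ?_) (hint ζ hζ y ?_)
          · rw [sub_self, scaledNorm_zero h𝔰]; exact hρ.le
          · rwa [scaledNorm_sub_comm]
      _ = _ := by
          rw [Finset.sum_const, nsmul_eq_mul, ENNReal.ofReal_mul (p := (R.lowFinset γ).card)
            (Nat.cast_nonneg _), ENNReal.ofReal_natCast]
          ring
  refine ⟨z, hz, fun v hv ζ hζ => ?_⟩
  have h1 : (ENNReal.ofReal (ρ ^ (γ - (ζ : ℝ))))⁻¹ * ‖M.increment f z v ζ‖ₑ ≤ Φ z := by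
    refine le_trans (mul_le_mul' le_rfl ?_) (Finset.single_le_sum
      (f := fun ζ : R.A => (ENNReal.ofReal (ρ ^ (γ - (ζ : ℝ))))⁻¹ *
        (‖M.increment f z x ζ‖ₑ + ‖M.increment f z y ζ‖ₑ)) (fun _ _ => zero_le) hζ)
    rcases hv with rfl | rfl
    · exact le_self_add
    · exact le_add_self
  have h2 := h1.trans hΦ
  rw [← ENNReal.div_eq_inv_mul, ENNReal.div_le_iff (hc0 ζ) ENNReal.ofReal_ne_top] at h2
  refine h2.trans_eq ?_
  rw [ENNReal.ofReal_mul (p := (R.lowFinset γ).card * K) (by positivity)]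
  ring

variable (M) in
/-- Pointwise bound on increments in terms of the majorant at the two endpoints. -/
lemma exists_increment_bound (hd : 0 < d) (h𝔰 : ∀ i, 0 < 𝔰 i) {γ : ℝ} (hγ : 0 < γ) :
    ∃ C : ℝ, 0 ≤ C ∧ ∀ f, M.IsMeasurableInto γ f → ∀ (x y : Fin d → ℝ) (ρ A : ℝ), 0 < ρ → ρ ≤ 1 →
      scaledNorm 𝔰 (y - x) ≤ ρ → 0 ≤ A → M.majorant γ f x ≤ ENNReal.ofReal A →
      M.majorant γ f y ≤ ENNReal.ofReal A → ∀ ζ ∈ R.lowFinset γ,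
        ‖M.increment f y x ζ‖ ≤ C * A * ρ ^ (γ - ζ) := by
  obtain ⟨m, hm⟩ := R.bddBelow
  obtain ⟨CΓ, hCΓ1, hCΓ⟩ := M.exists_reexpand_bound h𝔰 hγ
  set K : ℝ := (R.lowFinset γ).card * (2 ^ scalingSum 𝔰 * (2 ^ scalingSum 𝔰 * 2 ^ (γ - m))) with hK
  refine ⟨CΓ * (4 * K) * 2 ^ (γ - m), by positivity,
    fun f hf x y ρ A hρ hρ1 hxy hA hx hy ζ hζ => ?_⟩
  obtain ⟨z, hz, hzv⟩ := exists_common_point hd h𝔰 hγ hf (fun ζ => hm ζ.2) hρ hρ1 hxy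
  have hinc : ∀ v, v = x ∨ v = y → ∀ β ∈ R.lowFinset γ,
      ‖M.increment f z v β‖ ≤ 2 * K * A * ρ ^ (γ - β) := fun v hv β hβ => by
    have h := (hzv v hv β hβ).trans (mul_le_mul' le_rfl (add_le_add hx hy))
    rw [← ENNReal.ofReal_add hA hA, ← ENNReal.ofReal_mul (by positivity), ← ofReal_norm,
      ENNReal.ofReal_le_ofReal_iff (by positivity)] at h
    exact h.trans_eq (by rw [hK]; ring)
  have hyz : scaledNorm 𝔰 (y - z) ≤ 2 * ρ := by
    have h1 := scaledNorm_sub_le h𝔰 y x z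
    have h2 : scaledNorm 𝔰 (z - x) ≤ ρ := hz
    rw [scaledNorm_sub_comm z x] at h2
    linarith
  -- Apply `Γ_{y,z}` to the difference of two increments based at `x` and `y` but evaluated at the
  -- same `z`: the values `f z` cancel.
  have heq : M.increment f y x = M.reexpand y z (M.increment f z x - M.increment f z y) := by
    have h1 := increment_add (M := M) f y z y
    have h2 := increment_add (M := M) f y z x
    rw [increment_self] at h1
    rw [map_sub, ← h2, ← add_sub_cancel_left (M.increment f y z)
      (M.reexpand y z (M.increment f z y)), h1]
    abel
  rw [heq]
  have h := hCΓ y z (2 * ρ) (by positivity) (by linarith) hyz _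
    (Submodule.sub_mem _ (increment_mem_lowSpace hf.1 z x) (increment_mem_lowSpace hf.1 z y))
    γ (4 * K * A) (by positivity) ζ fun β hβ _ => by
      have hβγ := mem_lowFinset.1 hβ
      rw [DirectSum.sub_apply]
      refine (norm_sub_le _ _).trans ((add_le_add (hinc x (Or.inl rfl) β hβ)
        (hinc y (Or.inr rfl) β hβ)).trans ?_)
      have := Real.rpow_le_rpow hρ.le (show ρ ≤ 2 * ρ by linarith)
        (show 0 ≤ γ - (β : ℝ) by linarith)
      calc _ = 4 * K * A * ρ ^ (γ - (β : ℝ)) := by ring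
        _ ≤ _ := by gcongr
  refine h.trans ?_
  rw [Real.mul_rpow zero_le_two hρ.le]
  have h2 : (2 : ℝ) ^ (γ - (ζ : ℝ)) ≤ 2 ^ (γ - m) :=
    Real.rpow_le_rpow_of_exponent_le one_le_two (by linarith [hm ζ.2])
  calc _ ≤ CΓ * (4 * K * A * (2 ^ (γ - m) * ρ ^ (γ - (ζ : ℝ)))) := by gcongr
    _ = _ := by ring

/-- Chebyshev: a function exceeding the threshold throughout `Q(y, r/2)`, a ball of volume `2^d
(r/2)^N`, would have too large an `L^p` norm. -/
lemma exists_le_of_eLpNorm_le (h𝔰 : ∀ i, 0 < 𝔰 i) (hd : 0 < d) {H : (Fin d → ℝ) → ℝ≥0∞}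
    (hH : AEMeasurable H volume) {p S : ℝ} (hp : 1 ≤ p) (hS : 0 < S)
    (hle : eLpNorm H (ENNReal.ofReal p) volume ≤ ENNReal.ofReal S) (y : Fin d → ℝ) {r : ℝ}
    (hr : 0 < r) :
    ∃ z, H z ≤ ENNReal.ofReal (S * (2 ^ scalingSum 𝔰 * r ^ (-(scalingSum 𝔰 / p)))) ∧
      scaledNorm 𝔰 (y - z) ≤ r / 2 := by
  have hp0 : 0 < p := by linarith
  set N := scalingSum 𝔰 with hN
  set ε : ℝ := S * (2 ^ N * r ^ (-(N / p))) with hε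
  have hε0 : 0 < ε := by positivity
  by_contra! hcon
  have hsub : scaledBall 𝔰 y (r / 2) ⊆ {x | ENNReal.ofReal ε ≤ ‖H x‖ₑ} := fun z hz => by
    rw [mem_ofPred_eq, enorm_eq_self]
    by_contra! h
    refine absurd (hcon z h.le) (not_lt.2 ?_)
    rw [scaledNorm_sub_comm]
    exact hz
  have h1 := mul_meas_ge_le_pow_eLpNorm' (p := ENNReal.ofReal p) volume
    (by rw [Ne, ENNReal.ofReal_eq_zero, not_le]; exact hp0) ENNReal.ofReal_ne_top
    hH.aestronglyMeasurable (ENNReal.ofReal ε)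
  rw [ENNReal.toReal_ofReal hp0.le] at h1
  have h2 : ENNReal.ofReal ε ^ p * volume (scaledBall 𝔰 y (r / 2)) ≤ ENNReal.ofReal S ^ p :=
    (mul_le_mul' le_rfl (measure_mono hsub)).trans
      (h1.trans (ENNReal.rpow_le_rpow hle hp0.le))
  rw [volume_scaledBall h𝔰 y (by positivity), ENNReal.ofReal_rpow_of_pos hε0,
    ENNReal.ofReal_rpow_of_pos hS, ← ENNReal.ofReal_mul (by positivity),
    ENNReal.ofReal_le_ofReal_iff (by positivity), hε, Real.mul_rpow hS.le (by positivity),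
    Real.mul_rpow (by positivity) (by positivity), ← Real.rpow_mul hr.le,
    show -((N : ℝ) / p) * p = -N by field_simp, Real.rpow_neg hr.le, Real.rpow_natCast,
    div_pow] at h2
  have h3 : S ^ p * (((2 : ℝ) ^ N) ^ p * (r ^ N)⁻¹) * (2 ^ d * (r ^ N / 2 ^ N)) =
      S ^ p * ((2 ^ N) ^ p * 2 ^ d / 2 ^ N) := by field_simp
  have h4 : ((2 : ℝ) ^ N) ^ (1 : ℝ) ≤ (2 ^ N) ^ p :=
    Real.rpow_le_rpow_of_exponent_le (one_le_pow₀ one_le_two) hp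
  have h5 : (2 : ℝ) ≤ 2 ^ d := by
    simpa using pow_le_pow_right₀ (show (1 : ℝ) ≤ 2 by norm_num) (show 1 ≤ d from hd)
  rw [Real.rpow_one] at h4
  -- The factor `2^N` in the threshold, with `p ≥ 1`, compensates the halved radius; `2^d ≥ 2` then
  -- makes the contradiction strict.
  have h6 : (2 : ℝ) ≤ (2 ^ N) ^ p * 2 ^ d / 2 ^ N := by
    rw [le_div_iff₀ (by positivity), mul_comm (2 : ℝ)]
    gcongr
  rw [h3] at h2
  have h7 : 0 < S ^ p := by positivity
  nlinarith

variable (M) in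
-- Normalising by `S` gives `κ = |𝔰|/p` and `c = 2^{|𝔰|}` straight from the Chebyshev threshold.
-- Restricting `P` to points of finite majorant makes the passage to real numbers faithful.
lemma exists_isControlled_majorant (hd : 0 < d) (h𝔰 : ∀ i, 0 < 𝔰 i) {γ : ℝ} (hγ : 0 < γ) {p : ℝ}
    (hp : 1 ≤ p) :
    ∃ C : ℝ, 0 ≤ C ∧ ∀ f, M.IsMeasurableInto γ f → ∀ S : ℝ, 0 < S →
      eLpNorm (M.majorant γ f) (ENNReal.ofReal p) volume ≤ ENNReal.ofReal S →
      M.IsControlled γ (scalingSum 𝔰 / p) (2 ^ scalingSum 𝔰) C S f {x | M.majorant γ f x < ∞}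
        (fun x => (M.majorant γ f x / ENNReal.ofReal S).toReal) := by
  obtain ⟨C, hC0, hC⟩ := M.exists_increment_bound hd h𝔰 hγ
  refine ⟨C, hC0, fun f hf S hS hle => ?_⟩
  have hS0 : ENNReal.ofReal S ≠ 0 := by rwa [Ne, ENNReal.ofReal_eq_zero, not_le]
  have hfin : ∀ x, M.majorant γ f x < ∞ → M.majorant γ f x =
      ENNReal.ofReal (S * (M.majorant γ f x / ENNReal.ofReal S).toReal) := fun x hx => by
    rw [ENNReal.ofReal_mul hS.le, ENNReal.ofReal_toReal (ENNReal.div_ne_top hx.ne hS0),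
      ENNReal.mul_div_cancel hS0 ENNReal.ofReal_ne_top]
  refine ⟨hf.1, hS.le, fun _ => ENNReal.toReal_nonneg, fun x hx ζ hζ => ?_,
    fun y hy x hx ρ a hρ hρ1 hxy hya hxa ζ hζ => ?_, fun y r hr _ => ?_⟩
  · have h := enorm_le_majorant (M := M) f hζ x
    rw [hfin x hx, ← ofReal_norm, ENNReal.ofReal_le_ofReal_iff
      (mul_nonneg hS.le ENNReal.toReal_nonneg)] at h
    exact h
  · have ha : 0 ≤ a := ENNReal.toReal_nonneg.trans hya
    rw [mul_assoc C]
    refine hC f hf x y ρ (S * a) hρ hρ1 hxy (by positivity) ?_ ?_ ζ hζ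
    · rw [hfin x hx]
      exact ENNReal.ofReal_le_ofReal (mul_le_mul_of_nonneg_left hxa hS.le)
    · rw [hfin y hy]
      exact ENNReal.ofReal_le_ofReal (mul_le_mul_of_nonneg_left hya hS.le)
  · obtain ⟨z, hz, hyz⟩ := exists_le_of_eLpNorm_le h𝔰 hd
      (aemeasurable_majorant hd h𝔰 hγ hf) hp hS hle y hr
    have hzt : M.majorant γ f z < ∞ := hz.trans_lt ENNReal.ofReal_lt_top
    refine ⟨z, ⟨hzt, ?_⟩, hyz⟩
    rw [hfin z hzt, ENNReal.ofReal_le_ofReal_iff (by positivity)] at hz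
    exact le_of_mul_le_mul_left hz hS

end Model

/-! ### Integral estimates -/

/-- If `φ ≤ 1` then `φ^q ≤ φ`, so one integral handles every finite `q`. -/
lemma eLpNorm_lt_top_of_le_one {α : Type*} [MeasurableSpace α] {μ : Measure α} {φ : α → ℝ≥0∞}
    (h1 : ∀ᵐ x ∂μ, φ x ≤ 1) (hint : ∫⁻ x, φ x ∂μ < ∞) {q : ℝ≥0∞} (hq : 1 ≤ q) :
    eLpNorm φ q μ < ∞ := by
  rcases eq_or_ne q ∞ with rfl | hqt
  · rw [eLpNorm_exponent_top]
    exact (essSup_le_of_ae_le 1 (h1.mono fun x hx => by simpa using hx)).trans_lt ENNReal.one_lt_top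
  · have hq0 : q ≠ 0 := (zero_lt_one.trans_le hq).ne'
    have hq1 : 1 ≤ q.toReal := (ENNReal.ofReal_le_iff_le_toReal hqt).1 (by simpa using hq)
    rw [eLpNorm_eq_lintegral_rpow_enorm_toReal hq0 hqt]
    refine ENNReal.rpow_lt_top_of_nonneg (by positivity) (ne_of_lt ?_)
    refine (lintegral_mono_ae ?_).trans_lt hint
    filter_upwards [h1] with x hx
    rw [enorm_eq_self]
    exact (ENNReal.rpow_le_rpow_of_exponent_ge hx hq1).trans_eq (ENNReal.rpow_one _)

lemma ae_scaleMeasure_mem : ∀ᵐ l ∂Model.scaleMeasure, l ∈ Ioc (0 : ℝ) 1 :=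
  (withDensity_absolutelyContinuous _ _).ae_le (ae_restrict_mem measurableSet_Ioc)

lemma eLpNorm_rpow_scaleMeasure_lt_top {e : ℝ} (he : 0 < e) {q : ℝ≥0∞} (hq : 1 ≤ q) :
    eLpNorm (fun l : ℝ => ENNReal.ofReal (l ^ e)) q Model.scaleMeasure < ∞ := by
  refine eLpNorm_lt_top_of_le_one ?_ ?_ hq
  · filter_upwards [ae_scaleMeasure_mem] with l hl
    exact ENNReal.ofReal_le_one.2 (Real.rpow_le_one hl.1.le hl.2 he.le)
  · rw [Model.scaleMeasure, lintegral_withDensity_eq_lintegral_mul_non_measurable _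
      (by fun_prop) (Filter.Eventually.of_forall fun _ => ENNReal.ofReal_lt_top)]
    have h : IntegrableOn (fun l : ℝ => l ^ (e - 1)) (Ioc 0 1) := by
      have := intervalIntegral.intervalIntegrable_rpow' (a := 0) (b := 1)
        (show -1 < e - 1 by linarith)
      rwa [intervalIntegrable_iff_integrableOn_Ioc_of_le zero_le_one] at this
    refine lt_of_eq_of_lt (setLIntegral_congr_fun measurableSet_Ioc fun l hl => ?_)
      h.lintegral_lt_top
    rw [Pi.mul_apply, ← ENNReal.ofReal_mul (inv_nonneg.2 hl.1.le), Real.rpow_sub_one hl.1.ne']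
    congr 1
    ring

section

variable {d : ℕ} {𝔰 : Fin d → ℕ}

lemma ae_incrementMeasure_mem (hd : 0 < d) :
    ∀ᵐ h ∂Model.incrementMeasure 𝔰, h ∈ scaledBall 𝔰 0 1 :=
  (withDensity_absolutelyContinuous _ _).ae_le (ae_restrict_mem (measurableSet_scaledBall hd _ _))

lemma eLpNorm_rpow_incrementMeasure_lt_top (hd : 0 < d) (h𝔰 : ∀ i, 0 < 𝔰 i) {e : ℝ} (he : 0 < e)
    {q : ℝ≥0∞} (hq : 1 ≤ q) :
    eLpNorm (fun h => ENNReal.ofReal (scaledNorm 𝔰 h ^ e)) q (Model.incrementMeasure 𝔰) < ∞ := by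
  refine eLpNorm_lt_top_of_le_one ?_ ?_ hq
  · filter_upwards [ae_incrementMeasure_mem hd] with h hh
    exact ENNReal.ofReal_le_one.2 (Real.rpow_le_one (scaledNorm_nonneg _)
      (mem_scaledBall_zero.1 hh) he.le)
  · have hm : Measurable fun h : Fin d → ℝ =>
        ENNReal.ofReal (scaledNorm 𝔰 h ^ (-(scalingSum 𝔰 : ℝ))) :=
      ((continuous_scaledNorm hd).measurable.pow_const _).ennreal_ofReal
    rw [Model.incrementMeasure, lintegral_withDensity_eq_lintegral_mul_non_measurable _ hm
      (Filter.Eventually.of_forall fun _ => ENNReal.ofReal_lt_top)]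
    refine lt_of_le_of_lt ?_ (lintegral_scaledNorm_rpow_lt_top hd h𝔰 he)
    refine (lintegral_mono_set (scaledBall_mono 0 (by norm_num : (1 : ℝ) ≤ 4))).trans
      (lintegral_mono fun h => ?_)
    rw [Pi.mul_apply, ← ENNReal.ofReal_mul (Real.rpow_nonneg (scaledNorm_nonneg _) _)]
    refine ENNReal.ofReal_le_ofReal ?_
    rcases (scaledNorm_nonneg (𝔰 := 𝔰) h).eq_or_lt with h0 | h0
    · rw [← h0, Real.zero_rpow he.ne', mul_zero]
      exact Real.rpow_nonneg le_rfl _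
    · rw [← Real.rpow_add h0, sub_eq_neg_add]

/-- Minkowski's inequality for averages of translates. -/
lemma eLpNorm_lintegral_translate_le {ν : Measure (Fin d → ℝ)} [IsFiniteMeasure ν]
    (hν : ν ≪ volume) {K : (Fin d → ℝ) → ℝ≥0∞} (hK : AEMeasurable K volume) {p : ℝ} (hp : 1 ≤ p) :
    eLpNorm (fun x => ∫⁻ h, K (x + h) ∂ν) (ENNReal.ofReal p) volume ≤
      ν univ * eLpNorm K (ENNReal.ofReal p) volume := by
  have hp0 : 0 < p := by linarith
  have hpe : ENNReal.ofReal p ≠ 0 := by rwa [Ne, ENNReal.ofReal_eq_zero, not_le]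
  have hKx : ∀ x, AEMeasurable (fun h => K (x + h)) ν := fun x =>
    (hK.comp_quasiMeasurePreserving
      (measurePreserving_add_left volume x).quasiMeasurePreserving).mono_ac hν
  have hprod : AEMeasurable (fun z : (Fin d → ℝ) × (Fin d → ℝ) => K (z.1 + z.2) ^ p)
      (volume.prod ν) := by
    refine AEMeasurable.pow_const ?_ p
    refine (hK.comp_quasiMeasurePreserving (Measure.quasiMeasurePreserving_snd.comp
      (measurePreserving_prod_add volume volume).quasiMeasurePreserving)).mono_ac ?_
    exact Measure.AbsolutelyContinuous.rfl.prod hν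
  -- Hölder on the finite measure `ν`; Fubini and translation invariance then finish the estimate.
  have hpt : ∀ x, (∫⁻ h, K (x + h) ∂ν) ^ p ≤ ν univ ^ (p - 1) * ∫⁻ h, K (x + h) ^ p ∂ν := by
    intro x
    have h := eLpNorm_le_eLpNorm_mul_rpow_measure_univ (p := 1) (q := ENNReal.ofReal p)
      (by rwa [← ENNReal.ofReal_one, ENNReal.ofReal_le_ofReal_iff hp0.le])
      (hKx x).aestronglyMeasurable
    rw [eLpNorm_one_eq_lintegral_enorm, eLpNorm_eq_lintegral_rpow_enorm_toReal hpe
      ENNReal.ofReal_ne_top, ENNReal.toReal_ofReal hp0.le] at h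
    simp only [enorm_eq_self, ENNReal.toReal_one] at h
    refine (ENNReal.rpow_le_rpow h hp0.le).trans_eq ?_
    rw [ENNReal.mul_rpow_of_nonneg _ _ hp0.le, ← ENNReal.rpow_mul, ← ENNReal.rpow_mul,
      one_div_mul_cancel hp0.ne', ENNReal.rpow_one, mul_comm]
    congr 2
    field_simp
  have hν0 : ν univ ^ (p - 1) ≠ ∞ := ENNReal.rpow_ne_top_of_nonneg (by linarith) (measure_ne_top _ _)
  have htot : ∫⁻ x, (∫⁻ h, K (x + h) ∂ν) ^ p ≤ ν univ ^ p * ∫⁻ x, K x ^ p := by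
    calc _ ≤ ∫⁻ x, ν univ ^ (p - 1) * ∫⁻ h, K (x + h) ^ p ∂ν := lintegral_mono hpt
      _ = ν univ ^ (p - 1) * ∫⁻ h, ∫⁻ x, K (x + h) ^ p ∂volume ∂ν := by
          rw [lintegral_const_mul' _ _ hν0, lintegral_lintegral_swap hprod]
      _ = ν univ ^ (p - 1) * (ν univ * ∫⁻ x, K x ^ p) := by
          simp_rw [fun h => lintegral_add_right_eq_self (μ := (volume : Measure (Fin d → ℝ)))
            (fun x => K x ^ p) h]
          rw [lintegral_const, mul_comm (ν univ)]
      _ = _ := by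
          rw [← mul_assoc]
          congr 1
          -- The exponent law used below needs a nonzero base.
          rcases eq_or_ne (ν univ) 0 with h0 | h0
          · rw [h0, mul_zero, ENNReal.zero_rpow_of_pos hp0]
          · nth_rewrite 2 [← ENNReal.rpow_one (ν univ)]
            rw [← ENNReal.rpow_add _ _ h0 (measure_ne_top _ _), sub_add_cancel]
  rw [eLpNorm_eq_lintegral_rpow_enorm_toReal hpe ENNReal.ofReal_ne_top,
    eLpNorm_eq_lintegral_rpow_enorm_toReal hpe ENNReal.ofReal_ne_top, ENNReal.toReal_ofReal hp0.le]
  simp only [enorm_eq_self]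
  refine (ENNReal.rpow_le_rpow htot (by positivity)).trans_eq ?_
  rw [ENNReal.mul_rpow_of_nonneg _ _ (by positivity), ← ENNReal.rpow_mul,
    mul_one_div_cancel hp0.ne', ENNReal.rpow_one]

/-- Powers of normalised functions: `‖S (H/S)^{p'/p}‖_{L^p} ≤ S` if `‖H‖_{L^{p'}} ≤ S`. -/
lemma eLpNorm_rpow_div_le {H : (Fin d → ℝ) → ℝ≥0∞} {p p' S : ℝ} (hp : 0 < p)
    (hp' : 0 < p') (hS : 0 < S)
    (hle : eLpNorm H (ENNReal.ofReal p') volume ≤ ENNReal.ofReal S) :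
    eLpNorm (fun x => ENNReal.ofReal S * (H x / ENNReal.ofReal S) ^ (p' / p)) (ENNReal.ofReal p)
      volume ≤ ENNReal.ofReal S := by
  have hpe : ∀ {p : ℝ}, 0 < p → ENNReal.ofReal p ≠ 0 := fun h => by
    rwa [Ne, ENNReal.ofReal_eq_zero, not_le]
  have hS0 := hpe hS
  have hint : ∫⁻ x, H x ^ p' ≤ ENNReal.ofReal S ^ p' := by
    rw [eLpNorm_eq_lintegral_rpow_enorm_toReal (hpe hp') ENNReal.ofReal_ne_top,
      ENNReal.toReal_ofReal hp'.le, one_div, ENNReal.rpow_inv_le_iff hp'] at hle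
    simpa only [enorm_eq_self] using hle
  have hSp : ENNReal.ofReal S ^ p' ≠ 0 := (ENNReal.rpow_pos (pos_iff_ne_zero.2 hS0)
    ENNReal.ofReal_ne_top).ne'
  have hSp' : ENNReal.ofReal S ^ p' ≠ ∞ := ENNReal.rpow_ne_top_of_nonneg hp'.le
    ENNReal.ofReal_ne_top
  have hpt : ∀ x, (ENNReal.ofReal S * (H x / ENNReal.ofReal S) ^ (p' / p)) ^ p =
      ENNReal.ofReal S ^ p * (ENNReal.ofReal S ^ p')⁻¹ * H x ^ p' := fun x => by
    rw [ENNReal.mul_rpow_of_nonneg _ _ hp.le, ← ENNReal.rpow_mul, div_mul_cancel₀ _ hp.ne',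
      ENNReal.div_rpow_of_nonneg _ _ hp'.le, ENNReal.div_eq_inv_mul, mul_assoc]
  rw [eLpNorm_eq_lintegral_rpow_enorm_toReal (hpe hp) ENNReal.ofReal_ne_top,
    ENNReal.toReal_ofReal hp.le, one_div, ENNReal.rpow_inv_le_iff hp]
  simp only [enorm_eq_self, hpt]
  rw [lintegral_const_mul' _ _ (ENNReal.mul_ne_top
    (ENNReal.rpow_ne_top_of_nonneg hp.le ENNReal.ofReal_ne_top) (ENNReal.inv_ne_top.2 hSp)),
    mul_assoc]
  refine mul_le_of_le_one_right' ?_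
  rw [← ENNReal.div_eq_inv_mul]
  exact ENNReal.div_le_of_le_mul (by rwa [one_mul])

end

/-! ### Embeddings -/

namespace Model

open RegularityStructure

variable {d : ℕ} {𝔰 : Fin d → ℕ} {R : RegularityStructure.{u}} (M : Model 𝔰 R)

/-- Take the minimum of `g` and the finitely many points of `𝒜` in `[γ, g]`; it exceeds `γ` because
`γ ∉ 𝒜`. -/
lemma exists_gap {γ g : ℝ} (hγ : γ ∉ R.A) (hg : γ < g) :
    ∃ γ₂, γ < γ₂ ∧ γ₂ ≤ g ∧ ∀ δ : R.A, γ ≤ δ → γ₂ ≤ δ := by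
  have hne : (insert g (R.locallyFinite γ g).toFinset).Nonempty := Finset.insert_nonempty _ _
  refine ⟨(insert g (R.locallyFinite γ g).toFinset).min' hne, ?_,
    Finset.min'_le _ _ (Finset.mem_insert_self _ _), fun δ hδ => ?_⟩
  · rw [Finset.lt_min'_iff]
    intro a ha
    rcases Finset.mem_insert.1 ha with rfl | ha
    · exact hg
    · have ha' := (Set.Finite.mem_toFinset _).1 ha
      exact lt_of_le_of_ne ha'.2.1 fun h => hγ (h ▸ ha'.1)
  · rcases le_or_gt (δ : ℝ) g with h | h
    · have hmem : (δ : ℝ) ∈ R.A ∩ Icc γ g := ⟨δ.2, hδ, h⟩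
      exact Finset.min'_le _ _ (Finset.mem_insert_of_mem
        ((Set.Finite.mem_toFinset _).2 hmem))
    · exact (Finset.min'_le _ _ (Finset.mem_insert_self _ _)).trans h.le

/-- Pointwise bounds on the projection `𝒬_{<γ} f` in terms of an `L^p` function. -/
lemma exists_pointwise_bound (hd : 0 < d) (h𝔰 : ∀ i, 0 < 𝔰 i) {γ γ' p p' : ℝ} (hγ : 0 < γ)
    (hγA : γ ∉ R.A) (hp' : 1 ≤ p') (hpp' : p' ≤ p)
    (hγγ' : γ < γ' - (scalingSum 𝔰 : ℝ) * (1 / p' - 1 / p)) :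
    ∃ C : ℝ, 0 < C ∧ ∃ γ₂, γ < γ₂ ∧ ∀ f, M.IsMeasurableInto γ' f → ∀ S : ℝ, 0 < S →
      eLpNorm (M.majorant γ' f) (ENNReal.ofReal p') volume ≤ ENNReal.ofReal S →
      ∃ K : (Fin d → ℝ) → ℝ≥0∞, AEMeasurable K volume ∧
        eLpNorm K (ENNReal.ofReal p) volume ≤ ENNReal.ofReal S ∧
        ∀ ζ ∈ R.lowFinset γ, (∀ x, ‖R.projLow γ (f x) ζ‖ₑ ≤ ENNReal.ofReal C * K x) ∧
          ∀ h x, scaledNorm 𝔰 h ≤ 4 → ‖M.diff (fun x => R.projLow γ (f x)) h x ζ‖ₑ ≤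
            ENNReal.ofReal (C * scaledNorm 𝔰 h ^ (γ₂ - ζ)) * (K x + K (x + h)) := by
  have hp0 : 0 < p := by linarith
  have hp0' : 0 < p' := by linarith
  set N := scalingSum 𝔰 with hN
  have hN0 : (0 : ℝ) < N := by
    have h1 : 𝔰 ⟨0, hd⟩ ≤ N :=
      Finset.single_le_sum (f := 𝔰) (fun _ _ => Nat.zero_le _) (Finset.mem_univ _)
    exact_mod_cast (h𝔰 _).trans_le h1
  set κ : ℝ := N / p' with hκ
  set θ : ℝ := p' / p with hθ
  have hκ0 : 0 < κ := by positivity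
  have hθ0 : 0 < θ := by positivity
  have hθ1 : θ ≤ 1 := (div_le_one hp0).2 hpp'
  -- The interpolation loss coincides with the Sobolev loss in the hypothesis.
  have hκθ : κ * (1 - θ) = N * (1 / p' - 1 / p) := by rw [hκ, hθ]; field_simp
  have hle : γ ≤ γ' := by
    have : 0 ≤ κ * (1 - θ) := mul_nonneg hκ0.le (by linarith)
    linarith
  have hγ' : 0 < γ' := hγ.trans_le hle
  rw [← hκθ] at hγγ'
  obtain ⟨γ₂, h₂, h₂', hgap⟩ := exists_gap hγA hγγ'
  have hc : (1 : ℝ) ≤ 2 ^ N := one_le_pow₀ one_le_two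
  obtain ⟨C₀, hC₀, hctrl⟩ := M.exists_isControlled_majorant hd h𝔰 hγ' hp'
  obtain ⟨C₁, hC₁, hloc⟩ := M.exists_norm_le_of_le h𝔰 hγ' hκ0 hc hC₀ hθ0 hθ1
  obtain ⟨C₂, hC₂, hinc⟩ := M.exists_increment_projLow_bound h𝔰 hγ' hle hκ0 hc hC₀ hθ0 hθ1 h₂
    h₂' hgap
  have hC : 0 < max 1 (max C₁ C₂) := lt_max_of_lt_left one_pos
  refine ⟨max 1 (max C₁ C₂), hC, γ₂, h₂, fun f hf S hS hSle => ?_⟩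
  set C := max 1 (max C₁ C₂)
  have hC1 : C₁ ≤ C := (le_max_left _ _).trans (le_max_right _ _)
  have hC2 : C₂ ≤ C := (le_max_right _ _).trans (le_max_right _ _)
  have hS0 : ENNReal.ofReal S ≠ 0 := by rwa [Ne, ENNReal.ofReal_eq_zero, not_le]
  have hcon := hctrl f hf S hS hSle
  set w : (Fin d → ℝ) → ℝ := fun x => (M.majorant γ' f x / ENNReal.ofReal S).toReal with hw
  set K : (Fin d → ℝ) → ℝ≥0∞ := fun x =>
    ENNReal.ofReal S * (M.majorant γ' f x / ENNReal.ofReal S) ^ θ with hK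
  have hwx : ∀ x, 0 ≤ w x ^ θ := fun x => Real.rpow_nonneg ENNReal.toReal_nonneg _
  have hKfin : ∀ x, M.majorant γ' f x < ∞ → K x = ENNReal.ofReal (S * w x ^ θ) := fun x hx => by
    rw [ENNReal.ofReal_mul hS.le, ← ENNReal.ofReal_rpow_of_nonneg ENNReal.toReal_nonneg hθ0.le,
      ENNReal.ofReal_toReal (ENNReal.div_ne_top hx.ne hS0)]
  -- Where the majorant is infinite so is `K`, and the bounds hold trivially; they are thus valid at
  -- every point, without exceptional null sets.
  have hKtop : ∀ x, ¬ M.majorant γ' f x < ∞ → K x = ∞ := fun x hx => by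
    simp only [hK]
    rw [not_lt_top_iff.1 hx, ENNReal.top_div_of_ne_top ENNReal.ofReal_ne_top,
      ENNReal.top_rpow_of_pos hθ0, ENNReal.mul_top hS0]
  refine ⟨K, ((aemeasurable_majorant hd h𝔰 hγ' hf).div_const _ |>.pow_const _).const_mul _,
    eLpNorm_rpow_div_le hp0 hp0' hS hSle, fun ζ hζ => ⟨fun x => ?_, fun h x hh => ?_⟩⟩
  · have hζγ := mem_lowFinset.1 hζ
    rw [projLow_apply_of_lt _ hζγ]
    by_cases hx : M.majorant γ' f x < ∞
    · have h := hloc S f _ w hcon x hx ζ (mem_lowFinset.2 (hζγ.trans_le hle)) (by linarith)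
      rw [hKfin x hx, ← ENNReal.ofReal_mul hC.le, ← ofReal_norm]
      refine ENNReal.ofReal_le_ofReal (h.trans ?_)
      rw [mul_assoc]
      exact mul_le_mul_of_nonneg_right hC1 (mul_nonneg hS.le (hwx x))
    · rw [hKtop x hx, ENNReal.mul_top (by rwa [Ne, ENNReal.ofReal_eq_zero, not_le])]
      exact le_top
  -- A vanishing prefactor would spoil the infinite case, as `0 * ∞ = 0`; at `h = 0` the increment
  -- itself is zero.
  · rcases (scaledNorm_nonneg (𝔰 := 𝔰) h).eq_or_lt with h0 | h0
    · rw [eq_zero_of_scaledNorm_eq_zero h𝔰 h0.symm, diff_eq_increment, add_zero, increment_self,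
        DirectSum.zero_apply, enorm_zero]
      exact zero_le
    · have hpos : 0 < C * scaledNorm 𝔰 h ^ (γ₂ - (ζ : ℝ)) := by positivity
      have hne : ENNReal.ofReal (C * scaledNorm 𝔰 h ^ (γ₂ - (ζ : ℝ))) ≠ 0 := by
        rwa [Ne, ENNReal.ofReal_eq_zero, not_le]
      by_cases hx : M.majorant γ' f x < ∞
      · by_cases hxh : M.majorant γ' f (x + h) < ∞
        · have hb := hinc S f _ w hcon (x + h) hxh x hx (by rwa [add_sub_cancel_left]) ζ hζ
          rw [add_sub_cancel_left] at hb
          rw [hKfin x hx, hKfin _ hxh, ← ENNReal.ofReal_add (mul_nonneg hS.le (hwx _))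
            (mul_nonneg hS.le (hwx _)), ← ENNReal.ofReal_mul hpos.le, ← ofReal_norm,
            diff_eq_increment]
          refine ENNReal.ofReal_le_ofReal (hb.trans ?_)
          have h1 : 0 ≤ S * (scaledNorm 𝔰 h ^ (γ₂ - (ζ : ℝ)) * (w x ^ θ + w (x + h) ^ θ)) :=
            mul_nonneg hS.le (mul_nonneg (by positivity) (add_nonneg (hwx _) (hwx _)))
          calc _ = C₂ * (S * (scaledNorm 𝔰 h ^ (γ₂ - (ζ : ℝ)) *
                (w x ^ θ + w (x + h) ^ θ))) := by ring
            _ ≤ C * (S * (scaledNorm 𝔰 h ^ (γ₂ - (ζ : ℝ)) *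
                (w x ^ θ + w (x + h) ^ θ))) := mul_le_mul_of_nonneg_right hC2 h1
            _ = _ := by ring
        · rw [hKtop _ hxh, add_top, ENNReal.mul_top hne]
          exact le_top
      · rw [hKtop _ hx, top_add, ENNReal.mul_top hne]
        exact le_top

lemma isMeasurableInto_projLow {γ γ' : ℝ} (h : γ ≤ γ') {f : (Fin d → ℝ) → R.ModelSpace}
    (hf : M.IsMeasurableInto γ' f) : M.IsMeasurableInto γ fun x => R.projLow γ (f x) := by
  refine ⟨fun x => projLow_mem_lowSpace _, fun ζ hζ => ?_⟩
  have hζ' : (ζ : ℝ) < γ := hζ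
  simp_rw [projLow_apply_of_lt _ hζ']
  exact hf.2 ζ (lt_of_lt_of_le (α := ℝ) hζ' h)

variable {M}

lemma localNorm_le {γ C S p : ℝ} {g : (Fin d → ℝ) → R.ModelSpace}
    {K : (Fin d → ℝ) → ℝ≥0∞}
    (hKp : eLpNorm K (ENNReal.ofReal p) volume ≤ ENNReal.ofReal S)
    (hg : ∀ ζ ∈ R.lowFinset γ, ∀ x, ‖g x ζ‖ₑ ≤ ENNReal.ofReal C * K x) :
    M.localNorm γ (ENNReal.ofReal p) g ≤ ENNReal.ofReal C * ENNReal.ofReal S := by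
  refine iSup₂_le fun ζ hζ => ?_
  rw [← eLpNorm_enorm]
  exact (eLpNorm_le_const_mul ENNReal.ofReal_ne_top
    (Filter.Eventually.of_forall (hg ζ (mem_lowFinset.2 hζ))) _).trans (by gcongr)

/-- Bound on the Besov seminorm from pointwise bounds on increments. -/
lemma exists_translationNormB_le (hd : 0 < d) (h𝔰 : ∀ i, 0 < 𝔰 i) {γ γ₂ C p : ℝ} (hC : 0 < C)
    (h₂ : γ < γ₂) (hp : 1 ≤ p) {q : ℝ≥0∞} (hq : 1 ≤ q) :
    ∃ C' : ℝ≥0, ∀ (S : ℝ) (g : (Fin d → ℝ) → R.ModelSpace) (K : (Fin d → ℝ) → ℝ≥0∞),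
      AEMeasurable K volume → eLpNorm K (ENNReal.ofReal p) volume ≤ ENNReal.ofReal S →
      (∀ ζ ∈ R.lowFinset γ, ∀ h x, scaledNorm 𝔰 h ≤ 4 → ‖M.diff g h x ζ‖ₑ ≤
        ENNReal.ofReal (C * scaledNorm 𝔰 h ^ (γ₂ - ζ)) * (K x + K (x + h))) →
      M.translationNormB γ (ENNReal.ofReal p) q g ≤ C' * ENNReal.ofReal S := by
  have hΘ := eLpNorm_rpow_incrementMeasure_lt_top hd h𝔰 (sub_pos.2 h₂) hq
  set Θ := eLpNorm (fun h => ENNReal.ofReal (scaledNorm 𝔰 h ^ (γ₂ - γ))) q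
    (incrementMeasure 𝔰)
  have hpe : (1 : ℝ≥0∞) ≤ ENNReal.ofReal p := by rwa [ENNReal.one_le_ofReal]
  refine ⟨C.toNNReal * 2 * Θ.toNNReal, fun S g K hK hKp hg => iSup₂_le fun ζ hζ => ?_⟩
  have hζγ : (ζ : ℝ) < γ := hζ
  have hsum : ∀ h, eLpNorm (fun x => K x + K (x + h)) (ENNReal.ofReal p) volume ≤
      2 * ENNReal.ofReal S := fun h => by
    have hmp := measurePreserving_add_right (volume : Measure (Fin d → ℝ)) h
    refine (eLpNorm_add_le hK.aestronglyMeasurable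
      (hK.comp_quasiMeasurePreserving hmp.quasiMeasurePreserving).aestronglyMeasurable hpe).trans ?_
    rw [eLpNorm_comp_measurePreserving hK.aestronglyMeasurable hmp, ← two_mul]
    gcongr
  have hinner : ∀ᵐ h ∂incrementMeasure 𝔰, eLpNorm (fun x : Fin d → ℝ =>
      ‖M.diff g h x ζ‖ₑ / ENNReal.ofReal (scaledNorm 𝔰 h ^ (γ - (ζ : ℝ)))) (ENNReal.ofReal p)
      volume ≤ (ENNReal.ofReal C * (2 * ENNReal.ofReal S)) *
        ENNReal.ofReal (scaledNorm 𝔰 h ^ (γ₂ - γ)) := by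
    filter_upwards [ae_incrementMeasure_mem hd] with h hh
    have hh1 : scaledNorm 𝔰 h ≤ 1 := mem_scaledBall_zero.1 hh
    refine (eLpNorm_le_const_mul (c := ENNReal.ofReal C *
      ENNReal.ofReal (scaledNorm 𝔰 h ^ (γ₂ - γ))) (g := fun x => K x + K (x + h))
      (by finiteness) (Filter.Eventually.of_forall fun x => ?_) _).trans ?_
    · have hb := hg ζ (mem_lowFinset.2 hζ) h x (by linarith)
      rcases (scaledNorm_nonneg (𝔰 := 𝔰) h).eq_or_lt with h0 | h0
      · rw [← h0, Real.zero_rpow (by linarith), mul_zero, ENNReal.ofReal_zero, zero_mul] at hb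
        rw [nonpos_iff_eq_zero.1 hb, ENNReal.zero_div]
        exact zero_le
      · refine ENNReal.div_le_of_le_mul (hb.trans_eq ?_)
        -- The weight uses up `‖h‖^{γ-ζ}` and the surplus `‖h‖^{γ₂-γ}` remains for the integral over
        -- `h`.
        rw [show γ₂ - (ζ : ℝ) = (γ₂ - γ) + (γ - ζ) by ring, Real.rpow_add h0, ← mul_assoc,
          ENNReal.ofReal_mul (by positivity), ENNReal.ofReal_mul hC.le]
        ring
    · calc _ ≤ ENNReal.ofReal C * ENNReal.ofReal (scaledNorm 𝔰 h ^ (γ₂ - γ)) *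
            (2 * ENNReal.ofReal S) := by gcongr; exact hsum h
        _ = _ := by ring
  refine (eLpNorm_le_const_mul (by finiteness) hinner q).trans_eq ?_
  push_cast
  rw [ENNReal.coe_toNNReal hΘ.ne]
  change _ * Θ = ENNReal.ofReal C * 2 * Θ * _
  ring

/-- Bound on the Triebel–Lizorkin seminorm from pointwise bounds on increments. -/
lemma exists_translationNormF_le (hd : 0 < d) (h𝔰 : ∀ i, 0 < 𝔰 i) {γ γ₂ C p : ℝ} (hC : 0 < C)
    (h₂ : γ < γ₂) (hp : 1 ≤ p) {q : ℝ≥0∞} (hq : 1 ≤ q) :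
    ∃ C' : ℝ≥0, ∀ (S : ℝ) (g : (Fin d → ℝ) → R.ModelSpace) (K : (Fin d → ℝ) → ℝ≥0∞),
      AEMeasurable K volume → eLpNorm K (ENNReal.ofReal p) volume ≤ ENNReal.ofReal S →
      (∀ ζ ∈ R.lowFinset γ, ∀ h x, scaledNorm 𝔰 h ≤ 4 → ‖M.diff g h x ζ‖ₑ ≤
        ENNReal.ofReal (C * scaledNorm 𝔰 h ^ (γ₂ - ζ)) * (K x + K (x + h))) →
      M.translationNormF γ (ENNReal.ofReal p) q g ≤ C' * ENNReal.ofReal S := by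
  obtain ⟨m, hm⟩ := R.bddBelow
  have : Nonempty (Fin d) := ⟨⟨0, hd⟩⟩
  set N := scalingSum 𝔰 with hN
  have hN0 : (0 : ℝ) < N := by
    have h1 : 𝔰 ⟨0, hd⟩ ≤ N :=
      Finset.single_le_sum (f := 𝔰) (fun _ _ => Nat.zero_le _) (Finset.mem_univ _)
    exact_mod_cast (h𝔰 _).trans_le h1
  -- The surplus supplies two factors `l^e`: one makes the `L^q_λ` norm finite, the other turns the
  -- average of `K` into an integrable convolution. The cap `e ≤ N` makes the kernel `‖h‖^{e-N}`
  -- nonincreasing in `‖h‖`.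
  set e : ℝ := min ((γ₂ - γ) / 2) N with he
  have he0 : 0 < e := lt_min (by linarith) hN0
  have he1 : 2 * e ≤ γ₂ - γ := by have := min_le_left ((γ₂ - γ) / 2) (N : ℝ); linarith
  have he2 : e ≤ N := min_le_right _ _
  have hΘ := eLpNorm_rpow_scaleMeasure_lt_top he0 hq
  set Θ := eLpNorm (fun l : ℝ => ENNReal.ofReal (l ^ e)) q scaleMeasure
  have hmφ : Measurable fun h : Fin d → ℝ => ENNReal.ofReal (scaledNorm 𝔰 h ^ (e - (N : ℝ))) :=
    ((continuous_scaledNorm hd).measurable.pow_const _).ennreal_ofReal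
  set ν : Measure (Fin d → ℝ) := (volume.restrict (scaledBall 𝔰 0 4)).withDensity
    (fun h => ENNReal.ofReal (scaledNorm 𝔰 h ^ (e - (N : ℝ)))) with hν
  have hνfin : IsFiniteMeasure ν :=
    isFiniteMeasure_withDensity (lintegral_scaledNorm_rpow_lt_top hd h𝔰 he0).ne
  have hνac : ν ≪ volume :=
    (withDensity_absolutelyContinuous _ _).trans Measure.restrict_le_self.absolutelyContinuous
  have hpe : (1 : ℝ≥0∞) ≤ ENNReal.ofReal p := by rwa [ENNReal.one_le_ofReal]
  refine ⟨(C * 4 ^ (γ₂ - m)).toNNReal * Θ.toNNReal * (1 + (ν univ).toNNReal),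
    fun S g K hK hKp hg => iSup₂_le fun ζ hζ => ?_⟩
  have hζγ : (ζ : ℝ) < γ := hζ
  have hmζ : m ≤ ζ := hm ζ.2
  set D : ℝ := C * 4 ^ (γ₂ - m) with hD
  have hD0 : 0 < D := by positivity
  set Ψ : (Fin d → ℝ) → ℝ≥0∞ := fun x => ∫⁻ h, K (x + h) ∂ν with hΨ
  have hmean : ∀ (x : Fin d → ℝ) (l : ℝ), l ∈ Ioc (0 : ℝ) 1 →
      ⨍⁻ h in scaledBall 𝔰 0 (4 * l), ‖M.diff g h x ζ‖ₑ / ENNReal.ofReal (l ^ (γ - (ζ : ℝ)))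
        ∂volume ≤ ENNReal.ofReal D * (K x + Ψ x) * ENNReal.ofReal (l ^ e) := by
    rintro x l ⟨hl, hl1⟩
    have h4l : 0 < 4 * l := by positivity
    have hV0 := volume_scaledBall_ne_zero h𝔰 0 h4l
    have hVt := volume_scaledBall_ne_top h𝔰 0 h4l.le
    have hstep : ∀ h ∈ scaledBall 𝔰 0 (4 * l),
        ‖M.diff g h x ζ‖ₑ / ENNReal.ofReal (l ^ (γ - (ζ : ℝ))) ≤
          ENNReal.ofReal (D * l ^ (2 * e)) * (K x + K (x + h)) := fun h hh => by
      have hh4 : scaledNorm 𝔰 h ≤ 4 * l := mem_scaledBall_zero.1 hh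
      refine ENNReal.div_le_of_le_mul
        ((hg ζ (mem_lowFinset.2 hζ) h x (by linarith)).trans ?_)
      rw [mul_right_comm, ← ENNReal.ofReal_mul (by positivity)]
      refine mul_le_mul' (ENNReal.ofReal_le_ofReal ?_) le_rfl
      have e1 : scaledNorm 𝔰 h ^ (γ₂ - (ζ : ℝ)) ≤ (4 * l) ^ (γ₂ - (ζ : ℝ)) :=
        Real.rpow_le_rpow (scaledNorm_nonneg _) hh4 (by linarith)
      have e2 : (4 : ℝ) ^ (γ₂ - (ζ : ℝ)) ≤ 4 ^ (γ₂ - m) :=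
        Real.rpow_le_rpow_of_exponent_le (by norm_num) (by linarith)
      have e3 : l ^ (γ₂ - (ζ : ℝ)) ≤ l ^ (2 * e) * l ^ (γ - (ζ : ℝ)) := by
        rw [← Real.rpow_add hl]
        exact Real.rpow_le_rpow_of_exponent_ge hl hl1 (by linarith)
      rw [Real.mul_rpow (by norm_num) hl.le] at e1
      calc _ ≤ C * (4 ^ (γ₂ - m) * (l ^ (2 * e) * l ^ (γ - (ζ : ℝ)))) := by
            gcongr
            exact e1.trans (by gcongr)
        _ = _ := by rw [hD]; ring
    -- On `Q(0, 4l)` the kernel is at least `(4l)^{e-N}`, which is `(4l)^e` divided by the volume up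
    -- to the factor `2^d ≥ 1`. Hence `l^e` times the average of `K(x + ·)` is at most `Ψ x`,
    -- uniformly in `l`.
    have hball : ENNReal.ofReal (l ^ e) * (∫⁻ h in scaledBall 𝔰 0 (4 * l), K (x + h)) ≤
        volume (scaledBall 𝔰 (0 : Fin d → ℝ) (4 * l)) * Ψ x := by
      have hΨx : Ψ x = ∫⁻ h in scaledBall 𝔰 0 4,
          ENNReal.ofReal (scaledNorm 𝔰 h ^ (e - (N : ℝ))) * K (x + h) := by
        rw [hΨ]
        simp only [hν]
        rw [lintegral_withDensity_eq_lintegral_mul_non_measurable _ hmφ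
          (Filter.Eventually.of_forall fun _ => ENNReal.ofReal_lt_top)]
        rfl
      rw [hΨx, ← lintegral_const_mul' _ _ ENNReal.ofReal_ne_top, ← lintegral_const_mul' _ _ hVt]
      refine le_trans ?_ (lintegral_mono_set (scaledBall_mono 0 (by linarith : 4 * l ≤ 4)))
      have hne : ∀ᵐ h ∂(volume : Measure (Fin d → ℝ)), h ≠ 0 := by
        simp [ae_iff]
      refine lintegral_mono_ae ?_
      filter_upwards [ae_restrict_mem (measurableSet_scaledBall hd _ _), ae_restrict_of_ae hne]
        with h hh hh0
      have hh4 : scaledNorm 𝔰 h ≤ 4 * l := mem_scaledBall_zero.1 hh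
      have hpos : 0 < scaledNorm 𝔰 h := (scaledNorm_nonneg _).lt_of_ne fun h0 =>
        hh0 (eq_zero_of_scaledNorm_eq_zero h𝔰 h0.symm)
      rw [← mul_assoc]
      gcongr
      rw [volume_scaledBall h𝔰 0 h4l.le, ← ENNReal.ofReal_mul (by positivity)]
      refine ENNReal.ofReal_le_ofReal ?_
      have e1 : l ^ e ≤ (4 * l) ^ e := Real.rpow_le_rpow hl.le (by linarith) he0.le
      have e2 : (4 * l) ^ (e - (N : ℝ)) ≤ scaledNorm 𝔰 h ^ (e - (N : ℝ)) :=
        Real.rpow_le_rpow_of_nonpos hpos hh4 (by linarith)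
      have e3 : (4 * l) ^ e = (4 * l) ^ N * (4 * l) ^ (e - (N : ℝ)) := by
        rw [← Real.rpow_natCast, ← Real.rpow_add h4l, add_sub_cancel]
      have e4 : (1 : ℝ) ≤ 2 ^ d := one_le_pow₀ one_le_two
      calc l ^ e ≤ 1 * ((4 * l) ^ N * (4 * l) ^ (e - (N : ℝ))) := by rw [one_mul, ← e3]; exact e1
        _ ≤ 2 ^ d * ((4 * l) ^ N * scaledNorm 𝔰 h ^ (e - (N : ℝ))) := by gcongr
        _ = _ := by ring
    rw [setLAverage_eq, ENNReal.div_le_iff hV0 hVt]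
    refine (setLIntegral_mono' (measurableSet_scaledBall hd _ _) hstep).trans ?_
    rw [lintegral_const_mul' _ _ ENNReal.ofReal_ne_top, lintegral_add_left measurable_const,
      setLIntegral_const]
    have hl2 : ENNReal.ofReal (D * l ^ (2 * e)) =
        ENNReal.ofReal D * ENNReal.ofReal (l ^ e) * ENNReal.ofReal (l ^ e) := by
      rw [← ENNReal.ofReal_mul hD0.le, ← ENNReal.ofReal_mul (by positivity), two_mul,
        Real.rpow_add hl, mul_assoc D]
    have hle1 : ENNReal.ofReal (l ^ e) ≤ 1 :=
      ENNReal.ofReal_le_one.2 (Real.rpow_le_one hl.le hl1 he0.le)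
    calc _ = ENNReal.ofReal D * ENNReal.ofReal (l ^ e) *
          (ENNReal.ofReal (l ^ e) * (K x * volume (scaledBall 𝔰 (0 : Fin d → ℝ) (4 * l))) +
            ENNReal.ofReal (l ^ e) * ∫⁻ h in scaledBall 𝔰 0 (4 * l), K (x + h)) := by
          rw [hl2]; ring
      _ ≤ ENNReal.ofReal D * ENNReal.ofReal (l ^ e) *
          (K x * volume (scaledBall 𝔰 (0 : Fin d → ℝ) (4 * l)) +
            volume (scaledBall 𝔰 (0 : Fin d → ℝ) (4 * l)) * Ψ x) :=
          mul_le_mul' le_rfl (add_le_add (mul_le_of_le_one_left' hle1) hball)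
      _ = _ := by ring
  have hx : ∀ x, eLpNorm (fun l : ℝ => ⨍⁻ h in scaledBall 𝔰 0 (4 * l),
      ‖M.diff g h x ζ‖ₑ / ENNReal.ofReal (l ^ (γ - (ζ : ℝ))) ∂volume) q scaleMeasure ≤
      ENNReal.ofReal D * Θ * (K x + Ψ x) := fun x => by
    -- With an infinite factor the right side is infinite only if `Θ ≠ 0`, which is checked on the
    -- scales `(1/2, 1]`.
    rcases eq_or_ne (K x + Ψ x) ∞ with ht | ht
    · have hΘ0 : Θ ≠ 0 := by
        have h1 := le_eLpNorm_of_le_on (μ := scaleMeasure) (p := q)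
          (g := fun l : ℝ => ENNReal.ofReal (l ^ e)) (measurableSet_Ioc)
          (a := ENNReal.ofReal ((1 / 2) ^ e)) (fun l hl => ENNReal.ofReal_le_ofReal
            (Real.rpow_le_rpow (by norm_num) hl.1.le he0.le))
          (half_le_scaleMeasure_Ioc (l := 1 / 2) (by norm_num) le_rfl) hq
        intro h0
        change _ ≤ 2 * Θ at h1
        rw [h0, mul_zero, nonpos_iff_eq_zero, ENNReal.ofReal_eq_zero] at h1
        exact absurd h1 (not_le.2 (by positivity))
      rw [ht, ENNReal.mul_top (mul_ne_zero (by rwa [Ne, ENNReal.ofReal_eq_zero, not_le]) hΘ0)]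
      exact le_top
    · refine (eLpNorm_le_const_mul (ENNReal.mul_ne_top ENNReal.ofReal_ne_top ht)
        (ae_scaleMeasure_mem.mono fun l hl => hmean x l hl) q).trans_eq ?_
      change _ * Θ = _
      ring
  refine (eLpNorm_le_const_mul (by finiteness) (Filter.Eventually.of_forall hx) _).trans ?_
  have hΨm : AEMeasurable Ψ volume := by
    have h1 : AEMeasurable (fun z : (Fin d → ℝ) × (Fin d → ℝ) => K (z.1 + z.2))
        (volume.prod ν) :=
      (hK.comp_quasiMeasurePreserving (Measure.quasiMeasurePreserving_snd.comp
        (measurePreserving_prod_add volume volume).quasiMeasurePreserving)).mono_ac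
        (Measure.AbsolutelyContinuous.rfl.prod hνac)
    exact h1.lintegral_prod_right'
  have hsum : eLpNorm (fun x => K x + Ψ x) (ENNReal.ofReal p) volume ≤
      (1 + ν univ) * ENNReal.ofReal S := by
    refine (eLpNorm_add_le hK.aestronglyMeasurable hΨm.aestronglyMeasurable hpe).trans ?_
    rw [add_mul, one_mul]
    refine add_le_add hKp ((eLpNorm_lintegral_translate_le hνac hK hp).trans ?_)
    gcongr
  refine (mul_le_mul' le_rfl hsum).trans_eq ?_
  push_cast
  rw [ENNReal.coe_toNNReal hΘ.ne, ENNReal.coe_toNNReal (measure_ne_top _ _), ← mul_assoc]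
  rfl

variable (M)

/-- Boundedness of `𝒬_{<γ}` from a Triebel–Lizorkin space into a space of lower regularity. -/
lemma exists_norm_projLow_le (hd : 0 < d) (h𝔰 : ∀ i, 0 < 𝔰 i) {γ γ' p p' : ℝ} (hγ : 0 < γ)
    (hγA : γ ∉ R.A) (hp' : 1 ≤ p') (hpp' : p' ≤ p)
    (hγγ' : γ < γ' - (scalingSum 𝔰 : ℝ) * (1 / p' - 1 / p)) {q r : ℝ≥0∞} (hq : 1 ≤ q)
    (hr : 1 ≤ r) :
    ∃ C : ℝ≥0, ∀ f ∈ M.spaceF γ' (ENNReal.ofReal p') q,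
      M.normF γ (ENNReal.ofReal p) r (fun x => R.projLow γ (f x)) ≤
          C * M.normF γ' (ENNReal.ofReal p') q f ∧
        M.normB γ (ENNReal.ofReal p) r (fun x => R.projLow γ (f x)) ≤
          C * M.normF γ' (ENNReal.ofReal p') q f := by
  have hp : 1 ≤ p := hp'.trans hpp'
  have hle : γ ≤ γ' := by
    have h1 : 1 / p ≤ 1 / p' := one_div_le_one_div_of_le (by linarith) hpp'
    have : 0 ≤ (scalingSum 𝔰 : ℝ) * (1 / p' - 1 / p) := by
      have := sub_nonneg.2 h1
      positivity
    linarith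
  obtain ⟨C₀, hC₀⟩ := M.exists_eLpNorm_majorant_le hd h𝔰 (hγ.trans_le hle)
  obtain ⟨C, hC, γ₂, h₂, hpt⟩ := M.exists_pointwise_bound hd h𝔰 hγ hγA hp' hpp' hγγ'
  obtain ⟨CF, hCF⟩ := exists_translationNormF_le (M := M) hd h𝔰 hC h₂ hp hr
  obtain ⟨CB, hCB⟩ := exists_translationNormB_le (M := M) hd h𝔰 hC h₂ hp hr
  -- The normalisation divides by `S`, which has to be positive even if the norm of `f` is zero; `ε`
  -- ensures this and is removed by `hlim`.
  have key : ∀ f ∈ M.spaceF γ' (ENNReal.ofReal p') q, ∀ ε : ℝ≥0, 0 < ε →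
      M.normF γ (ENNReal.ofReal p) r (fun x => R.projLow γ (f x)) ≤
          (C.toNNReal + CF + CB) * (C₀ * M.normF γ' (ENNReal.ofReal p') q f + ε) ∧
        M.normB γ (ENNReal.ofReal p) r (fun x => R.projLow γ (f x)) ≤
          (C.toNNReal + CF + CB) * (C₀ * M.normF γ' (ENNReal.ofReal p') q f + ε) := by
    intro f hf ε hε
    have hfin : C₀ * M.normF γ' (ENNReal.ofReal p') q f + ε ≠ ∞ :=
      ENNReal.add_ne_top.2 ⟨ENNReal.mul_ne_top ENNReal.coe_ne_top hf.2.ne, ENNReal.coe_ne_top⟩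
    set S := (C₀ * M.normF γ' (ENNReal.ofReal p') q f + ε).toReal with hS
    have hSe : ENNReal.ofReal S = C₀ * M.normF γ' (ENNReal.ofReal p') q f + ε :=
      ENNReal.ofReal_toReal hfin
    have hS0 : 0 < S := ENNReal.toReal_pos (by simp [hε.ne']) hfin
    have hmaj := (hC₀ (ENNReal.ofReal p') q (by rwa [ENNReal.one_le_ofReal]) hq f hf.1).trans
      (le_self_add (b := (ε : ℝ≥0∞)))
    rw [← hSe] at hmaj ⊢
    obtain ⟨K, hK, hKp, hb⟩ := hpt f hf.1 S hS0 hmaj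
    have h1 := localNorm_le (M := M) (γ := γ) hKp fun ζ hζ => (hb ζ hζ).1
    have h2 := hCF S _ K hK hKp fun ζ hζ => (hb ζ hζ).2
    have h3 := hCB S _ K hK hKp fun ζ hζ => (hb ζ hζ).2
    constructor
    · refine (add_le_add h1 h2).trans ?_
      rw [← add_mul]
      exact mul_le_mul' le_self_add le_rfl
    · refine (add_le_add h1 h3).trans ?_
      rw [← add_mul, add_right_comm]
      exact mul_le_mul' le_self_add le_rfl
  have hlim : ∀ {a b c : ℝ≥0∞}, c ≠ ∞ → (∀ ε : ℝ≥0, 0 < ε → a ≤ c * (b + ε)) → a ≤ c * b := by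
    intro a b c hc h
    lift c to ℝ≥0 using hc
    refine ENNReal.le_of_forall_pos_le_add fun ε hε _ => ?_
    refine (h (ε / (c + 1)) (by positivity)).trans ?_
    rw [mul_add]
    gcongr
    rw [← ENNReal.coe_mul, ENNReal.coe_le_coe, mul_div_assoc', div_le_iff₀ (by positivity), mul_comm]
    gcongr
    exact le_self_add
  refine ⟨(C.toNNReal + CF + CB) * C₀, fun f hf => ?_⟩
  push_cast
  rw [mul_assoc]
  exact ⟨hlim (by finiteness) fun ε hε => (key f hf ε hε).1,
    hlim (by finiteness) fun ε hε => (key f hf ε hε).2⟩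

/-- Embeddings of Triebel–Lizorkin spaces into Triebel–Lizorkin and Besov spaces of lower
regularity. -/
lemma embeds_of_lt (hd : 0 < d) (h𝔰 : ∀ i, 0 < 𝔰 i) {γ γ' p p' : ℝ} (hγ : 0 < γ)
    (hγγ : γ ≤ γ') (hγA : γ ∉ R.A) (hp' : 1 ≤ p') (hpp' : p' ≤ p)
    (hγγ' : γ < γ' - (scalingSum 𝔰 : ℝ) * (1 / p' - 1 / p)) {q r : ℝ≥0∞} (hq : 1 ≤ q)
    (hr : 1 ≤ r) :
    R.Embeds γ (M.spaceF γ' (ENNReal.ofReal p') q) (M.spaceF γ (ENNReal.ofReal p) r)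
        (M.normF γ' (ENNReal.ofReal p') q) (M.normF γ (ENNReal.ofReal p) r) ∧
      R.Embeds γ (M.spaceF γ' (ENNReal.ofReal p') q) (M.spaceB γ (ENNReal.ofReal p) r)
        (M.normF γ' (ENNReal.ofReal p') q) (M.normB γ (ENNReal.ofReal p) r) := by
  obtain ⟨C, hC⟩ := M.exists_norm_projLow_le hd h𝔰 hγ hγA hp' hpp' hγγ' hq hr
  have hfin : ∀ f ∈ M.spaceF γ' (ENNReal.ofReal p') q,
      C * M.normF γ' (ENNReal.ofReal p') q f < ∞ := fun f hf =>
    ENNReal.mul_lt_top ENNReal.coe_lt_top hf.2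
  exact ⟨⟨C, fun f hf => ⟨⟨M.isMeasurableInto_projLow hγγ hf.1,
      (hC f hf).1.trans_lt (hfin f hf)⟩, (hC f hf).1⟩⟩,
    ⟨C, fun f hf => ⟨⟨M.isMeasurableInto_projLow hγγ hf.1,
      (hC f hf).2.trans_lt (hfin f hf)⟩, (hC f hf).2⟩⟩⟩

end Model

theorem mainTheorem5 {d : ℕ} (hd : 0 < d) (𝔰 : Fin d → ℕ) (h𝔰 : ∀ i, 0 < 𝔰 i)
    (R : RegularityStructure.{u}) (M : Model 𝔰 R)
    (γ γ' : ℝ) (hγ : 0 < γ) (hγγ' : γ ≤ γ') (hγA : γ ∉ R.A)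
    (p p' : ℝ) (hp : 1 ≤ p) (hp' : 1 ≤ p')
    (q q' r : ℝ≥0∞) (hq : 1 ≤ q) (hq' : 1 ≤ q') (hr : 1 ≤ r) :
    (q < q' → γ < γ' →
      R.Embeds γ
        (M.spaceF γ' (ENNReal.ofReal p) q') (M.spaceF γ (ENNReal.ofReal p) q)
        (M.normF γ' (ENNReal.ofReal p) q') (M.normF γ (ENNReal.ofReal p) q)) ∧
    (p' < p → γ < γ' - (scalingSum 𝔰 : ℝ) * (1 / p' - 1 / p) →
      R.Embeds γ
        (M.spaceF γ' (ENNReal.ofReal p') q) (M.spaceF γ (ENNReal.ofReal p) r)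
        (M.normF γ' (ENNReal.ofReal p') q) (M.normF γ (ENNReal.ofReal p) r)) ∧
    (p' < p → γ < γ' - (scalingSum 𝔰 : ℝ) * (1 / p' - 1 / p) →
      R.Embeds γ
        (M.spaceF γ' (ENNReal.ofReal p') q)
        (M.spaceB γ (ENNReal.ofReal p) (ENNReal.ofReal p'))
        (M.normF γ' (ENNReal.ofReal p') q)
        (M.normB γ (ENNReal.ofReal p) (ENNReal.ofReal p'))) := by
  refine ⟨fun _ h => ?_, fun h h' => ?_, fun h h' => ?_⟩
  -- With equal integrability exponents the Sobolev loss vanishes and the condition reduces to `γ <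
  -- γ'`.
  · exact (M.embeds_of_lt hd h𝔰 hγ hγγ' hγA hp le_rfl (by simpa using h) hq' hq).1
  · exact (M.embeds_of_lt hd h𝔰 hγ hγγ' hγA hp' h.le h' hq hr).1
  · exact (M.embeds_of_lt hd h𝔰 hγ hγγ' hγA hp' h.le h' hq
      (by rwa [ENNReal.one_le_ofReal])).2
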